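/- Let $\Lambda$ be an associative unital $\mathbb{C}$-algebra, for example the contraction algebra, a finite-dimensional symmetric $4$-periodic algebra. (No property of $\Lambda$ is needed.) Let $\Lambda[\imath^{\pm1}]=\Lambda\otimes_{\mathbb C}\mathbb C[\imath^{\pm1}]$ be the graded algebra with $\Lambda$ in degree $0$ and $\imath$ central of degree $|\imath|=-2$. All Hochschild cohomology is bigraded by a horizontal (Hochschild) degree $p\in\mathbb Z$ and an internal degree; $HH^{p,q}$ is zero for $p<0$, and for odd $q$ because $\Lambda[\imath^{\pm1}]$ lives in even degrees. $HH(\Lambda)=HH^{\bullet}(\Lambda,\Lambda)$ is the ordinary Hochschild cohomology over $\mathbb C$, in internal degree $0$. The cup product on cochains is $(x\cdot y)(a_1,\dots,a_{p+q})=(-1)^{pq}x(a_1,\dots,a_p)\,y(a_{p+1},\dots,a_{p+q})$ for $x$, $y$ of horizontal degrees $p$, $q$. The Gerstenhaber bracket of such $x,y$ is $[x,y]=x\{y\}-(-1)^{(p-1)(q-1)}y\{x\}$, where $x\{y\}(a_1,\dots,a_{p+q-1})=\sum_i(-1)^{(q-1)i}x(a_1,\dots,a_i,y(a_{i+1},\dots,a_{i+q}),\dots)$.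 Let $\delta\in HH^{1,0}(\Lambda[\imath^{\pm1}])$ be the fractional Euler class, i.e. the class of the derivation $a\mapsto\frac{|a|}{2}a$, and let $\imath\in HH^{0,-2}(\Lambda[\imath^{\pm1}])$ be the class of the central element $\imath$. 1. The bigraded algebra $HH(\Lambda[\imath^{\pm1}])=HH(\Lambda[\imath^{\pm1}],\Lambda[\imath^{\pm1}])$ is graded commutative, and there is an isomorphism of graded algebras $$\Phi\colon HH(\Lambda)[\imath^{\pm1},\delta]\xrightarrow{\ \cong\ }HH(\Lambda[\imath^{\pm1}])$$ that sends $1$, $\imath$, $\delta$ to $1$, $\imath$, $\delta$. Here the left-hand side is the free graded commutative $HH(\Lambda)$-algebra on an invertible generator $\imath$ of bidegree $(0,-2)$ and a generator $\delta$ of bidegree $(1,0)$, so that $\delta^2=0$ and the elements of bidegree $(p,-2w)$ are the $(x+y\delta)\imath^w$ with $x\in HH^p(\Lambda)$, $y\in HH^{p-1}(\Lambda)$. Under $\Phi$ the Gerstenhaber bracket of $HH(\Lambda[\imath^{\pm1}])$ corresponds to the bracket which extends that of $HH(\Lambda)$, by graded antisymmetry and the graded Leibniz rule $[a,bc]=[a,b]c+(-1)^{(|a|-1)|b|}b[a,c]$,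 from the relations $$[\imath,HH(\Lambda)]=0,\quad[\imath,\imath]=0,\quad[\delta,HH(\Lambda)]=0,\quad[\delta,\imath]=-\imath.$$ Explicitly, for $x\in HH^p(\Lambda)$, $y\in HH^{p-1}(\Lambda)$, $x'\in HH^q(\Lambda)$, $y'\in HH^{q-1}(\Lambda)$ and $w,w'\in\mathbb Z$, $$[(x+y\delta)\imath^w,(x'+y'\delta)\imath^{w'}]=(X+Y\delta)\,\imath^{w+w'},$$ $$X=[x,x']-w'\,yx'+(-1)^{q-1}w\,xy',\qquad Y=[x,y']+(-1)^{q-1}[y,x']+(w-w')\,yy'.$$ 2. Multiplication by the powers of $\imath$ on coefficients gives an isomorphism of graded algebras $$\Psi\colon HH(\Lambda)[\imath^{\pm1}]\xrightarrow{\ \cong\ }HH(\Lambda,\Lambda[\imath^{\pm1}]).$$ The morphism $j^*\colon HH(\Lambda[\imath^{\pm1}])\to HH(\Lambda,\Lambda[\imath^{\pm1}])$ induced by the inclusion $j\colon\Lambda\hookrightarrow\Lambda[\imath^{\pm1}]$ of the degree $0$ part is the projection $j^*\Phi((x+y\delta)\imath^w)=\Psi(x\imath^w)$. Its kernel is the ideal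 generated by $\delta$, i.e. it consists in each bidegree of the elements $z\cdot\delta$. 3. For a $\Lambda$-bimodule $M$ that is projective as a right module, let $\widehat{HH}^n(\Lambda,M)=\operatorname{colim}_k\underline{\mathrm{Hom}}(\Omega^{n+k}\Lambda,\Omega^kM)$ be Tate–Hochschild cohomology ($n\in\mathbb Z$). Here $\underline{\mathrm{Hom}}$ denotes bimodule homomorphisms modulo those that factor through a projective bimodule, and $\Omega$ denotes syzygies of bimodules; if $\Lambda$ is a Frobenius algebra, this is the space of morphisms $\Lambda\to M[n]$ in the stable category of $\Lambda$-bimodules. Products are given by composition in the stable category and the multiplication of coefficients, with the sign $(-1)^{pq}$ in degrees $p,q$. There is an isomorphism of graded algebras $$\Theta\colon\widehat{HH}(\Lambda,\Lambda)[\imath^{\pm1}]\xrightarrow{\ \cong\ }\widehat{HH}(\Lambda,\Lambda[\imath^{\pm1}]),$$ where $\widehat{HH}(\Lambda,\Lambda[\imath^{\pm1}])$ is the direct sum over $w\in\mathbb Z$ of its parts $\widehat{HH}(\Lambda,\Lambda\imath^w)$ of internal degree $-2w$. The comparison map $HH(\Lambda,\Lambda[\imath^{\pm1}])\to\widehat{HH}(\Lambda,\Lambda[\imath^{\pm1}])$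 corresponds, under $\Psi$ and $\Theta$, to the $\imath$-linear extension of the comparison map $HH(\Lambda)\to\widehat{HH}(\Lambda,\Lambda)$. -/

import Mathlib

open scoped TensorProduct

universe u

namespace HochschildTate

/-! ### Bimodules -/

/-- A bimodule over a (noncommutative) `ℂ`-algebra `A`; the base field acts centrally.
`l a x` is `a · x` and `r a x` is `x · a`. -/
structure Bim (A : Type u) [Ring A] [Algebra ℂ A] where
  carrier : Type u
  [addCommGroup : AddCommGroup carrier]
  [module : Module ℂ carrier]
  l : A →ₗ[ℂ] carrier →ₗ[ℂ] carrier
  r : A →ₗ[ℂ] carrier →ₗ[ℂ] carrier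
  one_l : ∀ x, l 1 x = x
  mul_l : ∀ a b x, l (a * b) x = l a (l b x)
  one_r : ∀ x, r 1 x = x
  mul_r : ∀ a b x, r (a * b) x = r b (r a x)
  l_r : ∀ a b x, l a (r b x) = r b (l a x)

attribute [instance] Bim.addCommGroup Bim.module

/-- The diagonal bimodule `A`. -/
def Bim.diag (A : Type u) [Ring A] [Algebra ℂ A] : Bim A where
  carrier := A
  l := LinearMap.mul ℂ A
  r := (LinearMap.mul ℂ A).flip
  one_l := by simp
  mul_l := by simp [mul_assoc]
  one_r := by simp
  mul_r := by simp [mul_assoc]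
  l_r := by simp [mul_assoc]

section Bimodules

variable {A : Type u} [Ring A] [Algebra ℂ A]

/-- A linear map between bimodules is a bimodule homomorphism. -/
structure Bim.IsHom {X Y : Bim A} (φ : X.carrier →ₗ[ℂ] Y.carrier) : Prop where
  map_l : ∀ a x, φ (X.l a x) = Y.l a (φ x)
  map_r : ∀ a x, φ (X.r a x) = Y.r a (φ x)

/-- A pairing `M ⊗_A N → P` of bimodules, i.e. a balanced `ℂ`-bilinear map which is a
homomorphism of bimodules. -/
structure Pairing (M N P : Bim A) where
  toFun : M.carrier →ₗ[ℂ] N.carrier →ₗ[ℂ] P.carrier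
  map_l : ∀ a x y, toFun (M.l a x) y = P.l a (toFun x y)
  balanced : ∀ a x y, toFun (M.r a x) y = toFun x (N.l a y)
  map_r : ∀ a x y, toFun x (N.r a y) = P.r a (toFun x y)

/-- The multiplication of `A` as a pairing. -/
def Pairing.diag (A : Type u) [Ring A] [Algebra ℂ A] :
    Pairing (Bim.diag A) (Bim.diag A) (Bim.diag A) where
  toFun := LinearMap.mul ℂ A
  map_l a x y := mul_assoc (G := A) a x y
  balanced a x y := mul_assoc (G := A) x a y
  map_r a x y := (mul_assoc (G := A) x y a).symm

end Bimodules

/-! ### The Hochschild complex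

Cochains are functions on finite sequences (lists) of elements of `A`.  A cochain of degree `p` is
multilinear and supported on the sequences of length `p`; these are the linear maps `A^{⊗p} → X`. -/

section Cochains

variable {A : Type u} [Ring A] [Algebra ℂ A]

/-- The functions on finite sequences of elements of `A` which are `ℂ`-multilinear. -/
def ML (A : Type u) [Ring A] [Algebra ℂ A] (X : Type u) [AddCommGroup X] [Module ℂ X] :
    Submodule ℂ (List A → X) where
  carrier := {f | ∀ l₁ l₂, IsLinearMap ℂ fun a => f (l₁ ++ a :: l₂)}
  add_mem' hf hg l₁ l₂ := ((hf l₁ l₂).mk' _ + (hg l₁ l₂).mk' _).isLinear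
  zero_mem' _ _ := (0 : A →ₗ[ℂ] X).isLinear
  smul_mem' c _ hf l₁ l₂ := (c • (hf l₁ l₂).mk' _).isLinear

/-- The cochains of degree `p`, i.e. `Hom_ℂ(A^{⊗p}, X)` (zero for negative `p`). -/
def Coch (X : Bim A) (p : ℤ) : Submodule ℂ (List A → X.carrier) where
  carrier := {f | f ∈ ML A X.carrier ∧ ∀ l, (l.length : ℤ) ≠ p → f l = 0}
  add_mem' := by
    rintro f g ⟨hf, hf'⟩ ⟨hg, hg'⟩
    exact ⟨add_mem hf hg, fun l h => by simp [hf' l h, hg' l h]⟩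
  zero_mem' := ⟨zero_mem _, by simp⟩
  smul_mem' := by
    rintro c f ⟨hf, hf'⟩
    exact ⟨Submodule.smul_mem _ c hf, fun l h => by simp [hf' l h]⟩

/-- Replace the entries in positions `i`, `i + 1` by their product. -/
def mergeAt : ℕ → List A → List A
  | 0, a :: b :: t => (a * b) :: t
  | i + 1, a :: t => a :: mergeAt i t
  | _, t => t

/-- The part of the Hochschild differential, evaluated at `(a, t)`, which does not involve the left
action: `∑ᵢ (-1)^(i+1) f(…, aᵢ aᵢ₊₁, …) + (-1)^(n+1) f(a₀, …, aₙ₋₁) aₙ`, where `a₀ = a` and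
`t = (a₁, …, aₙ)`. -/
def inner (X : Bim A) (f : List A → X.carrier) (a : A) (t : List A) : X.carrier :=
  (∑ i ∈ Finset.range t.length, (-1 : ℤ) ^ (i + 1) • f (mergeAt i (a :: t))) +
    (-1 : ℤ) ^ (t.length + 1) •
      X.r ((a :: t).getLast (List.cons_ne_nil a t)) (f (a :: t).dropLast)

/-- The Hochschild differential
`(df)(a₀, …, aₙ) = a₀ f(a₁, …, aₙ) + ∑ᵢ (-1)^(i+1) f(…, aᵢ aᵢ₊₁, …) + (-1)^(n+1) f(a₀, …, aₙ₋₁) aₙ`. -/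
def d (X : Bim A) : (List A → X.carrier) →ₗ[ℂ] (List A → X.carrier) where
  toFun f l := match l with
    | [] => 0
    | a :: t => X.l a (f t) + inner X f a t
  map_add' f g := by
    funext l
    rcases l with _ | ⟨a, t⟩
    · simp
    · simp only [inner, Pi.add_apply, map_add, smul_add, Finset.sum_add_distrib]
      abel
  map_smul' c f := by
    funext l
    rcases l with _ | ⟨a, t⟩
    · simp
    · simp only [inner, Pi.smul_apply, map_smul, smul_add, Finset.smul_sum, RingHom.id_apply,
        smul_comm c]

variable {X Y Z : Bim A}

theorem d_nil (f : List A → X.carrier) : d X f [] = 0 := rfl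

theorem d_cons (f : List A → X.carrier) (a : A) (t : List A) :
    d X f (a :: t) = X.l a (f t) + inner X f a t := rfl

/-- Fix the first argument of a function on sequences. -/
def tl {V : Type u} (f : List A → V) (a : A) : List A → V := fun l => f (a :: l)

theorem inner_nil (f : List A → X.carrier) (a : A) : inner X f a [] = - X.r a (f []) := by
  simp [inner]

theorem inner_cons (f : List A → X.carrier) (a b : A) (t : List A) :
    inner X f a (b :: t) = - f ((a * b) :: t) - inner X (tl f a) b t := by
  simp only [inner, List.length_cons, Finset.sum_range_succ', mergeAt, tl, pow_succ, neg_smul,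
    Finset.sum_neg_distrib, mul_neg, mul_one, List.getLast_cons_cons, List.dropLast_cons_cons, pow_zero,
    one_smul, neg_neg]
  abel

theorem inner_add (f g : List A → X.carrier) (a : A) (t : List A) :
    inner X (f + g) a t = inner X f a t + inner X g a t := by
  simp only [inner, Pi.add_apply, map_add, smul_add, Finset.sum_add_distrib]
  abel

theorem inner_smul (c : ℂ) (f : List A → X.carrier) (a : A) (t : List A) :
    inner X (c • f) a t = c • inner X f a t := by
  simp only [inner, Pi.smul_apply, map_smul, smul_add, Finset.smul_sum, smul_comm c]

theorem inner_map (φ : X.carrier →ₗ[ℂ] Y.carrier) (hφ : ∀ a x, φ (X.r a x) = Y.r a (φ x))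
    (f : List A → X.carrier) (a : A) (t : List A) :
    inner Y (fun l => φ (f l)) a t = φ (inner X f a t) := by
  simp only [inner, map_add, map_sum, map_zsmul, hφ]

theorem d_map {φ : X.carrier →ₗ[ℂ] Y.carrier} (hφ : Bim.IsHom φ) (f : List A → X.carrier) :
    d Y (fun l => φ (f l)) = fun l => φ (d X f l) := by
  funext l
  rcases l with _ | ⟨a, t⟩
  · simp [d_nil]
  · simp only [d_cons, map_add, hφ.map_l, inner_map φ hφ.map_r]

theorem inner_inner (f : List A → X.carrier) (a b : A) (t : List A) :
    inner X (inner X f a) b t = - inner X f (a * b) t := by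
  induction t generalizing f a b with
  | nil => simp [inner_nil, X.mul_r]
  | cons c t ih =>
    have h : tl (inner X f a) b = -(tl f (a * b) + inner X (tl f a) b) := by
      funext s; simp [tl, inner_cons]; abel
    have h2 : ∀ g : List A → X.carrier, inner X (-g) c t = - inner X g c t := fun g => by
      have := inner_smul (-1) g c t
      simpa using this
    rw [inner_cons, h, h2, inner_add, ih, inner_cons, inner_cons]
    simp only [mul_assoc]
    have h3 : tl (tl f a) b = tl (tl f a) b := rfl
    abel

theorem inner_l (f : List A → X.carrier) (a b : A) (t : List A) :
    inner X (fun l => X.l a (f l)) b t = X.l a (inner X f b t) :=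
  inner_map (X.l a) (fun b x => X.l_r a b x) f b t

theorem tl_d (f : List A → X.carrier) (a : A) :
    tl (d X f) a = (fun l => X.l a (f l)) + inner X f a := by
  funext t; simp [tl, d_cons]

theorem inner_d (f : List A → X.carrier) (a : A) (t : List A) :
    inner X (d X f) a t = - X.l a (d X f t) := by
  rcases t with _ | ⟨b, t⟩
  · simp [inner_nil, d_nil]
  · rw [inner_cons, tl_d, inner_add, inner_l, inner_inner, d_cons, d_cons, X.mul_l, map_add]
    abel

theorem d_d (f : List A → X.carrier) : d X (d X f) = 0 := by
  funext l
  rcases l with _ | ⟨a, t⟩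
  · rfl
  · simp [d_cons, inner_d]

theorem ML.tl_mem {V : Type u} [AddCommGroup V] [Module ℂ V] {f : List A → V} (hf : f ∈ ML A V)
    (a : A) : tl f a ∈ ML A V := fun l₁ l₂ => hf (a :: l₁) l₂

theorem ML.lin {V : Type u} [AddCommGroup V] [Module ℂ V] {f : List A → V} (hf : f ∈ ML A V)
    (t : List A) : IsLinearMap ℂ fun a => f (a :: t) := hf [] t

theorem ML.tl_lin {V : Type u} [AddCommGroup V] [Module ℂ V] {f : List A → V} (hf : f ∈ ML A V) :
    IsLinearMap ℂ fun a => tl f a :=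
  ⟨fun a b => funext fun t => (hf [] t).map_add a b, fun c a => funext fun t => (hf [] t).map_smul c a⟩

theorem ML.comp {V W : Type u} [AddCommGroup V] [Module ℂ V] [AddCommGroup W] [Module ℂ W]
    {f : List A → V} (hf : f ∈ ML A V) (φ : V →ₗ[ℂ] W) : (fun l => φ (f l)) ∈ ML A W :=
  fun l₁ l₂ => (φ ∘ₗ (hf l₁ l₂).mk' _).isLinear

theorem ML.zero_arg {V : Type u} [AddCommGroup V] [Module ℂ V] {f : List A → V} (hf : f ∈ ML A V)
    (t : List A) : f (0 :: t) = 0 := (hf [] t).map_zero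

theorem inner_lin {f : List A → X.carrier} (hf : f ∈ ML A X.carrier) (t : List A) :
    IsLinearMap ℂ fun a => inner X f a t := by
  rcases t with _ | ⟨b, t⟩
  · simp only [inner_nil]
    exact (-(X.r.flip (f []))).isLinear
  · constructor
    · intro x y
      simp only [inner_cons, (ML.tl_lin hf).map_add, inner_add, add_mul, (ML.lin hf _).map_add]
      abel
    · intro c x
      simp only [inner_cons, (ML.tl_lin hf).map_smul, inner_smul, smul_mul_assoc, (ML.lin hf _).map_smul,
        smul_sub, smul_neg]

theorem inner_mem {f : List A → X.carrier} (hf : f ∈ ML A X.carrier) (a : A) :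
    inner X f a ∈ ML A X.carrier := by
  intro l₁ l₂
  induction l₁ generalizing f a with
  | nil =>
    simp only [List.nil_append, inner_cons]
    exact (-((ML.lin hf l₂).mk' _ ∘ₗ LinearMap.mulLeft ℂ a) -
      (inner_lin (ML.tl_mem hf a) l₂).mk' _).isLinear
  | cons c l₁ ih =>
    simp only [List.cons_append, inner_cons]
    exact (-((hf ((a * c) :: l₁) l₂).mk' _) - (ih (ML.tl_mem hf a) c).mk' _).isLinear

theorem d_mem_ML {f : List A → X.carrier} (hf : f ∈ ML A X.carrier) : d X f ∈ ML A X.carrier := by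
  intro l₁ l₂
  rcases l₁ with _ | ⟨a, l₁⟩
  · simp only [List.nil_append, d_cons]
    exact (X.l.flip (f l₂) + (inner_lin hf l₂).mk' _).isLinear
  · simp only [List.cons_append, d_cons]
    exact (X.l a ∘ₗ (hf l₁ l₂).mk' _ + (inner_mem hf a l₁ l₂).mk' _).isLinear

theorem inner_eq_zero {f : List A → X.carrier} {p : ℤ} (hf : ∀ l, (l.length : ℤ) ≠ p → f l = 0)
    (a : A) (t : List A) (ht : (t.length : ℤ) ≠ p) : inner X f a t = 0 := by
  induction t generalizing f a p with
  | nil => simp [inner_nil, hf [] ht]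
  | cons b t ih =>
    rw [inner_cons, hf _ (by simpa using ht), ih (p := p - 1)]
    · simp
    · intro l hl
      exact hf _ (by simp only [List.length_cons]; omega)
    · simp only [List.length_cons] at ht; omega

theorem d_mem {f : List A → X.carrier} {p : ℤ} (hf : f ∈ Coch X p) : d X f ∈ Coch X (p + 1) := by
  refine ⟨d_mem_ML hf.1, fun l hl => ?_⟩
  rcases l with _ | ⟨a, t⟩
  · rfl
  · have ht : (t.length : ℤ) ≠ p := fun h => hl (by simp [h])
    rw [d_cons, hf.2 t ht, inner_eq_zero hf.2 a t ht]
    simp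

end Cochains

section Brace

set_option linter.unusedSectionVars false

variable {A : Type u} [Ring A] [Algebra ℂ A] {X : Bim A}

/-- `∑ φ(g(l₁), l₂)` over all ways `l = l₁ ++ l₂` of cutting `l` in two pieces. -/
def hsum {B V W : Type u} [AddCommGroup V] (φ : W → List B → V) (g : List B → W) (l : List B) : V :=
  ∑ i ∈ Finset.range (l.length + 1), φ (g (l.take i)) (l.drop i)

/-- The brace `f{g}`: the sum of `ε ^ |l₁| • f(l₁, g(l₂), l₃)` over all ways `l = l₁ ++ l₂ ++ l₃` of
cutting `l` in three pieces.  For `g` of degree `q` the sign is `ε = (-1)^(q-1)`. -/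
def brace {V : Type u} [AddCommGroup V] (ε : ℤ) (f : List A → V) (g : List A → A) (l : List A) : V :=
  ∑ i ∈ Finset.range (l.length + 1),
    ε ^ i • hsum (fun a t => f (l.take i ++ a :: t)) g (l.drop i)

section
variable {B V W : Type u} [AddCommGroup V]

theorem hsum_nil (φ : W → List B → V) (g : List B → W) : hsum φ g [] = φ (g []) [] := by
  simp [hsum]

theorem hsum_cons (φ : W → List B → V) (g : List B → W) (a : B) (t : List B) :
    hsum φ g (a :: t) = φ (g []) (a :: t) + hsum φ (tl g a) t := by
  rw [hsum, List.length_cons, Finset.sum_range_succ', add_comm]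
  simp [hsum, tl]

theorem hsum_add_left (φ ψ : W → List B → V) (g : List B → W) (l : List B) :
    hsum (φ + ψ) g l = hsum φ g l + hsum ψ g l := by
  simp [hsum, Finset.sum_add_distrib]

theorem hsum_smul_left {S : Type*} [DistribSMul S V] (c : S) (φ : W → List B → V) (g : List B → W)
    (l : List B) : hsum (c • φ) g l = c • hsum φ g l := by
  simp [hsum, Finset.smul_sum]

theorem hsum_add_right [AddCommGroup W] {φ : W → List B → V}
    (hφ : ∀ t x y, φ (x + y) t = φ x t + φ y t) (g h : List B → W) (l : List B) :
    hsum φ (g + h) l = hsum φ g l + hsum φ h l := by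
  simp [hsum, Finset.sum_add_distrib, hφ]

theorem hsum_smul_right {S : Type*} [DistribSMul S V] [SMul S W] {φ : W → List B → V} (c : S)
    (hφ : ∀ t x, φ (c • x) t = c • φ x t) (g : List B → W) (l : List B) :
    hsum φ (c • g) l = c • hsum φ g l := by
  simp [hsum, Finset.smul_sum, hφ]

end

section
variable {V : Type u} [AddCommGroup V]

theorem brace_nil (ε : ℤ) (f : List A → V) (g : List A → A) : brace ε f g [] = f [g []] := by
  simp [brace, hsum]

theorem brace_cons (ε : ℤ) (f : List A → V) (g : List A → A) (a : A) (t : List A) :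
    brace ε f g (a :: t) = hsum (fun x s => f (x :: s)) g (a :: t) + ε • brace ε (tl f a) g t := by
  rw [brace, List.length_cons, Finset.sum_range_succ', add_comm]
  simp [brace, tl, Finset.smul_sum, pow_succ', mul_smul]

theorem brace_add_left (ε : ℤ) (f f' : List A → V) (g : List A → A) :
    brace ε (f + f') g = brace ε f g + brace ε f' g := by
  funext l
  simp [brace, hsum, Finset.sum_add_distrib, smul_add]

theorem brace_smul_left [Module ℂ V] (ε : ℤ) (c : ℂ) (f : List A → V) (g : List A → A) :
    brace ε (c • f) g = c • brace ε f g := by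
  funext l
  simp [brace, hsum, Finset.smul_sum, smul_comm c]

theorem brace_neg_left (ε : ℤ) (f : List A → V) (g : List A → A) :
    brace ε (-f) g = -brace ε f g := by
  funext l
  simp [brace, hsum]

variable [Module ℂ V]

theorem brace_add_right (ε : ℤ) {f : List A → V} (hf : f ∈ ML A V) (g g' : List A → A) :
    brace ε f (g + g') = brace ε f g + brace ε f g' := by
  funext l
  simp [brace, hsum, Finset.sum_add_distrib, smul_add, (hf _ _).map_add]

theorem brace_smul_right (ε : ℤ) (c : ℂ) {f : List A → V} (hf : f ∈ ML A V) (g : List A → A) :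
    brace ε f (c • g) = c • brace ε f g := by
  funext l
  simp [brace, hsum, Finset.smul_sum, smul_comm c, (hf _ _).map_smul]

theorem hsum_mem {B W : Type u} [Ring B] [Algebra ℂ B] [AddCommGroup W] [Module ℂ W]
    {φ : W → List B → V} (hφ : ∀ t, IsLinearMap ℂ fun x => φ x t) (hφ' : ∀ x, φ x ∈ ML B V)
    {g : List B → W} (hg : g ∈ ML B W) : hsum φ g ∈ ML B V := by
  intro l₁ l₂
  induction l₁ generalizing g with
  | nil =>
    simp only [List.nil_append, hsum_cons]
    refine (((ML.lin (hφ' (g [])) l₂).mk' _) + (IsLinearMap.mk (f := fun a => hsum φ (tl g a) l₂) ?_ ?_).mk' _).isLinear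
    · intro x y
      rw [(ML.tl_lin hg).map_add, hsum_add_right fun t => (hφ t).map_add]
    · intro c x
      rw [(ML.tl_lin hg).map_smul, hsum_smul_right c fun t x => (hφ t).map_smul c x]
  | cons c l₁ ih =>
    simp only [List.cons_append, hsum_cons]
    exact (((hφ' (g [])) (c :: l₁) l₂).mk' _ + (ih (ML.tl_mem hg c)).mk' _).isLinear

theorem brace_mem_ML (ε : ℤ) {f : List A → V} (hf : f ∈ ML A V) {g : List A → A} (hg : g ∈ ML A A) :
    brace ε f g ∈ ML A V := by
  have key : ∀ {f : List A → V}, f ∈ ML A V → hsum (fun x s => f (x :: s)) g ∈ ML A V :=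
    fun hf => hsum_mem (fun t => ML.lin hf t) (fun x => ML.tl_mem hf x) hg
  intro l₁ l₂
  induction l₁ generalizing f with
  | nil =>
    simp only [List.nil_append, brace_cons]
    refine ((key hf [] l₂).mk' _ + (ε • (IsLinearMap.mk (f := fun a => brace ε (tl f a) g l₂) ?_ ?_).mk' _)).isLinear
    · intro x y
      rw [(ML.tl_lin hf).map_add, brace_add_left]; rfl
    · intro c x
      rw [(ML.tl_lin hf).map_smul, brace_smul_left]; rfl
  | cons c l₁ ih =>
    simp only [List.cons_append, brace_cons]
    exact ((key hf (c :: l₁) l₂).mk' _ + (ε • (ih (ML.tl_mem hf c)).mk' _)).isLinear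

end

theorem hsum_zsmul_right {B V W : Type u} [AddCommGroup V] [Module ℂ V] [AddCommGroup W] [Module ℂ W]
    {φ : W → List B → V} (hφ : ∀ t, IsLinearMap ℂ fun x => φ x t) (n : ℤ) (g : List B → W)
    (l : List B) : hsum φ (n • g) l = n • hsum φ g l :=
  hsum_smul_right n (fun t x => map_zsmul ((hφ t).mk' _) n x) g l

theorem hsum_neg_right {B V W : Type u} [AddCommGroup V] [Module ℂ V] [AddCommGroup W] [Module ℂ W]
    {φ : W → List B → V} (hφ : ∀ t, IsLinearMap ℂ fun x => φ x t) (g : List B → W)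
    (l : List B) : hsum φ (-g) l = - hsum φ g l := by
  simpa using hsum_zsmul_right hφ (-1) g l

/-- Multiplication by `(-1) ^ length`. -/
def tau {V : Type u} [AddCommGroup V] (f : List A → V) : List A → V :=
  fun l => (-1 : ℤ) ^ l.length • f l

theorem tl_tau {V : Type u} [AddCommGroup V] (f : List A → V) (a : A) :
    tl (tau f) a = - tau (tl f a) := by
  funext t; simp [tl, tau, pow_succ]

theorem tau_nil {V : Type u} [AddCommGroup V] (f : List A → V) : tau f [] = f [] := by
  simp [tau]

theorem tau_cons {V : Type u} [AddCommGroup V] (f : List A → V) (a : A) (t : List A) :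
    tau f (a :: t) = - tau (tl f a) t := congrFun (tl_tau f a) t

/-- The differential and its inner part for cochains with values in `A` itself. -/
abbrev dA (g : List A → A) : List A → A := d (Bim.diag A) g
abbrev innA (g : List A → A) (a : A) : List A → A := inner (Bim.diag A) g a

theorem innA_nil (g : List A → A) (a : A) : innA g a [] = -(g [] * a) := inner_nil (X := Bim.diag A) g a

theorem tl_innA (g : List A → A) (a b : A) : tl (innA g a) b = -tl g (a * b) + -innA (tl g a) b := by
  funext t
  exact (inner_cons (X := Bim.diag A) g a b t).trans (sub_eq_add_neg (G := A) _ _)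

theorem tl_dA (g : List A → A) (a : A) : tl (dA g) a = (fun l => a * g l) + innA g a :=
  tl_d (X := Bim.diag A) g a

theorem dA_nil (g : List A → A) : dA g [] = 0 := rfl

theorem inner_neg (f : List A → X.carrier) (a : A) (t : List A) :
    inner X (-f) a t = - inner X f a t := by simpa using inner_smul (-1) f a t

theorem inner_zsmul (n : ℤ) (f : List A → X.carrier) (a : A) (t : List A) :
    inner X (n • f) a t = n • inner X f a t := by
  have := inner_smul (n : ℂ) f a t
  rwa [Int.cast_smul_eq_zsmul, Int.cast_smul_eq_zsmul] at this

theorem inner_hsum {f : List A → X.carrier} (hf : f ∈ ML A X.carrier) (k : List A → A) (b : A)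
    (t : List A) :
    inner X (hsum (fun x s => f (x :: s)) k) b t =
      hsum (fun x s => f (x :: s)) (innA k b) t - hsum (fun x s => inner X f x s) (tau k) (b :: t) -
        X.r (tau k (b :: t)) (f []) := by
  have hadd : ∀ (k k' : List A → A) t, hsum (fun x s => f (x :: s)) (k + k') t =
      hsum (fun x s => f (x :: s)) k t + hsum (fun x s => f (x :: s)) k' t :=
    fun k k' t => hsum_add_right (fun t => (ML.lin hf t).map_add) k k' t
  have hneg : ∀ (k : List A → A) t, hsum (fun x s => f (x :: s)) (-k) t =
      - hsum (fun x s => f (x :: s)) k t := hsum_neg_right (ML.lin hf)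
  have hneg' : ∀ (k : List A → A) t, hsum (fun x s => inner X f x s) (-k) t =
      - hsum (fun x s => inner X f x s) k t := hsum_neg_right (inner_lin hf)
  have fneg : ∀ x s, f (-x :: s) = - f (x :: s) := fun x s => by
    simpa using (ML.lin hf s).map_smul (-1) x
  induction t generalizing k b with
  | nil =>
    simp only [hsum_nil, hsum_cons, inner_nil, innA_nil, tl_tau, tau_nil, tau_cons, fneg, inner_cons, tl,
      hneg', map_neg, LinearMap.neg_apply]
    abel
  | cons c t ih =>
    have h1 : tl (hsum (fun x s => f (x :: s)) k) b =
        tl (tl f (k [])) b + hsum (fun x s => f (x :: s)) (tl k b) := by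
      funext s; simp [tl, hsum_cons]
    rw [inner_cons, hsum_cons, h1, inner_add, ih (tl k b) c, hsum_cons _ (innA k b), tl_innA, hadd, hneg,
      hneg, innA_nil, fneg, hsum_cons _ (tau k), tl_tau, hneg', tau_nil, tau_cons, inner_cons f (k []) b,
      inner_cons (tl f (k [])) b c]
    have h5 : tau (tl k b) (c :: t) = - tau (tl (tl k b) c) t := tau_cons _ _ _
    have h6 : tau k (b :: c :: t) = tau (tl (tl k b) c) t := by rw [tau_cons, h5, neg_neg]
    have h7 : tl f (k []) ((b * c) :: t) = f (k [] :: (b * c) :: t) := rfl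
    simp only [h6, h7, map_neg, LinearMap.neg_apply]
    abel

/-- `∑ σ^(|l₁|+1) • f(l₁) · g(l₂)`. -/
def cupR (X : Bim A) (σ : ℤ) (f : List A → X.carrier) (g : List A → A) (l : List A) : X.carrier :=
  ∑ i ∈ Finset.range (l.length + 1), σ ^ (i + 1) • X.r (g (l.drop i)) (f (l.take i))

theorem cupR_nil (σ : ℤ) (f : List A → X.carrier) (g : List A → A) :
    cupR X σ f g [] = σ • X.r (g []) (f []) := by simp [cupR]

theorem cupR_cons (σ : ℤ) (f : List A → X.carrier) (g : List A → A) (a : A) (t : List A) :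
    cupR X σ f g (a :: t) = σ • X.r (g (a :: t)) (f []) + σ • cupR X σ (tl f a) g t := by
  rw [cupR, List.length_cons, Finset.sum_range_succ', add_comm]
  simp [cupR, tl, Finset.smul_sum, pow_succ', mul_smul]

theorem inner_brace {ε : ℤ} (hε : ε * ε = 1) {f : List A → X.carrier} (hf : f ∈ ML A X.carrier)
    {g : List A → A} (hg : tau g = -(ε • g)) (a : A) (t : List A) :
    inner X (brace ε f g) a t =
      ε • hsum (fun x s => inner X f x s) g (a :: t) + brace ε (inner X f a) g t +
        brace (-ε) f (dA g) (a :: t) - cupR X (-ε) f g (a :: t) := by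
  have h0 : ε • g [] = - g [] := by
    have := congrFun hg []
    rw [tau_nil] at this
    exact eq_neg_iff_add_eq_zero.mpr (by rw [add_comm]; exact eq_neg_iff_add_eq_zero.mp this)
  have hi0 : ∀ {f : List A → X.carrier}, f ∈ ML A X.carrier → ∀ t,
      ε • inner X f (g []) t = - inner X f (g []) t := fun {f} hf t => by
    have h := map_zsmul ((inner_lin hf t).mk' _) ε (g [])
    simp only [IsLinearMap.mk'_apply] at h
    rw [← h, h0]
    exact map_neg ((inner_lin hf t).mk' _) (g [])
  induction t generalizing f a with
  | nil =>
    have fneg : ∀ x s, f (-x :: s) = - f (x :: s) := fun x s => map_neg ((ML.lin hf s).mk' _) x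
    have fadd : ∀ x y s, f ((x + y) :: s) = f (x :: s) + f (y :: s) :=
      fun x y s => (ML.lin hf s).map_add x y
    have h1 : dA g [a] = a * g [] + -(g [] * a) := by
      rw [← innA_nil]; exact congrFun (tl_dA g a) []
    have h6 : tl (dA g) a [] = dA g [a] := rfl
    have h7 : tl g a [] = g [a] := rfl
    have h8 : tl f (g []) [] = f [g []] := rfl
    have h9 : tl f a [0] = 0 := ML.zero_arg (ML.tl_mem hf a) []
    have h10 : tl f a [] = f [a] := rfl
    simp only [inner_nil, brace_nil, hsum_cons, hsum_nil, brace_cons, smul_add, h6, h7, h9, h1, dA_nil,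
      ML.zero_arg hf, cupR_cons, cupR_nil, inner_cons, fadd, fneg, h8, h10]
    rcases mul_self_eq_one_iff.mp hε with rfl | rfl
    · have hz : g [] = 0 := by
        have h : (2 : ℂ) • g [] = 0 := by
          rw [two_smul]; exact eq_neg_iff_add_eq_zero.mp ((one_smul ℤ _).symm.trans h0)
        simpa using h
      simp only [one_smul, neg_smul, hz, zero_mul, ML.zero_arg hf, map_zero]
      abel
    · simp only [one_smul, neg_smul, neg_neg]
      abel
  | cons b t ih =>
    have fneg : ∀ x s, f (-x :: s) = - f (x :: s) := fun x s => map_neg ((ML.lin hf s).mk' _) x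
    have hadd : ∀ (k k' : List A → A) t, hsum (fun x s => f (x :: s)) (k + k') t =
        hsum (fun x s => f (x :: s)) k t + hsum (fun x s => f (x :: s)) k' t :=
      fun k k' t => hsum_add_right (fun t => (ML.lin hf t).map_add) k k' t
    have hneg : ∀ (k : List A → A) t, hsum (fun x s => f (x :: s)) (-k) t =
        - hsum (fun x s => f (x :: s)) k t := hsum_neg_right (ML.lin hf)
    have htau : tau (tl g a) = ε • tl g a := by
      have := congrArg (fun k => tl k a) hg
      simp only [tl_tau] at this
      rw [← neg_inj, this]; rfl
    have h1 : tl (brace ε f g) a = tl (tl f (g [])) a + hsum (fun x s => f (x :: s)) (tl g a) +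
        ε • brace ε (tl f a) g := by
      funext s; simp [tl, hsum_cons, brace_cons]
    have h2 : hsum (fun x s => inner X f a (x :: s)) g (b :: t) =
        - hsum (fun x s => f (x :: s)) (fun l => a * g l) (b :: t)
        - hsum (fun x s => inner X (tl f a) x s) g (b :: t) := by
      simp [hsum, inner_cons, Finset.sum_sub_distrib]
    have h3 : hsum (fun x s => inner X f x s) (ε • tl g a) (b :: t) =
        ε • hsum (fun x s => inner X f x s) (tl g a) (b :: t) :=
      hsum_zsmul_right (inner_lin hf) ε _ _
    have h4 : tl (inner X f a) b = -tl f (a * b) + -inner X (tl f a) b := by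
      funext s; simp [tl, inner_cons]; abel
    have h5 : f (0 :: a :: b :: t) = 0 := ML.zero_arg hf _
    have h7 : tl f (g []) ((a * b) :: t) = f (g [] :: (a * b) :: t) := rfl
    have h6 : (tl g a) (b :: t) = g (a :: b :: t) := rfl
    rw [inner_cons, brace_cons, h1, inner_add, inner_add, inner_zsmul, ih (ML.tl_mem hf a) b,
      inner_hsum hf, htau, h3, hsum_cons _ g (a * b), hsum_cons (fun x s => inner X f x s) g a, smul_add,
      hi0 hf, brace_cons ε (inner X f a), h2,
      h4, brace_add_left, brace_neg_left, brace_neg_left, brace_cons (-ε) f, hsum_cons _ (dA g), dA_nil, tl_dA, hadd,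
      hsum_cons _ (innA g a), tl_innA, hadd, hneg, hneg, innA_nil, fneg, cupR_cons _ f g a, h5,
      inner_cons f (g []), inner_cons (tl f (g []))]
    simp only [Pi.smul_apply, Pi.add_apply, Pi.neg_apply, map_zsmul, LinearMap.smul_apply, h6, h7]
    rcases mul_self_eq_one_iff.mp hε with rfl | rfl
    · simp only [one_smul, neg_smul]
      abel
    · simp only [one_smul, neg_smul, neg_neg]
      abel

end Brace

section Leibniz

set_option linter.unusedSectionVars false

variable {A : Type u} [Ring A] [Algebra ℂ A] {X : Bim A}

theorem brace_comp {V W : Type u} [AddCommGroup V] [Module ℂ V] [AddCommGroup W] [Module ℂ W] (ε : ℤ)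
    (φ : V →ₗ[ℂ] W) (f : List A → V) (g : List A → A) (t : List A) :
    brace ε (fun l => φ (f l)) g t = φ (brace ε f g t) := by
  simp [brace, hsum]

theorem d_brace {ε : ℤ} (hε : ε * ε = 1) {f : List A → X.carrier} (hf : f ∈ ML A X.carrier)
    {g : List A → A} (hg : tau g = -(ε • g)) :
    d X (brace ε f g) = ε • brace ε (d X f) g + brace (-ε) f (dA g) -
      ε • hsum (fun x s => X.l x (f s)) g - cupR X (-ε) f g := by
  funext l
  rcases l with _ | ⟨a, t⟩
  · simp only [d_nil, Pi.sub_apply, Pi.add_apply, Pi.smul_apply, brace_nil, d_cons, inner_nil, dA_nil,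
      ML.zero_arg hf, hsum_nil, cupR_nil, smul_add, smul_neg, neg_smul]
    abel
  · have h1 : hsum (fun x s => d X f (x :: s)) g (a :: t) =
        hsum (fun x s => X.l x (f s)) g (a :: t) + hsum (fun x s => inner X f x s) g (a :: t) := by
      simp [hsum, d_cons, Finset.sum_add_distrib]
    simp only [d_cons, Pi.sub_apply, Pi.add_apply, Pi.smul_apply]
    rw [inner_brace hε hf hg, brace_cons ε (d X f), h1, tl_d, brace_add_left, Pi.add_apply,
      brace_comp ε (X.l a)]
    simp only [smul_add, smul_smul, hε, one_smul]
    abel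

variable {M N : Bim A}

/-- The product `∑ f(l₁) · g(l₂)` over all ways `l = l₁ ++ l₂` of cutting `l` in two pieces,
with values multiplied by a bilinear map. -/
def cup {U V W : Type u} [AddCommGroup U] [Module ℂ U] [AddCommGroup V] [Module ℂ V]
    [AddCommGroup W] [Module ℂ W] (β : U →ₗ[ℂ] V →ₗ[ℂ] W) (f : List A → U) (g : List A → V) :
    List A → W :=
  fun l => ∑ i ∈ Finset.range (l.length + 1), β (f (l.take i)) (g (l.drop i))

section
variable {U V W : Type u} [AddCommGroup U] [Module ℂ U] [AddCommGroup V] [Module ℂ V]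
    [AddCommGroup W] [Module ℂ W] (β : U →ₗ[ℂ] V →ₗ[ℂ] W)

theorem cup_nil (f : List A → U) (g : List A → V) : cup β f g [] = β (f []) (g []) := by
  simp [cup]

theorem cup_cons (f : List A → U) (g : List A → V) (a : A) (t : List A) :
    cup β f g (a :: t) = β (f []) (g (a :: t)) + cup β (tl f a) g t :=
  hsum_cons (fun x s => β x (g s)) f a t

theorem cup_add_left (f f' : List A → U) (g : List A → V) :
    cup β (f + f') g = cup β f g + cup β f' g := by
  funext l; simp [cup, Finset.sum_add_distrib]

theorem cup_smul_left (c : ℂ) (f : List A → U) (g : List A → V) :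
    cup β (c • f) g = c • cup β f g := by
  funext l; simp [cup, Finset.smul_sum]

theorem cup_neg_left (f : List A → U) (g : List A → V) :
    cup β (-f) g = - cup β f g := by
  funext l; simp [cup]

theorem cup_zsmul_left (n : ℤ) (f : List A → U) (g : List A → V) :
    cup β (n • f) g = n • cup β f g := by
  funext l; simp [cup, Finset.smul_sum]

theorem cup_add_right (f : List A → U) (g g' : List A → V) :
    cup β f (g + g') = cup β f g + cup β f g' := by
  funext l; simp [cup, Finset.sum_add_distrib]

theorem cup_smul_right (c : ℂ) (f : List A → U) (g : List A → V) :
    cup β f (c • g) = c • cup β f g := by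
  funext l; simp [cup, Finset.smul_sum]

theorem cup_mem_ML {f : List A → U} (hf : f ∈ ML A U) {g : List A → V} (hg : g ∈ ML A V) :
    cup β f g ∈ ML A W :=
  hsum_mem (fun t => (β.flip (g t)).isLinear) (fun x => ML.comp hg (β x)) hf

end

theorem inner_cup (γ : Pairing M N X) (f : List A → M.carrier) (g : List A → N.carrier) (a : A)
    (t : List A) :
    inner X (cup γ.toFun f g) a t = cup γ.toFun (inner M f a) g t + γ.toFun (f []) (N.l a (g t)) +
      γ.toFun (f []) (inner N g a t) - cup γ.toFun (tau (tl f a)) (d N g) t := by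
  induction t generalizing f a with
  | nil =>
    simp only [inner_nil, cup_nil, d_nil, map_zero, map_neg, LinearMap.neg_apply, γ.balanced, γ.map_r]
    abel
  | cons b t ih =>
    have h1 : tl (cup γ.toFun f g) a = (fun l => γ.toFun (f []) (tl g a l)) + cup γ.toFun (tl f a) g := by
      funext s; simp [tl, cup_cons]
    have h2 : tl (inner M f a) b = -tl f (a * b) + -inner M (tl f a) b := by
      funext s; simp [tl, inner_cons]; abel
    have h3 : tl f a [] = f [a] := rfl
    rw [inner_cons, h1, inner_add, inner_map (γ.toFun (f [])) (fun a x => γ.map_r a (f []) x), ih, cup_cons,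
      cup_cons _ (inner M f a), h2, cup_cons _ (tau _), tl_tau, cup_add_left, cup_neg_left, cup_neg_left,
      cup_neg_left, inner_cons g, tau_nil, inner_nil, d_cons]
    simp only [map_neg, LinearMap.neg_apply, γ.balanced, map_sub, Pi.add_apply, Pi.neg_apply, map_add]
    abel

theorem d_cup (γ : Pairing M N X) (f : List A → M.carrier) (g : List A → N.carrier) :
    d X (cup γ.toFun f g) = cup γ.toFun (d M f) g + cup γ.toFun (tau f) (d N g) := by
  funext l
  rcases l with _ | ⟨a, t⟩
  · simp [cup_nil, d_nil]
  · have h1 : (fun l => M.l a (f l)) = fun l => M.l a (f l) := rfl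
    have h2 : cup γ.toFun (fun l => M.l a (f l)) g t = X.l a (cup γ.toFun f g t) := by
      simp [cup, γ.map_l]
    rw [d_cons, inner_cup, Pi.add_apply, cup_cons, cup_cons, tl_d, cup_add_left, tl_tau, cup_neg_left,
      Pi.add_apply, h2, tau_nil, d_nil, d_cons]
    simp only [map_zero, LinearMap.zero_apply, map_add, Pi.neg_apply]
    abel

/-- The sign `(-1)^n`. -/
def sg (n : ℤ) : ℤ := (n.negOnePow : ℤˣ)

theorem sg_add (m n : ℤ) : sg (m + n) = sg m * sg n := by simp [sg, Int.negOnePow_add]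

theorem sg_mul_self (n : ℤ) : sg n * sg n = 1 := by
  rw [← sg_add]; simp [sg, Int.negOnePow_even _ (Even.add_self n)]

theorem sg_one : sg 1 = -1 := by simp [sg]
theorem sg_zero : sg 0 = 1 := by simp [sg]
theorem sg_neg (n : ℤ) : sg (-n) = sg n := by simp [sg, Int.negOnePow_neg]

theorem sg_natCast (n : ℕ) : sg (n : ℤ) = (-1) ^ n := by
  simp [sg, Int.negOnePow]

theorem sg_congr {m n : ℤ} (h : Even (m - n)) : sg m = sg n := by
  simp only [sg, (Int.negOnePow_eq_iff m n).mpr h]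

theorem tau_eq {f : List A → X.carrier} {p : ℤ} (hf : f ∈ Coch X p) : tau f = sg p • f := by
  funext l
  by_cases h : (l.length : ℤ) = p
  · subst h; simp [tau, sg_natCast]
  · simp [tau, hf.2 l h]

theorem cup_mem {f : List A → M.carrier} {g : List A → N.carrier} {p q n : ℤ} (hf : f ∈ Coch M p)
    (hg : g ∈ Coch N q) (h : p + q = n) (β : M.carrier →ₗ[ℂ] N.carrier →ₗ[ℂ] X.carrier) :
    cup β f g ∈ Coch X n := by
  refine ⟨cup_mem_ML β hf.1 hg.1, fun l hl => Finset.sum_eq_zero fun i hi => ?_⟩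
  rw [Finset.mem_range] at hi
  by_cases h1 : ((l.take i).length : ℤ) = p
  · rw [hg.2 (l.drop i), map_zero]
    rw [List.length_take] at h1
    rw [List.length_drop]
    omega
  · rw [hf.2 _ h1]; simp

theorem brace_mem {f : List A → X.carrier} {g : List A → A} {p q n : ℤ} (hf : f ∈ Coch X p)
    (hg : g ∈ Coch (Bim.diag A) q) (h : p + q = n + 1) (ε : ℤ) : brace ε f g ∈ Coch X n := by
  refine ⟨brace_mem_ML ε hf.1 hg.1, fun l hl => Finset.sum_eq_zero fun i hi => ?_⟩
  rw [hsum, Finset.sum_eq_zero, smul_zero]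
  intro j hj
  rw [Finset.mem_range] at hi hj
  rw [List.length_drop] at hj
  by_cases h1 : (((l.drop i).take j).length : ℤ) = q
  · rw [hf.2]
    simp only [List.length_append, List.length_cons, List.length_take, List.length_drop] at h1 ⊢
    omega
  · rw [hg.2 _ h1]
    exact (hf.1 _ _).map_zero

theorem cupR_eq {f g : List A → A} {p : ℤ} (hf : f ∈ Coch (Bim.diag A) p) (σ τ : ℤ)
    (hτ : ∀ i : ℕ, (i : ℤ) = p → σ ^ (i + 1) = τ) :
    cupR (Bim.diag A) σ f g = τ • cup (LinearMap.mul ℂ A) f g := by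
  funext l
  change (∑ i ∈ Finset.range (l.length + 1), σ ^ (i + 1) • (f (l.take i) * g (l.drop i)) : A) =
    τ • ∑ i ∈ Finset.range (l.length + 1), f (l.take i) * g (l.drop i)
  rw [Finset.smul_sum]
  refine Finset.sum_congr rfl fun i hi => ?_
  rw [Finset.mem_range] at hi
  by_cases h1 : ((l.take i).length : ℤ) = p
  · rw [hτ i (by rw [List.length_take] at h1; omega)]
  · rw [show f (l.take i) = 0 from hf.2 _ h1]; simp

end Leibniz

section Bracket

set_option linter.unusedSectionVars false

variable {A : Type u} [Ring A] [Algebra ℂ A]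

/-- The Gerstenhaber bracket `[f, g] = f{g} - (-1)^((p-1)(q-1)) g{f}` of cochains of degrees
`p`, `q` with values in `A`. -/
def gerst (p q : ℤ) (f g : List A → A) : List A → A :=
  brace (sg (q - 1)) f g - sg ((p - 1) * (q - 1)) • brace (sg (p - 1)) g f

theorem tau_coch {g : List A → A} {q : ℤ} (hg : g ∈ Coch (Bim.diag A) q) :
    tau g = -(sg (q - 1) • g) := by
  have h : tau g = sg q • g := tau_eq (X := Bim.diag A) hg
  rw [h, sub_eq_add_neg, sg_add, sg_neg, sg_one]
  simp

theorem d_brace_A {f g : List A → A} {p q : ℤ} (hf : f ∈ Coch (Bim.diag A) p)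
    (hg : g ∈ Coch (Bim.diag A) q) :
    dA (brace (sg (q - 1)) f g) = sg (q - 1) • brace (sg (q - 1)) (dA f) g + brace (sg q) f (dA g) -
      sg (q - 1) • cup (LinearMap.mul ℂ A) g f - sg (q * (p + 1)) • cup (LinearMap.mul ℂ A) f g := by
  have h1 : -sg (q - 1) = sg q := by
    rw [sub_eq_add_neg, sg_add, sg_neg, sg_one]; simp
  have h2 := d_brace (X := Bim.diag A) (sg_mul_self (q - 1)) hf.1 (tau_coch hg)
  rw [h1] at h2
  have h3 : cupR (Bim.diag A) (sg q) f g = sg (q * (p + 1)) • cup (LinearMap.mul ℂ A) f g := by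
    refine cupR_eq hf _ _ fun i hi => ?_
    subst hi
    obtain hq | hq := Int.even_or_odd q
    · rw [show sg q = 1 by simp [sg, Int.negOnePow_even q hq],
        show sg (q * (i + 1)) = 1 by simp [sg, Int.negOnePow_even _ (hq.mul_right _)], one_pow]
    · rw [show sg q = -1 by simp [sg, Int.negOnePow_odd q hq]]
      rw [sg_congr (n := ((i + 1 : ℕ) : ℤ)), sg_natCast]
      obtain ⟨k, rfl⟩ := hq
      exact ⟨k * (i + 1), by push_cast; ring⟩
  rw [h3] at h2
  exact h2

theorem sg_eq_ite (n : ℤ) : sg n = if Even n then 1 else -1 := by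
  split_ifs with h
  · simp [sg, Int.negOnePow_even n h]
  · simp [sg, Int.negOnePow_odd n (Int.not_even_iff_odd.mp h)]

theorem gerst_mem {f g : List A → A} {p q n : ℤ} (hf : f ∈ Coch (Bim.diag A) p)
    (hg : g ∈ Coch (Bim.diag A) q) (h : p + q = n + 1) :
    gerst p q f g ∈ Coch (Bim.diag A) n :=
  Submodule.sub_mem _ (brace_mem hf hg h _)
    (zsmul_mem (brace_mem (X := Bim.diag A) hg hf (by omega) _) _)

theorem d_gerst {f g : List A → A} {p q : ℤ} (hf : f ∈ Coch (Bim.diag A) p)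
    (hg : g ∈ Coch (Bim.diag A) q) :
    dA (gerst p q f g) = sg (q - 1) • gerst (p + 1) q (dA f) g + gerst p (q + 1) f (dA g) := by
  have e : dA (gerst p q f g) = dA (brace (sg (q - 1)) f g) -
      sg ((p - 1) * (q - 1)) • dA (brace (sg (p - 1)) g f) := by
    exact (map_sub (d (Bim.diag A)) (brace (sg (q - 1)) f g)
      (sg ((p - 1) * (q - 1)) • brace (sg (p - 1)) g f)).trans (congrArg _
        (map_zsmul (d (Bim.diag A)) (sg ((p - 1) * (q - 1))) (brace (sg (p - 1)) g f)))
  rw [e, d_brace_A hf hg, d_brace_A hg hf, gerst, gerst]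
  simp only [smul_add, smul_sub, smul_smul, add_sub_cancel_right]
  rcases Int.even_or_odd p with hp | hp <;> rcases Int.even_or_odd q with hq | hq <;>
  simp only [sg_eq_ite, Int.even_sub, Int.even_mul, Int.even_add, hp, hq, Int.not_even_one,
    Int.not_even_iff_odd.mpr, iff_false, not_true_eq_false, not_false_eq_true, or_self, or_true, or_false, false_or,
    true_or, iff_true, iff_self, if_true, if_false, one_smul, neg_smul, neg_neg, mul_one, one_mul,
    mul_neg, neg_mul] <;>
  abel

end Bracket

/-! ### Cohomology -/

section Cohomology

variable {V V' V'' : Type u} [AddCommGroup V] [Module ℂ V] [AddCommGroup V'] [Module ℂ V']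
  [AddCommGroup V''] [Module ℂ V'']

/-- Cocycles of degree `p` for the differential `D` and the groups of cochains `C`. -/
def cocyc (D : V →ₗ[ℂ] V) (C : ℤ → Submodule ℂ V) (p : ℤ) : Submodule ℂ V := C p ⊓ LinearMap.ker D

/-- Coboundaries, as a subspace of the cocycles of degree `p`. -/
def cobd (D : V →ₗ[ℂ] V) (C : ℤ → Submodule ℂ V) (p : ℤ) : Submodule ℂ (cocyc D C p) :=
  ((C (p - 1)).map D).comap (cocyc D C p).subtype

/-- The cohomology in degree `p`. -/
abbrev Coho (D : V →ₗ[ℂ] V) (C : ℤ → Submodule ℂ V) (p : ℤ) : Type u :=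
  cocyc D C p ⧸ cobd D C p

/-- The class of a cocycle. -/
def Coho.mk (D : V →ₗ[ℂ] V) (C : ℤ → Submodule ℂ V) {p : ℤ} (f : V) (hf : f ∈ cocyc D C p) :
    Coho D C p := (cobd D C p).mkQ ⟨f, hf⟩

/-- The map on cohomology induced by a map of complexes. -/
def Coho.map (D : V →ₗ[ℂ] V) (C : ℤ → Submodule ℂ V) (D' : V' →ₗ[ℂ] V') (C' : ℤ → Submodule ℂ V')
    (φ : V →ₗ[ℂ] V') (h : ∀ p, ∀ f ∈ C p, φ f ∈ C' p) (hd : ∀ p, ∀ f ∈ C p, φ (D f) = D' (φ f)) (p : ℤ) :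
    Coho D C p →ₗ[ℂ] Coho D' C' p :=
  (cobd D C p).mapQ (cobd D' C' p)
    (φ.restrict (p := cocyc D C p) (q := cocyc D' C' p) fun f hf => ⟨h p f hf.1, by
      have h1 := hd p f hf.1
      rw [LinearMap.mem_ker.mp hf.2, map_zero] at h1
      exact h1.symm⟩)
    (by
      rintro ⟨f, hf⟩ ⟨g, hg, hgf⟩
      exact ⟨φ g, h _ g hg, by rw [← hd _ g hg, hgf]; rfl⟩)

/-- The bilinear map on cohomology induced by an operation on cochains, which is bilinear on the cochains
of the given degrees, preserves cocycles, and sends a coboundary and a cocycle to a coboundary. -/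
def Coho.map₂ (D : V →ₗ[ℂ] V) (C : ℤ → Submodule ℂ V) (D' : V' →ₗ[ℂ] V') (C' : ℤ → Submodule ℂ V')
    (D'' : V'' →ₗ[ℂ] V'') (C'' : ℤ → Submodule ℂ V'') (p q n : ℤ) (op : V → V' → V'')
    (add_l : ∀ f ∈ C p, ∀ f' ∈ C p, ∀ g ∈ C' q, op (f + f') g = op f g + op f' g)
    (smul_l : ∀ c : ℂ, ∀ f ∈ C p, ∀ g ∈ C' q, op (c • f) g = c • op f g)
    (add_r : ∀ f ∈ C p, ∀ g ∈ C' q, ∀ g' ∈ C' q, op f (g + g') = op f g + op f g')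
    (smul_r : ∀ c : ℂ, ∀ f ∈ C p, ∀ g ∈ C' q, op f (c • g) = c • op f g)
    (hZ : ∀ f ∈ cocyc D C p, ∀ g ∈ cocyc D' C' q, op f g ∈ cocyc D'' C'' n)
    (hl : ∀ f ∈ C (p - 1), ∀ g ∈ cocyc D' C' q, op (D f) g ∈ (C'' (n - 1)).map D'')
    (hr : ∀ f ∈ cocyc D C p, ∀ g ∈ C' (q - 1), op f (D' g) ∈ (C'' (n - 1)).map D'') :
    Coho D C p →ₗ[ℂ] Coho D' C' q →ₗ[ℂ] Coho D'' C'' n :=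
  let B : cocyc D C p →ₗ[ℂ] cocyc D' C' q →ₗ[ℂ] cocyc D'' C'' n :=
    LinearMap.mk₂ ℂ (fun f g => ⟨op f g, hZ f f.2 g g.2⟩)
      (fun f f' g => Subtype.ext (add_l f f.2.1 f' f'.2.1 g g.2.1))
      (fun c f g => Subtype.ext (smul_l c f f.2.1 g g.2.1))
      (fun f g g' => Subtype.ext (add_r f f.2.1 g g.2.1 g' g'.2.1))
      (fun c f g => Subtype.ext (smul_r c f f.2.1 g g.2.1))
  (cobd D C p).liftQ
    (LinearMap.flip ((cobd D' C' q).liftQ (B.compr₂ (cobd D'' C'' n).mkQ).flip (by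
      rintro ⟨g, hg⟩ ⟨k, hk, hkg⟩
      refine LinearMap.mem_ker.mpr (LinearMap.ext fun f => (Submodule.Quotient.mk_eq_zero _).mpr ?_)
      have h1 := hr f f.2 k hk
      rw [hkg] at h1
      exact h1)))
    (by
      rintro ⟨f, hf⟩ ⟨k, hk, hkf⟩
      refine LinearMap.mem_ker.mpr (Submodule.linearMap_qext _ (LinearMap.ext fun g =>
        (Submodule.Quotient.mk_eq_zero _).mpr ?_))
      have h1 := hl k hk g g.2
      rw [hkf] at h1
      exact h1)

end Cohomology

/-! ### Hochschild cohomology of an algebra with coefficients in a bimodule -/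

section HH

variable {A : Type u} [Ring A] [Algebra ℂ A]

/-- Hochschild cohomology `HH^p(A, X)`. -/
abbrev HH (X : Bim A) (p : ℤ) : Type u := Coho (d X) (Coch X) p

theorem sg_smul_map {V W : Type u} [AddCommGroup V] [Module ℂ V] [AddCommGroup W] [Module ℂ W]
    (φ : V →ₗ[ℂ] W) (n : ℤ) (v : V) : φ (n • v) = n • φ v := map_zsmul φ n v

/-- The signed cup product of cochains,
`(x ⌣ y)(a₁, …, a_{p+q}) = (-1)^(pq) x(a₁, …, a_p) y(a_{p+1}, …, a_{p+q})`. -/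
def scup {X Y Z : Bim A} (γ : Pairing X Y Z) (p q : ℤ) (f : List A → X.carrier) (g : List A → Y.carrier) :
    List A → Z.carrier := sg (p * q) • cup γ.toFun f g

theorem scup_mem {X Y Z : Bim A} (γ : Pairing X Y Z) {p q n : ℤ} (h : p + q = n)
    {f : List A → X.carrier} {g : List A → Y.carrier} (hf : f ∈ Coch X p) (hg : g ∈ Coch Y q) :
    scup γ p q f g ∈ Coch Z n :=
  zsmul_mem (cup_mem hf hg h _) _

theorem d_scup {X Y Z : Bim A} (γ : Pairing X Y Z) {p q : ℤ}
    {f : List A → X.carrier} {g : List A → Y.carrier} (hf : f ∈ Coch X p) :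
    d Z (scup γ p q f g) = sg q • scup γ (p + 1) q (d X f) g + scup γ p (q + 1) f (d Y g) := by
  rw [scup, sg_smul_map, d_cup, tau_eq hf, cup_zsmul_left, scup, scup, smul_add, smul_smul, smul_smul,
    ← sg_add, ← sg_add]
  rw [sg_congr (m := p * q) (n := q + (p + 1) * q) ⟨-q, by ring⟩, mul_add, mul_one]

theorem scup_zero_left {X Y Z : Bim A} (γ : Pairing X Y Z) (p q : ℤ) (g : List A → Y.carrier) :
    scup γ p q 0 g = 0 := by
  funext l; simp [scup, cup]

theorem scup_zero_right {X Y Z : Bim A} (γ : Pairing X Y Z) (p q : ℤ) (f : List A → X.carrier) :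
    scup γ p q f 0 = 0 := by
  funext l; simp [scup, cup]

/-- The product on cohomology induced by the signed cup product, for families of subspaces of the
Hochschild cochains which are closed under it. -/
def mulOf {X Y Z : Bim A} (γ : Pairing X Y Z) (C : ℤ → Submodule ℂ (List A → X.carrier))
    (C' : ℤ → Submodule ℂ (List A → Y.carrier)) (C'' : ℤ → Submodule ℂ (List A → Z.carrier))
    (hC : ∀ p, C p ≤ Coch X p)
    (hmul : ∀ p q n, p + q = n → ∀ f ∈ C p, ∀ g ∈ C' q, scup γ p q f g ∈ C'' n)
    {p q n : ℤ} (h : p + q = n) :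
    Coho (d X) C p →ₗ[ℂ] Coho (d Y) C' q →ₗ[ℂ] Coho (d Z) C'' n :=
  Coho.map₂ _ _ _ _ _ _ p q n (scup γ p q)
    (fun f _ f' _ g _ => by rw [scup, cup_add_left, smul_add]; rfl)
    (fun c f _ g _ => by rw [scup, cup_smul_left, smul_comm]; rfl)
    (fun f _ g _ g' _ => by rw [scup, cup_add_right, smul_add]; rfl)
    (fun c f _ g _ => by rw [scup, cup_smul_right, smul_comm]; rfl)
    (fun f hf g hg => ⟨hmul _ _ _ h f hf.1 g hg.1, LinearMap.mem_ker.mpr (by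
      rw [d_scup γ (hC _ hf.1), LinearMap.mem_ker.mp hf.2, LinearMap.mem_ker.mp hg.2, scup_zero_left,
        scup_zero_right, smul_zero, add_zero])⟩)
    (fun f hf g hg => ⟨sg q • scup γ (p - 1) q f g, zsmul_mem (hmul _ _ _ (by omega) f hf g hg.1) _, by
      rw [sg_smul_map, d_scup γ (hC _ hf), LinearMap.mem_ker.mp hg.2, scup_zero_right, add_zero, smul_smul,
        sg_mul_self, one_smul, sub_add_cancel]⟩)
    (fun f hf g hg => ⟨scup γ p (q - 1) f g, hmul _ _ _ (by omega) f hf.1 g hg, by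
      rw [d_scup γ (hC _ hf.1), LinearMap.mem_ker.mp hf.2, scup_zero_left, smul_zero, zero_add,
        sub_add_cancel]⟩)

/-- The cup product `HH^p(A, X) ⊗ HH^q(A, Y) → HH^(p+q)(A, Z)` for a pairing `X ⊗_A Y → Z`. -/
def HH.mul {X Y Z : Bim A} (γ : Pairing X Y Z) {p q n : ℤ} (h : p + q = n) :
    HH X p →ₗ[ℂ] HH Y q →ₗ[ℂ] HH Z n :=
  mulOf γ _ _ _ (fun _ => le_rfl) (fun _ _ _ h _ hf _ hg => scup_mem γ h hf hg) h

/-- A cochain of degree `0`. -/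
def coch0 {V : Type u} [AddCommGroup V] (x : V) : List A → V
  | [] => x
  | _ :: _ => 0

theorem coch0_mem (X : Bim A) (x : X.carrier) : (coch0 x : List A → X.carrier) ∈ Coch X 0 := by
  refine ⟨?_, ?_⟩
  · rintro (_ | ⟨a, l₁⟩) l₂ <;> exact (0 : A →ₗ[ℂ] X.carrier).isLinear
  · rintro (_ | ⟨a, l⟩) h
    · simp at h
    · rfl

theorem coch0_cocyc (X : Bim A) (x : X.carrier) (hx : ∀ a, X.l a x = X.r a x) :
    d X (coch0 x) = 0 := by
  have h := d_mem (coch0_mem X x)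
  funext l
  by_cases hl : (l.length : ℤ) = 0 + 1
  · obtain ⟨a, rfl⟩ : ∃ a, l = [a] := List.length_eq_one_iff.mp (by omega)
    simp [d_cons, inner_nil, coch0, hx]
  · exact h.2 l hl

theorem coch0_mem_cocyc (X : Bim A) (x : X.carrier) (hx : ∀ a, X.l a x = X.r a x) {p : ℤ} (h : p = 0) :
    (coch0 x : List A → X.carrier) ∈ cocyc (d X) (Coch X) p :=
  ⟨h ▸ coch0_mem X x, LinearMap.mem_ker.mpr (coch0_cocyc X x hx)⟩

/-- The class in `HH^0(A, X)` of a central element of `X`. -/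
def HH.central (X : Bim A) (x : X.carrier) (hx : ∀ a, X.l a x = X.r a x) {p : ℤ} (h : p = 0) : HH X p :=
  Coho.mk _ _ (coch0 x) (coch0_mem_cocyc X x hx h)

end HH

section Gerstenhaber

set_option linter.unusedSectionVars false

variable {A : Type u} [Ring A] [Algebra ℂ A]

theorem brace_zero_left (ε : ℤ) (g : List A → A) : brace ε (0 : List A → A) g = 0 := by
  funext l; simp [brace, hsum]

theorem brace_zero_right (ε : ℤ) {f : List A → A} (hf : f ∈ ML A A) : brace ε f 0 = 0 := by
  funext l; simp [brace, hsum, (hf _ _).map_zero]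

theorem gerst_add_left {p q : ℤ} {f f' g : List A → A} (hg : g ∈ ML A A) :
    gerst p q (f + f') g = gerst p q f g + gerst p q f' g := by
  rw [gerst, brace_add_left, brace_add_right _ hg, gerst, gerst, smul_add]; abel

theorem gerst_add_right {p q : ℤ} {f g g' : List A → A} (hf : f ∈ ML A A) :
    gerst p q f (g + g') = gerst p q f g + gerst p q f g' := by
  rw [gerst, brace_add_left, brace_add_right _ hf, gerst, gerst, smul_add]; abel

theorem gerst_smul_left {p q : ℤ} (c : ℂ) {f g : List A → A} (hg : g ∈ ML A A) :
    gerst p q (c • f) g = c • gerst p q f g := by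
  rw [gerst, brace_smul_left, brace_smul_right _ _ hg, gerst, smul_sub, smul_comm c]

theorem gerst_smul_right {p q : ℤ} (c : ℂ) {f g : List A → A} (hf : f ∈ ML A A) :
    gerst p q f (c • g) = c • gerst p q f g := by
  rw [gerst, brace_smul_left, brace_smul_right _ _ hf, gerst, smul_sub, smul_comm c]

theorem gerst_zero_left (p q : ℤ) {g : List A → A} (hg : g ∈ ML A A) : gerst p q 0 g = 0 := by
  rw [gerst, brace_zero_left, brace_zero_right _ hg, smul_zero, sub_zero]

theorem gerst_zero_right (p q : ℤ) {f : List A → A} (hf : f ∈ ML A A) : gerst p q f 0 = 0 := by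
  rw [gerst, brace_zero_left, brace_zero_right _ hf, smul_zero, sub_zero]

theorem cocyc_dA {C : ℤ → Submodule ℂ (List A → (Bim.diag A).carrier)} {p : ℤ} {f : List A → A}
    (hf : f ∈ cocyc (d (Bim.diag A)) C p) : dA f = 0 :=
  (LinearMap.mem_ker (f := d (Bim.diag A))).mp hf.2

/-- The Gerstenhaber bracket on cohomology, for families of subspaces of the Hochschild cochains which
are closed under it. -/
def bracketOf (C C' C'' : ℤ → Submodule ℂ (List A → (Bim.diag A).carrier))
    (hC : ∀ p, C p ≤ Coch (Bim.diag A) p) (hC' : ∀ p, C' p ≤ Coch (Bim.diag A) p)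
    (hbr : ∀ p q n, p + q = n + 1 → ∀ f ∈ C p, ∀ g ∈ C' q, gerst (A := A) p q f g ∈ C'' n)
    {p q n : ℤ} (h : p + q = n + 1) :
    Coho (d (Bim.diag A)) C p →ₗ[ℂ] Coho (d (Bim.diag A)) C' q →ₗ[ℂ] Coho (d (Bim.diag A)) C'' n :=
  Coho.map₂ _ _ _ _ _ _ p q n (gerst (A := A) p q)
    (fun f _ f' _ g hg => gerst_add_left (hC' _ hg).1)
    (fun c f _ g hg => gerst_smul_left c (hC' _ hg).1)
    (fun f hf g _ g' _ => gerst_add_right (hC _ hf).1)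
    (fun c f hf g _ => gerst_smul_right c (hC _ hf).1)
    (fun f hf g hg => ⟨hbr _ _ _ h f hf.1 g hg.1,
      LinearMap.mem_ker.mpr ((d_gerst (hC _ hf.1) (hC' _ hg.1)).trans (by
        rw [cocyc_dA hf, cocyc_dA hg, gerst_zero_left _ _ (hC' _ hg.1).1,
          gerst_zero_right _ _ (hC _ hf.1).1, smul_zero, add_zero]; rfl))⟩)
    (fun f hf g hg => ⟨sg (q - 1) • gerst (p - 1) q f g,
      zsmul_mem (hbr _ _ _ (by omega) f hf g hg.1) _, by
      have h1 := d_gerst (hC _ hf) (hC' _ hg.1)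
      rw [cocyc_dA hg, gerst_zero_right _ _ (hC _ hf).1, add_zero, sub_add_cancel] at h1
      refine (map_zsmul (d (Bim.diag A)) _ _).trans ?_
      refine (congrArg (fun x => sg (q - 1) • x) h1).trans ?_
      change (sg (q - 1) • sg (q - 1) • gerst p q (dA f) g : List A → A) = gerst p q (dA f) g
      rw [smul_smul, sg_mul_self, one_smul]⟩)
    (fun f hf g hg => ⟨gerst p (q - 1) f g, hbr _ _ _ (by omega) f hf.1 g hg, by
      have h1 := d_gerst (hC _ hf.1) (hC' _ hg)
      rw [cocyc_dA hf, gerst_zero_left _ _ (hC' _ hg).1, smul_zero, zero_add, sub_add_cancel] at h1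
      exact h1⟩)

/-- The Gerstenhaber bracket `HH^p(A, A) ⊗ HH^q(A, A) → HH^(p+q-1)(A, A)`. -/
def HH.bracket (A : Type u) [Ring A] [Algebra ℂ A] {p q n : ℤ} (h : p + q = n + 1) :
    HH (Bim.diag A) p →ₗ[ℂ] HH (Bim.diag A) q →ₗ[ℂ] HH (Bim.diag A) n :=
  bracketOf _ _ _ (fun _ => le_rfl) (fun _ => le_rfl) (fun _ _ _ h _ hf _ hg => gerst_mem hf hg h) h

end Gerstenhaber

/-! ### Hochschild cohomology of a graded algebra

The gradings used below are indexed by a weight `w : ℤ`; the element `ı` has weight `1`, and the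
weight `w` corresponds to the internal degree `-2 w`.  In particular all internal degrees are even, and
no signs arise from them. -/

section Graded

set_option linter.unusedSectionVars false

variable {A : Type u} [Ring A] [Algebra ℂ A] (𝒜 : ℤ → Submodule ℂ A)

/-- The functions `f` on sequences which are homogeneous of weight `w`: if the `aᵢ` are homogeneous
of weight `vᵢ` then `f(a₁, …, aₙ)` is homogeneous of weight `v₁ + ⋯ + vₙ + w`. -/
def Homog (w : ℤ) : Submodule ℂ (List A → (Bim.diag A).carrier) where
  carrier := {f | ∀ l : List (A × ℤ), (∀ x ∈ l, x.1 ∈ 𝒜 x.2) →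
    f (l.map Prod.fst) ∈ 𝒜 ((l.map Prod.snd).sum + w)}
  add_mem' hf hg l hl := (𝒜 _).add_mem (hf l hl) (hg l hl)
  zero_mem' _ _ := (𝒜 _).zero_mem
  smul_mem' c _ hf l hl := (𝒜 _).smul_mem c (hf l hl)

/-- The Hochschild cochains of degree `p` of the graded algebra `A` which are homogeneous of weight
`w`, i.e. the homogeneous linear maps `A^{⊗p} → A` of weight `w`. -/
def GCoch (w p : ℤ) : Submodule ℂ (List A → (Bim.diag A).carrier) := Coch (Bim.diag A) p ⊓ Homog 𝒜 w

variable {𝒜}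

theorem Homog.congr {w w' : ℤ} (h : w = w') {f : List A → A} (hf : f ∈ Homog 𝒜 w) : f ∈ Homog 𝒜 w' :=
  h ▸ hf

theorem Homog.nil {w : ℤ} {f : List A → A} (hf : f ∈ Homog 𝒜 w) : f [] ∈ 𝒜 w := by
  have h : f [] ∈ 𝒜 ((([] : List (A × ℤ)).map Prod.snd).sum + w) := hf [] (by simp)
  have e : (([] : List (A × ℤ)).map Prod.snd).sum + w = w := by simp
  exact e ▸ h

theorem Homog.tl {w v : ℤ} {f : List A → A} (hf : f ∈ Homog 𝒜 w) {a : A} (ha : a ∈ 𝒜 v) :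
    tl f a ∈ Homog 𝒜 (v + w) := by
  intro l hl
  have h := hf ((a, v) :: l) (by
    intro x hx
    rcases List.mem_cons.mp hx with rfl | hx
    · exact ha
    · exact hl x hx)
  have e : (((a, v) :: l).map Prod.snd).sum + w = (l.map Prod.snd).sum + (v + w) := by
    simp only [List.map_cons, List.sum_cons]; ring
  exact e ▸ h

theorem Homog.of {w : ℤ} {f : List A → A} (h0 : f [] ∈ 𝒜 w)
    (h1 : ∀ v, ∀ a ∈ 𝒜 v, HochschildTate.tl f a ∈ Homog 𝒜 (v + w)) : f ∈ Homog 𝒜 w := by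
  rintro (_ | ⟨⟨a, v⟩, l⟩) hl
  · have e : w = (([] : List (A × ℤ)).map Prod.snd).sum + w := by simp
    exact e ▸ h0
  · have h := h1 v a (hl _ List.mem_cons_self) l fun x hx => hl x (List.mem_cons_of_mem _ hx)
    have e : (l.map Prod.snd).sum + (v + w) = (((a, v) :: l).map Prod.snd).sum + w := by
      simp only [List.map_cons, List.sum_cons]; ring
    exact e ▸ h

variable [SetLike.GradedMonoid 𝒜]

theorem mul_mem_gr {v w u : ℤ} (h : v + w = u) {a b : A} (ha : a ∈ 𝒜 v) (hb : b ∈ 𝒜 w) :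
    a * b ∈ 𝒜 u := h ▸ SetLike.mul_mem_graded ha hb

theorem innA_homog {w v : ℤ} {f : List A → A} (hf : f ∈ Homog 𝒜 w) {a : A} (ha : a ∈ 𝒜 v) :
    innA f a ∈ Homog 𝒜 (v + w) := by
  intro l
  induction l generalizing f a w v with
  | nil =>
    intro _
    have e : v + w = (([] : List (A × ℤ)).map Prod.snd).sum + (v + w) := by simp
    refine e ▸ ?_
    have h : innA f a [] = -(f [] * a) := innA_nil f a
    exact h ▸ (𝒜 _).neg_mem (mul_mem_gr (add_comm _ _) (Homog.nil hf) ha)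
  | cons x l ih =>
    obtain ⟨b, i⟩ := x
    intro hl
    have hb : b ∈ 𝒜 i := hl _ List.mem_cons_self
    have hl' : ∀ x ∈ l, x.1 ∈ 𝒜 x.2 := fun x hx => hl x (List.mem_cons_of_mem _ hx)
    have e : (((b, i) :: l).map Prod.snd).sum + (v + w) = (l.map Prod.snd).sum + (i + (v + w)) := by
      simp only [List.map_cons, List.sum_cons]; ring
    refine e ▸ ?_
    have h : innA f a (b :: l.map Prod.fst) = -f ((a * b) :: l.map Prod.fst) -
        innA (tl f a) b (l.map Prod.fst) := inner_cons (X := Bim.diag A) f a b _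
    refine h ▸ (𝒜 _).sub_mem ((𝒜 _).neg_mem ?_) ?_
    · have h1 := Homog.tl hf (mul_mem_gr rfl ha hb) l hl'
      have e1 : (l.map Prod.snd).sum + (i + (v + w)) = (l.map Prod.snd).sum + (v + i + w) := by ring
      exact e1 ▸ h1
    · exact ih (Homog.tl hf ha) hb hl'

theorem d_homog {w : ℤ} {f : List A → A} (hf : f ∈ Homog 𝒜 w) : dA f ∈ Homog 𝒜 w := by
  refine Homog.of ?_ fun v a ha => ?_
  · exact (𝒜 w).zero_mem
  · have h : tl (dA f) a = (fun l => a * f l) + innA f a := tl_dA f a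
    rw [h]
    refine (Homog 𝒜 _).add_mem (fun l hl => ?_) (innA_homog hf ha)
    exact mul_mem_gr (A := A) (by ring) ha (hf l hl)

theorem hsum_homog {W : Type u} {φ : W → List A → A} {w : ℤ} (ψ : ℤ → Set W)
    (hφ : ∀ v, ∀ x ∈ ψ v, φ x ∈ Homog 𝒜 (v + w)) {g : List A → W} {w' : ℤ}
    (hg : ∀ l : List (A × ℤ), (∀ x ∈ l, x.1 ∈ 𝒜 x.2) → g (l.map Prod.fst) ∈ ψ ((l.map Prod.snd).sum + w')) :
    hsum φ g ∈ Homog 𝒜 (w + w') := by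
  intro l hl
  refine (𝒜 _).sum_mem fun i _ => ?_
  have h1 := hg (l.take i) fun x hx => hl x (List.mem_of_mem_take hx)
  have h2 := hφ _ _ h1 (l.drop i) fun x hx => hl x (List.mem_of_mem_drop hx)
  have e : ((l.drop i).map Prod.snd).sum + (((l.take i).map Prod.snd).sum + w' + w) =
      (l.map Prod.snd).sum + (w + w') := by
    have h3 : (l.map Prod.snd).sum = ((l.take i).map Prod.snd).sum + ((l.drop i).map Prod.snd).sum := by
      rw [← List.sum_append, ← List.map_append, List.take_append_drop]
    rw [h3]; ring
  rw [e, List.map_take, List.map_drop] at h2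
  exact h2

theorem cup_homog {f g : List A → A} {w w' : ℤ} (hf : f ∈ Homog 𝒜 w) (hg : g ∈ Homog 𝒜 w') :
    cup (LinearMap.mul ℂ A) f g ∈ Homog 𝒜 (w + w') := by
  have h := hsum_homog (𝒜 := 𝒜) (φ := fun x s => x * g s) (w := w') (fun v => (𝒜 v : Set A))
    (fun v x hx l hl => mul_mem_gr (A := A) (by ring) hx (hg l hl)) (g := f) (w' := w) hf
  rw [add_comm w' w] at h
  exact h

theorem brace_homog (ε : ℤ) {f g : List A → A} {w w' : ℤ} (hf : f ∈ Homog 𝒜 w) (hg : g ∈ Homog 𝒜 w') :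
    brace ε f g ∈ Homog 𝒜 (w + w') := by
  have key : ∀ {f : List A → A} {w : ℤ}, f ∈ Homog 𝒜 w →
      hsum (fun x s => f (x :: s)) g ∈ Homog 𝒜 (w + w') := fun hf =>
    hsum_homog (𝒜 := 𝒜) (fun v => (𝒜 v : Set A)) (fun v x hx => Homog.tl hf hx) hg
  intro l
  induction l generalizing f w with
  | nil =>
    intro hl
    have h : brace ε f g ([] : List A) = hsum (fun x s => f (x :: s)) g [] := by
      rw [brace_nil, hsum_nil]
    exact h ▸ key hf [] hl
  | cons x l ih =>
    obtain ⟨a, v⟩ := x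
    intro hl
    have hl' : ∀ x ∈ l, x.1 ∈ 𝒜 x.2 := fun x hx => hl x (List.mem_cons_of_mem _ hx)
    have h : brace ε f g (((a, v) :: l).map Prod.fst) =
        hsum (fun x s => f (x :: s)) g (((a, v) :: l).map Prod.fst) +
          ε • brace ε (tl f a) g (l.map Prod.fst) := brace_cons ε f g a _
    refine h ▸ (𝒜 _).add_mem (key hf _ hl) (zsmul_mem ?_ _)
    have h1 := ih (Homog.tl hf (hl _ List.mem_cons_self)) hl'
    have e : (l.map Prod.snd).sum + (v + w + w') = (((a, v) :: l).map Prod.snd).sum + (w + w') := by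
      simp only [List.map_cons, List.sum_cons]; ring
    exact e ▸ h1

theorem scup_gmem {f g : List A → A} {p q n w w' v : ℤ} (h : p + q = n) (k : w + w' = v)
    (hf : f ∈ GCoch 𝒜 w p) (hg : g ∈ GCoch 𝒜 w' q) : scup (Pairing.diag A) p q f g ∈ GCoch 𝒜 v n :=
  ⟨scup_mem (Pairing.diag A) h hf.1 hg.1, zsmul_mem (k ▸ cup_homog hf.2 hg.2) _⟩

theorem gerst_gmem {f g : List A → A} {p q n w w' v : ℤ} (h : p + q = n + 1) (k : w + w' = v)
    (hf : f ∈ GCoch 𝒜 w p) (hg : g ∈ GCoch 𝒜 w' q) : gerst p q f g ∈ GCoch 𝒜 v n :=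
  ⟨gerst_mem hf.1 hg.1 h, Submodule.sub_mem _ (k ▸ brace_homog _ hf.2 hg.2)
    (zsmul_mem (Homog.congr (by omega) (brace_homog _ hg.2 hf.2)) _)⟩

variable (𝒜)

/-- The Hochschild cohomology of the graded algebra `A` (with coefficients in `A`) in horizontal degree
`p` and weight `w`. -/
abbrev GHH (w p : ℤ) : Type u := Coho (d (Bim.diag A)) (GCoch 𝒜 w) p

/-- The cup product on the Hochschild cohomology of a graded algebra. -/
def GHH.mul {w w' v p q n : ℤ} (k : w + w' = v) (h : p + q = n) :
    GHH 𝒜 w p →ₗ[ℂ] GHH 𝒜 w' q →ₗ[ℂ] GHH 𝒜 v n :=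
  mulOf (Pairing.diag A) _ _ _ (fun _ => inf_le_left)
    (fun _ _ _ h _ hf _ hg => scup_gmem h k hf hg) h

/-- The Gerstenhaber bracket on the Hochschild cohomology of a graded algebra. -/
def GHH.bracket {w w' v p q n : ℤ} (k : w + w' = v) (h : p + q = n + 1) :
    GHH 𝒜 w p →ₗ[ℂ] GHH 𝒜 w' q →ₗ[ℂ] GHH 𝒜 v n :=
  bracketOf _ _ _ (fun _ => inf_le_left) (fun _ => inf_le_left)
    (fun _ _ _ h _ hf _ hg => gerst_gmem h k hf hg) h

/-- The class in `GHH^0` of a homogeneous central element of `A`. -/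
def GHH.central {w p : ℤ} (x : A) (hx : ∀ a, a * x = x * a) (hw : x ∈ 𝒜 w) (h : p = 0) : GHH 𝒜 w p :=
  Coho.mk _ _ (coch0 x) ⟨⟨(coch0_mem_cocyc (Bim.diag A) x hx h).1, Homog.of (f := coch0 x) hw
    fun _ _ _ _ _ => (𝒜 _).zero_mem⟩, (coch0_mem_cocyc (Bim.diag A) x hx h).2⟩

/-- The cochain of degree `1` given by a linear map. -/
def coch1 (E : A →ₗ[ℂ] A) : List A → A
  | [a] => E a
  | _ => 0

theorem coch1_mem (E : A →ₗ[ℂ] A) : coch1 E ∈ Coch (Bim.diag A) 1 := by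
  refine ⟨?_, ?_⟩
  · rintro (_ | ⟨a, l₁⟩) (_ | ⟨b, l₂⟩)
    · exact E.isLinear
    · exact (0 : A →ₗ[ℂ] A).isLinear
    · rcases l₁ with _ | ⟨c, l₁⟩ <;> exact (0 : A →ₗ[ℂ] A).isLinear
    · rcases l₁ with _ | ⟨c, l₁⟩ <;> exact (0 : A →ₗ[ℂ] A).isLinear
  · rintro (_ | ⟨a, _ | ⟨b, l⟩⟩) h
    · rfl
    · simp at h
    · rfl

theorem coch1_cocyc (E : A →ₗ[ℂ] A) (hE : ∀ a b, E (a * b) = a * E b + E a * b) : dA (coch1 E) = 0 := by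
  have h := d_mem (X := Bim.diag A) (coch1_mem E)
  funext l
  by_cases hl : (l.length : ℤ) = 1 + 1
  · obtain ⟨a, b, rfl⟩ : ∃ a b, l = [a, b] := List.length_eq_two.mp (by omega)
    have h1 : dA (coch1 E) [a, b] = a * E b + (-E (a * b) - -(E a * b)) := by
      have h2 := inner_cons (X := Bim.diag A) (coch1 E) a b []
      rw [inner_nil] at h2
      refine (d_cons (X := Bim.diag A) (coch1 E) a [b]).trans ?_
      rw [h2]; rfl
    rw [h1, hE]
    simp
  · exact h.2 l hl

/-- The class in `GHH^1` of a derivation of the algebra `A` which is homogeneous of weight `w`. -/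
def GHH.derivation {w p : ℤ} (E : A →ₗ[ℂ] A) (hE : ∀ a b, E (a * b) = a * E b + E a * b)
    (hw : ∀ v, ∀ a ∈ 𝒜 v, E a ∈ 𝒜 (v + w)) (h : p = 1) : GHH 𝒜 w p :=
  Coho.mk _ _ (coch1 E) ⟨⟨h ▸ coch1_mem E, Homog.of (f := coch1 E) (𝒜 w).zero_mem fun v a ha =>
    Homog.of (f := tl (coch1 E) a) (hw v a ha) fun _ _ _ _ _ => (𝒜 _).zero_mem⟩,
    LinearMap.mem_ker.mpr (coch1_cocyc E hE)⟩

end Graded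

/-! ### The graded algebra `Λ[ı^{±1}]` -/

noncomputable section Laurent

open LaurentPolynomial

variable (Λ : Type u) [Ring Λ] [Algebra ℂ Λ]

/-- The homogeneous part `Λ ı^w` of `Λ[ı^{±1}]`. -/
def lgr (w : ℤ) : Submodule ℂ (LaurentPolynomial Λ) := LinearMap.range (AddMonoidAlgebra.lsingle w)

variable {Λ}

theorem single_mem_lgr (w : ℤ) (a : Λ) : AddMonoidAlgebra.single w a ∈ lgr Λ w := ⟨a, rfl⟩

theorem lgr_mul_mem {v w u : ℤ} (h : v + w = u) {a b : LaurentPolynomial Λ} (ha : a ∈ lgr Λ v)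
    (hb : b ∈ lgr Λ w) : a * b ∈ lgr Λ u := by
  obtain ⟨a, rfl⟩ := ha
  obtain ⟨b, rfl⟩ := hb
  refine ⟨a * b, ?_⟩
  rw [AddMonoidAlgebra.lsingle_apply, AddMonoidAlgebra.lsingle_apply, AddMonoidAlgebra.lsingle_apply,
    AddMonoidAlgebra.single_mul_single, h]

instance lgr_graded : SetLike.GradedMonoid (lgr Λ) where
  one_mem := ⟨1, rfl⟩
  mul_mem _ _ _ _ ha hb := lgr_mul_mem rfl ha hb

theorem C_mem_lgr (a : Λ) : C a ∈ lgr Λ 0 := ⟨a, rfl⟩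

theorem T_mem_lgr (w : ℤ) : (T w : LaurentPolynomial Λ) ∈ lgr Λ w := ⟨1, rfl⟩

variable (Λ)

/-- The linear map underlying the fractional Euler derivation of `Λ[ı^{±1}]`: it multiplies the elements
of weight `w`, i.e. of internal degree `-2 w`, by `-w`. -/
def eulerMap : LaurentPolynomial Λ →ₗ[ℂ] LaurentPolynomial Λ :=
  Finsupp.lsum ℂ (fun w : ℤ => (-(w : ℂ)) • AddMonoidAlgebra.lsingle w) ∘ₗ
    (AddMonoidAlgebra.coeffLinearEquiv ℂ).toLinearMap

theorem eulerMap_single (w : ℤ) (a : Λ) :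
    eulerMap Λ (AddMonoidAlgebra.single w a) = (-(w : ℂ)) • AddMonoidAlgebra.single w a := by
  change Finsupp.lsum ℂ (fun w : ℤ => (-(w : ℂ)) • AddMonoidAlgebra.lsingle w) (Finsupp.single w a) = _
  rw [Finsupp.lsum_single]
  rfl

theorem eulerMap_mul (a b : LaurentPolynomial Λ) :
    eulerMap Λ (a * b) = a * eulerMap Λ b + eulerMap Λ a * b := by
  induction a using LaurentPolynomial.induction_on' with
  | add p q hp hq => simp only [add_mul, map_add, hp, hq]; abel
  | C_mul_T n x =>
    induction b using LaurentPolynomial.induction_on' with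
    | add p q hp hq => simp only [mul_add, map_add, hp, hq]; abel
    | C_mul_T m y =>
      simp only [← single_eq_C_mul_T, AddMonoidAlgebra.single_mul_single, eulerMap_single,
        mul_smul_comm, smul_mul_assoc, ← add_smul]
      congr 1
      push_cast
      ring

theorem eulerMap_mem (v : ℤ) (a : LaurentPolynomial Λ) (ha : a ∈ lgr Λ v) :
    eulerMap Λ a ∈ lgr Λ (v + 0) := by
  obtain ⟨a, rfl⟩ := ha
  rw [add_zero, AddMonoidAlgebra.lsingle_apply, eulerMap_single]
  exact (lgr Λ v).smul_mem _ (single_mem_lgr v a)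

/-- The class of `ı` in `HH^0(Λ[ı^{±1}])`. -/
def iotaClass : GHH (lgr Λ) 1 0 :=
  GHH.central (lgr Λ) (T 1) (fun a => (commute_T 1 a).symm.eq) (T_mem_lgr 1) rfl

/-- The unit of `HH(Λ[ı^{±1}])`. -/
def oneClass : GHH (lgr Λ) 0 0 :=
  GHH.central (lgr Λ) 1 (fun a => by rw [mul_one, one_mul]) SetLike.GradedOne.one_mem rfl

/-- The fractional Euler class in `HH^1(Λ[ı^{±1}])`. -/
def eulerClass : GHH (lgr Λ) 0 1 :=
  GHH.derivation (lgr Λ) (eulerMap Λ) (eulerMap_mul Λ) (eulerMap_mem Λ) rfl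

/-- The part `Λ ı^w` of weight `w` of `Λ[ı^{±1}]`, as a `Λ`-bimodule. -/
def Lw (w : ℤ) : Bim Λ where
  carrier := lgr Λ w
  l := LinearMap.mk₂ ℂ (fun a x => ⟨C a * x.1, lgr_mul_mem (zero_add w) (C_mem_lgr a) x.2⟩)
    (fun a b x => Subtype.ext (by simp [add_mul]))
    (fun c a x => Subtype.ext (by
      change C (c • a) * x.1 = c • (C a * x.1)
      rw [← smul_mul_assoc]; congr 1; ext n; simp [C_apply]))
    (fun a x y => Subtype.ext (by simp [mul_add]))
    (fun c a x => Subtype.ext (by simp))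
  r := LinearMap.mk₂ ℂ (fun a x => ⟨x.1 * C a, lgr_mul_mem (add_zero w) x.2 (C_mem_lgr a)⟩)
    (fun a b x => Subtype.ext (by simp [mul_add]))
    (fun c a x => Subtype.ext (by
      change x.1 * C (c • a) = c • (x.1 * C a)
      rw [← mul_smul_comm]; congr 1; ext n; simp [C_apply]))
    (fun a x y => Subtype.ext (by simp [add_mul]))
    (fun c a x => Subtype.ext (by simp))
  one_l x := Subtype.ext (by simp)
  mul_l a b x := Subtype.ext (by simp [mul_assoc])
  one_r x := Subtype.ext (by simp)
  mul_r a b x := Subtype.ext (by simp [mul_assoc])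
  l_r a b x := Subtype.ext (by simp [mul_assoc])

/-- The multiplication `Λ ı^w ⊗_Λ Λ ı^{w'} → Λ ı^{w+w'}`. -/
def Lw.mul {w w' v : ℤ} (h : w + w' = v) : Pairing (Lw Λ w) (Lw Λ w') (Lw Λ v) where
  toFun := LinearMap.mk₂ ℂ (fun (x : lgr Λ w) (y : lgr Λ w') =>
      (⟨x.1 * y.1, lgr_mul_mem h x.2 y.2⟩ : lgr Λ v))
    (fun x x' y => Subtype.ext (add_mul x.1 x'.1 y.1))
    (fun c x y => Subtype.ext (smul_mul_assoc c x.1 y.1))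
    (fun x y y' => Subtype.ext (mul_add x.1 y.1 y'.1))
    (fun c x y => Subtype.ext (mul_smul_comm c x.1 y.1))
  map_l a (x : lgr Λ w) (y : lgr Λ w') := Subtype.ext (mul_assoc (C a) x.1 y.1)
  balanced a (x : lgr Λ w) (y : lgr Λ w') := Subtype.ext (mul_assoc x.1 (C a) y.1)
  map_r a (x : lgr Λ w) (y : lgr Λ w') := Subtype.ext (mul_assoc x.1 y.1 (C a)).symm

/-- The projection of `Λ[ı^{±1}]` onto its part of weight `w`. -/
def prW (w : ℤ) : LaurentPolynomial Λ →ₗ[ℂ] (Lw Λ w).carrier where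
  toFun x := (⟨AddMonoidAlgebra.single w (x.coeff w), single_mem_lgr w _⟩ : lgr Λ w)
  map_add' x y := Subtype.ext (AddMonoidAlgebra.single_add w (x.coeff w) (y.coeff w))
  map_smul' c x := Subtype.ext (AddMonoidAlgebra.smul_single c w (x.coeff w)).symm

theorem prW_l (w : ℤ) (a : Λ) (x : LaurentPolynomial Λ) : prW Λ w (C a * x) = (Lw Λ w).l a (prW Λ w x) := by
  refine Subtype.ext ?_
  change AddMonoidAlgebra.single w ((C a * x).coeff w) = C a * AddMonoidAlgebra.single w (x.coeff w)
  rw [← smul_eq_C_mul, ← smul_eq_C_mul, AddMonoidAlgebra.smul_single]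
  rfl

theorem prW_r (w : ℤ) (a : Λ) (x : LaurentPolynomial Λ) : prW Λ w (x * C a) = (Lw Λ w).r a (prW Λ w x) := by
  refine Subtype.ext ?_
  change AddMonoidAlgebra.single w ((x * C a).coeff w) = AddMonoidAlgebra.single w (x.coeff w) * C a
  rw [← single_eq_C, AddMonoidAlgebra.single_mul_single, add_zero]
  congr 1
  induction x using LaurentPolynomial.induction_on' with
  | add p q hp hq => rw [add_mul, AddMonoidAlgebra.coeff_add, AddMonoidAlgebra.coeff_add,
      Finsupp.add_apply, Finsupp.add_apply, hp, hq, add_mul]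
  | C_mul_T n x =>
    rw [← single_eq_C_mul_T, AddMonoidAlgebra.single_mul_single, AddMonoidAlgebra.coeff_single,
      AddMonoidAlgebra.coeff_single, Finsupp.single_apply, Finsupp.single_apply, add_zero]
    split_ifs <;> simp

/-- The restriction of cochains along `j : Λ → Λ[ı^{±1}]`.  (The restriction of a cochain of weight `w`
takes values in `Λ ı^w`, so that the projection to this summand only changes the codomain.) -/
def jCoch (w : ℤ) : (List (LaurentPolynomial Λ) → (Bim.diag (LaurentPolynomial Λ)).carrier) →ₗ[ℂ]
    (List Λ → (Lw Λ w).carrier) where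
  toFun f l := prW Λ w (f (l.map C))
  map_add' f g := by funext l; exact map_add (prW Λ w) _ _
  map_smul' c f := by funext l; exact map_smul (prW Λ w) _ _

theorem jCoch_val (w p : ℤ) {f : List (LaurentPolynomial Λ) → LaurentPolynomial Λ}
    (hf : f ∈ GCoch (lgr Λ) w p) (l : List Λ) : (jCoch Λ w f l : lgr Λ w).1 = f (l.map C) := by
  have h : f ((l.map fun a => ((C a : LaurentPolynomial Λ), (0 : ℤ))).map Prod.fst) ∈
      lgr Λ (((l.map fun a => ((C a : LaurentPolynomial Λ), (0 : ℤ))).map Prod.snd).sum + w) :=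
    hf.2 _ (by simp [C_mem_lgr])
  have e : ((l.map fun a => ((C a : LaurentPolynomial Λ), (0 : ℤ))).map Prod.snd).sum + w = w := by
    rw [List.map_map]
    have : (Prod.snd ∘ fun a : Λ => ((C a : LaurentPolynomial Λ), (0 : ℤ))) = fun _ => 0 := rfl
    simp [this]
  rw [e, List.map_map] at h
  obtain ⟨b, hb⟩ := h
  change AddMonoidAlgebra.single w ((f (l.map C)).coeff w) = f (l.map C)
  have h1 : f (l.map C) = AddMonoidAlgebra.single w b := hb.symm
  rw [h1, AddMonoidAlgebra.coeff_single, Finsupp.single_eq_same]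

theorem jCoch_inner (w : ℤ) (f : List (LaurentPolynomial Λ) → LaurentPolynomial Λ) (a : Λ) (t : List Λ) :
    inner (Lw Λ w) (jCoch Λ w f) a t = prW Λ w (innA f (C a) (t.map C)) := by
  induction t generalizing f a with
  | nil =>
    have h : innA f (C a) (([] : List Λ).map C) = -(f [] * C a) := innA_nil f (C a)
    rw [inner_nil, h, map_neg, prW_r]
    rfl
  | cons b t ih =>
    have h : innA f (C a) ((b :: t).map C) = -f ((C a * C b) :: t.map C) -
        innA (tl f (C a)) (C b) (t.map C) := inner_cons (X := Bim.diag _) f (C a) (C b) _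
    have h3 : jCoch Λ w f ((a * b) :: t) = prW Λ w (f ((C a * C b) :: t.map C)) := by
      rw [← map_mul]; rfl
    rw [h, map_sub, map_neg, ← ih, ← h3]
    exact inner_cons (X := Lw Λ w) _ _ _ _

theorem jCoch_d (w : ℤ) (f : List (LaurentPolynomial Λ) → LaurentPolynomial Λ) :
    jCoch Λ w (dA f) = d (Lw Λ w) (jCoch Λ w f) := by
  funext l
  rcases l with _ | ⟨a, t⟩
  · exact map_zero (prW Λ w)
  · have h : dA f ((a :: t).map C) = C a * f (t.map C) + innA f (C a) (t.map C) := rfl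
    have h2 : jCoch Λ w (dA f) (a :: t) = prW Λ w (dA f ((a :: t).map C)) := rfl
    rw [h2, h, map_add, prW_l, d_cons, jCoch_inner]
    rfl

theorem jCoch_mem (w p : ℤ) {f : List (LaurentPolynomial Λ) → LaurentPolynomial Λ}
    (hf : f ∈ Coch (Bim.diag _) p) : jCoch Λ w f ∈ Coch (Lw Λ w) p := by
  refine ⟨fun l₁ l₂ => ?_, fun l hl => ?_⟩
  · have h1 := hf.1 (l₁.map C) (l₂.map C)
    have h2 : (fun a => jCoch Λ w f (l₁ ++ a :: l₂)) = fun a =>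
        prW Λ w (f (l₁.map C ++ (C a : LaurentPolynomial Λ) :: l₂.map C)) := by
      funext a
      change prW Λ w (f ((l₁ ++ a :: l₂).map C)) = _
      rw [List.map_append, List.map_cons]
    rw [h2]
    exact (prW Λ w ∘ₗ h1.mk' _ ∘ₗ AddMonoidAlgebra.lsingle (R := ℂ) (0 : ℤ)).isLinear
  · have h1 : f (l.map C) = 0 := hf.2 _ (by rwa [List.length_map])
    change prW Λ w (f (l.map C)) = 0
    rw [h1, map_zero]

/-- The restriction `j^* : HH(Λ[ı^{±1}], Λ[ı^{±1}]) → HH(Λ, Λ[ı^{±1}])` along the inclusion `j` of the part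
of weight `0`. -/
def jStar (w p : ℤ) : GHH (lgr Λ) w p →ₗ[ℂ] HH (Lw Λ w) p :=
  Coho.map _ _ _ _ (jCoch Λ w) (fun p f (hf : f ∈ GCoch (lgr Λ) w p) => jCoch_mem Λ w p hf.1) (fun _ f _ => jCoch_d Λ w f) p

/-- The unit of `HH(Λ, Λ[ı^{±1}])`. -/
def oneRel : HH (Lw Λ 0) 0 :=
  HH.central (Lw Λ 0) (⟨1, ⟨1, rfl⟩⟩ : lgr Λ 0)
    (fun a => Subtype.ext (show C a * 1 = 1 * C a by rw [mul_one, one_mul])) rfl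

/-- The unit of `HH(Λ, Λ)`. -/
def oneHH {p : ℤ} (h : p = 0) : HH (Bim.diag Λ) p :=
  HH.central (Bim.diag Λ) (1 : Λ) (fun a => show a * 1 = 1 * a by rw [mul_one, one_mul]) h

/-- Multiplication by `ı^w`, as an isomorphism of bimodules from `Λ` to `Λ ı^w`. -/
def iotaMul (w : ℤ) : (Bim.diag Λ).carrier →ₗ[ℂ] (Lw Λ w).carrier :=
  LinearMap.rangeRestrict (AddMonoidAlgebra.lsingle (R := ℂ) (S := Λ) w)

theorem iotaMul_isHom (w : ℤ) : Bim.IsHom (iotaMul Λ w) where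
  map_l a (x : Λ) := Subtype.ext (by
    change AddMonoidAlgebra.single w (a * x : Λ) = C a * AddMonoidAlgebra.single w x
    rw [← single_eq_C, AddMonoidAlgebra.single_mul_single, zero_add])
  map_r a (x : Λ) := Subtype.ext (by
    change AddMonoidAlgebra.single w (x * a : Λ) = AddMonoidAlgebra.single w x * C a
    rw [← single_eq_C, AddMonoidAlgebra.single_mul_single, add_zero])

end Laurent

section Coefficients

variable {A : Type u} [Ring A] [Algebra ℂ A] {X Y : Bim A}

/-- Composition of a function on sequences with a linear map. -/
def post {V W : Type u} [AddCommGroup V] [Module ℂ V] [AddCommGroup W] [Module ℂ W] (φ : V →ₗ[ℂ] W) :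
    (List A → V) →ₗ[ℂ] (List A → W) where
  toFun f l := φ (f l)
  map_add' f g := by funext l; exact map_add φ _ _
  map_smul' c f := by funext l; exact map_smul φ _ _

theorem Coch.map (φ : X.carrier →ₗ[ℂ] Y.carrier) {i : ℤ} {f : List A → X.carrier}
    (hf : f ∈ Coch X i) : post φ f ∈ Coch Y i :=
  ⟨ML.comp hf.1 φ, fun l hl => (congrArg φ (hf.2 l hl)).trans (map_zero φ)⟩

/-- The functoriality of Hochschild cohomology in the coefficients. -/
def HH.map {φ : X.carrier →ₗ[ℂ] Y.carrier} (hφ : Bim.IsHom φ) (p : ℤ) : HH X p →ₗ[ℂ] HH Y p :=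
  Coho.map _ _ _ _ (post φ) (fun _ _ hf => Coch.map φ hf) (fun _ f _ => (d_map hφ f).symm) p

end Coefficients

/-! ### The algebra `HH(Λ)[ı^{±1}, δ]` -/

section Extension

variable (Λ : Type u) [Ring Λ] [Algebra ℂ Λ]

/-- The part of horizontal degree `p` and of any fixed weight `w` of `HH(Λ, Λ)[ı^{±1}, δ]`, the free
graded commutative `HH(Λ, Λ)`-algebra on the invertible generator `ı`, of horizontal degree `0` and
weight `1`, and on the generator `δ`, of horizontal degree `1` and weight `0` (so that `δ² = 0`).  The pair
`(x, y)` stands for `(x + y δ) ı^w`. -/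
abbrev UE (p : ℤ) : Type u := HH (Bim.diag Λ) p × HH (Bim.diag Λ) (p - 1)

variable {Λ}

/-- The product `(x + y δ) ı^w · (x' + y' δ) ı^w' = (x x' + (x y' + (-1)^q y x') δ) ı^(w + w')`, where `q` is
the degree of `x'`. -/
def UE.mul {p q n : ℤ} (h : p + q = n) (a : UE Λ p) (b : UE Λ q) : UE Λ n :=
  (HH.mul (Pairing.diag Λ) h a.1 b.1,
    HH.mul (Pairing.diag Λ) (show p + (q - 1) = n - 1 by omega) a.1 b.2 +
      sg q • HH.mul (Pairing.diag Λ) (show p - 1 + q = n - 1 by omega) a.2 b.1)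

/-- The bracket of `(x + y δ) ı^w` and `(x' + y' δ) ı^w'`, of horizontal degrees `p` and `q`.  It is the
extension of the Gerstenhaber bracket of `HH(Λ, Λ)` by the graded Leibniz rule
`[a, b c] = [a, b] c + (-1)^((|a| - 1) |b|) b [a, c]` and graded antisymmetry
`[a, b] = -(-1)^((|a| - 1) (|b| - 1)) [b, a]` from the relations
`[ı, x] = 0`, `[ı, ı] = 0`, `[δ, x] = 0`, `[δ, ı] = -ı` (and `[δ, δ] = 0`, as `δ` is of degree `1`). -/
def UE.bracket (w w' : ℤ) {p q n : ℤ} (h : p + q = n + 1) (a : UE Λ p) (b : UE Λ q) : UE Λ n :=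
  (HH.bracket Λ h a.1 b.1 - w' • HH.mul (Pairing.diag Λ) (show p - 1 + q = n by omega) a.2 b.1 +
      (sg (q - 1) * w) • HH.mul (Pairing.diag Λ) (show p + (q - 1) = n by omega) a.1 b.2,
    HH.bracket Λ (show p + (q - 1) = n - 1 + 1 by omega) a.1 b.2 +
      sg (q - 1) • HH.bracket Λ (show p - 1 + q = n - 1 + 1 by omega) a.2 b.1 +
      (w - w') • HH.mul (Pairing.diag Λ) (show p - 1 + (q - 1) = n - 1 by omega) a.2 b.2)

end Extension

/-! ### Syzygies, projective bimodules and the stable category -/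

noncomputable section Syzygies

variable {A : Type u} [Ring A] [Algebra ℂ A]

/-- The bimodule `A ⊗ X`, with `A` acting from the left on `A` and from the right on `X`. -/
def Bim.tens (X : Bim A) : Bim A where
  carrier := A ⊗[ℂ] X.carrier
  l := LinearMap.rTensorHom X.carrier ∘ₗ LinearMap.mul ℂ A
  r := LinearMap.lTensorHom A ∘ₗ X.r
  one_l t := by
    induction t using TensorProduct.induction_on with
    | zero => exact map_zero _
    | tmul b x => simp
    | add s t hs ht => rw [map_add, hs, ht]
  mul_l a b t := by
    induction t using TensorProduct.induction_on with
    | zero => simp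
    | tmul c x => simp [mul_assoc]
    | add s t hs ht => rw [map_add, hs, ht, map_add, map_add]
  one_r t := by
    induction t using TensorProduct.induction_on with
    | zero => exact map_zero _
    | tmul b x => simp [X.one_r]
    | add s t hs ht => rw [map_add, hs, ht]
  mul_r a b t := by
    induction t using TensorProduct.induction_on with
    | zero => simp
    | tmul c x => simp [X.mul_r]
    | add s t hs ht => rw [map_add, hs, ht, map_add, map_add]
  l_r a b t := by
    induction t using TensorProduct.induction_on with
    | zero => simp
    | tmul c x => simp
    | add s t hs ht => rw [map_add, map_add, hs, ht, map_add, map_add]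

/-- The element `a ⊗ x` of `A ⊗ X`. -/
def tm (X : Bim A) : A →ₗ[ℂ] X.carrier →ₗ[ℂ] X.tens.carrier := TensorProduct.mk ℂ A X.carrier

/-- The linear map on `A ⊗ X` given by a bilinear map. -/
def tlift (X : Bim A) {V : Type u} [AddCommGroup V] [Module ℂ V] (c : A →ₗ[ℂ] X.carrier →ₗ[ℂ] V) :
    X.tens.carrier →ₗ[ℂ] V := TensorProduct.lift c

theorem tlift_tm (X : Bim A) {V : Type u} [AddCommGroup V] [Module ℂ V]
    (c : A →ₗ[ℂ] X.carrier →ₗ[ℂ] V) (a : A) (x : X.carrier) : tlift X c (tm X a x) = c a x :=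
  TensorProduct.lift.tmul _ _

theorem tens_ext {X : Bim A} {V : Type u} [AddCommGroup V] [Module ℂ V]
    (f g : X.tens.carrier →ₗ[ℂ] V) (h : ∀ a x, f (tm X a x) = g (tm X a x)) (t : X.tens.carrier) :
    f t = g t := LinearMap.congr_fun (TensorProduct.ext' h) t

theorem tens_l (X : Bim A) (a b : A) (x : X.carrier) : X.tens.l a (tm X b x) = tm X (a * b) x := rfl

theorem tens_r (X : Bim A) (a b : A) (x : X.carrier) : X.tens.r a (tm X b x) = tm X b (X.r a x) := rfl

/-- The action `A ⊗ X → X`, `a ⊗ x ↦ a x`. -/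
def act (X : Bim A) : X.tens.carrier →ₗ[ℂ] X.carrier := tlift X X.l

theorem act_tm (X : Bim A) (a : A) (x : X.carrier) : act X (tm X a x) = X.l a x := tlift_tm X X.l a x

theorem act_isHom (X : Bim A) : Bim.IsHom (X := X.tens) (Y := X) (act X) where
  map_l a := tens_ext (act X ∘ₗ X.tens.l a) (X.l a ∘ₗ act X) fun b x => by
    rw [LinearMap.comp_apply, LinearMap.comp_apply, tens_l, act_tm, act_tm, X.mul_l]
  map_r a := tens_ext (act X ∘ₗ X.tens.r a) (X.r a ∘ₗ act X) fun b x => by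
    rw [LinearMap.comp_apply, LinearMap.comp_apply, tens_r, act_tm, act_tm, X.l_r]

theorem act_surj (X : Bim A) : Function.Surjective (act X) := fun x =>
  ⟨tm X 1 x, by rw [act_tm, X.one_l]⟩

/-- The kernel of `A ⊗ X → X`.  If `X` is projective as a right module, then `A ⊗ X` is a projective
bimodule and this is a syzygy of `X` in the category of bimodules. -/
def Bim.syz (X : Bim A) : Bim A where
  carrier := LinearMap.ker (act X)
  l := LinearMap.mk₂ ℂ (fun a t => ⟨X.tens.l a t.1, by
      rw [LinearMap.mem_ker, (act_isHom X).map_l, LinearMap.mem_ker.mp t.2, map_zero]⟩)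
    (fun a b t => Subtype.ext (by simp)) (fun c a t => Subtype.ext (by simp))
    (fun a s t => Subtype.ext (by simp)) (fun c a t => Subtype.ext (by simp))
  r := LinearMap.mk₂ ℂ (fun a t => ⟨X.tens.r a t.1, by
      rw [LinearMap.mem_ker, (act_isHom X).map_r, LinearMap.mem_ker.mp t.2, map_zero]⟩)
    (fun a b t => Subtype.ext (by simp)) (fun c a t => Subtype.ext (by simp))
    (fun a s t => Subtype.ext (by simp)) (fun c a t => Subtype.ext (by simp))
  one_l t := Subtype.ext (X.tens.one_l t.1)
  mul_l a b t := Subtype.ext (X.tens.mul_l a b t.1)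
  one_r t := Subtype.ext (X.tens.one_r t.1)
  mul_r a b t := Subtype.ext (X.tens.mul_r a b t.1)
  l_r a b t := Subtype.ext (X.tens.l_r a b t.1)

/-- The inclusion of the syzygy in `A ⊗ X`. -/
def syzInc (X : Bim A) : X.syz.carrier →ₗ[ℂ] X.tens.carrier := (LinearMap.ker (act X)).subtype

theorem syzInc_isHom (X : Bim A) : Bim.IsHom (X := X.syz) (Y := X.tens) (syzInc X) where
  map_l _ _ := rfl
  map_r _ _ := rfl

theorem syzInc_inj (X : Bim A) {s t : X.syz.carrier} (h : syzInc X s = syzInc X t) : s = t :=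
  Subtype.ext h

theorem act_syzInc (X : Bim A) (t : X.syz.carrier) : act X (syzInc X t) = 0 := LinearMap.mem_ker.mp t.2

theorem act_kap (X : Bim A) (a : A) (x : X.carrier) :
    (tm X - X.l.compr₂ (tm X 1)) a x ∈ LinearMap.ker (act X) := by
  rw [LinearMap.mem_ker, LinearMap.sub_apply, LinearMap.sub_apply, LinearMap.compr₂_apply, map_sub, act_tm,
    act_tm, X.one_l, sub_self]

/-- The element `a ⊗ x - 1 ⊗ a x` of the syzygy of `X`. -/
def kap (X : Bim A) : A →ₗ[ℂ] X.carrier →ₗ[ℂ] X.syz.carrier :=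
  LinearMap.mk₂ ℂ (fun a x => (⟨(tm X - X.l.compr₂ (tm X 1)) a x, act_kap X a x⟩ : LinearMap.ker (act X)))
    (fun a b x => Subtype.ext (LinearMap.map_add₂ _ a b x))
    (fun c a x => Subtype.ext (LinearMap.map_smul₂ _ c a x))
    (fun _ x y => Subtype.ext (map_add _ x y))
    (fun c _ x => Subtype.ext (map_smul _ c x))

theorem syzInc_kap (X : Bim A) (a : A) (x : X.carrier) :
    syzInc X (kap X a x) = tm X a x - tm X 1 (X.l a x) := rfl

theorem kap_one (X : Bim A) (x : X.carrier) : kap X 1 x = 0 :=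
  syzInc_inj X (by rw [syzInc_kap, X.one_l, sub_self]; exact (map_zero (syzInc X)).symm)

/-- The iterated syzygies `Ω^k X`. -/
def Bim.syzN (X : Bim A) : ℕ → Bim A
  | 0 => X
  | k + 1 => (X.syzN k).syz

/-- Projective bimodules. -/
def Bim.Projective (P : Bim A) : Prop :=
  ∀ (Y Z : Bim A) (e : Y.carrier →ₗ[ℂ] Z.carrier) (g : P.carrier →ₗ[ℂ] Z.carrier),
    Bim.IsHom e → Function.Surjective e → Bim.IsHom g →
      ∃ g' : P.carrier →ₗ[ℂ] Y.carrier, Bim.IsHom g' ∧ e ∘ₗ g' = g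

/-- A linear map between bimodules is right linear. -/
def Bim.IsRight {X Y : Bim A} (φ : X.carrier →ₗ[ℂ] Y.carrier) : Prop :=
  ∀ a x, φ (X.r a x) = Y.r a (φ x)

/-- Bimodules which are projective as right modules, in the form in which it is used. -/
def Bim.RProj (P : Bim A) : Prop :=
  ∀ (Y Z : Bim A) (e : Y.carrier →ₗ[ℂ] Z.carrier) (g : P.carrier →ₗ[ℂ] Z.carrier),
    Bim.IsHom e → Function.Surjective e → Bim.IsRight g →
      ∃ g' : P.carrier →ₗ[ℂ] Y.carrier, Bim.IsRight g' ∧ e ∘ₗ g' = g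

theorem RProj.tens_projective {X : Bim A} (h : X.RProj) : X.tens.Projective := by
  intro Y Z e g he hes hg
  obtain ⟨g', hg', heg⟩ := h Y Z e (g ∘ₗ tm X 1) he hes (fun a x => by
    rw [LinearMap.comp_apply, ← tens_r, hg.map_r]; rfl)
  refine ⟨tlift X (Y.l.compl₂ g'), ⟨fun a => ?_, fun a => ?_⟩, LinearMap.ext ?_⟩
  · refine tens_ext (tlift X (Y.l.compl₂ g') ∘ₗ X.tens.l a) (Y.l a ∘ₗ tlift X (Y.l.compl₂ g')) fun b x => ?_
    rw [LinearMap.comp_apply, LinearMap.comp_apply, tens_l, tlift_tm, tlift_tm]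
    exact Y.mul_l a b (g' x)
  · refine tens_ext (tlift X (Y.l.compl₂ g') ∘ₗ X.tens.r a) (Y.r a ∘ₗ tlift X (Y.l.compl₂ g')) fun b x => ?_
    rw [LinearMap.comp_apply, LinearMap.comp_apply, tens_r, tlift_tm, tlift_tm, LinearMap.compl₂_apply, hg',
      Y.l_r]
    rfl
  · refine tens_ext _ _ fun b x => ?_
    rw [LinearMap.comp_apply, tlift_tm, LinearMap.compl₂_apply, he.map_l]
    have h1 : e (g' x) = g (tm X 1 x) := LinearMap.congr_fun heg x
    rw [h1, ← hg.map_l, tens_l, mul_one]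

theorem RProj.tens {X : Bim A} (h : X.RProj) : X.tens.RProj := by
  intro Y Z e g he hes hg
  let b := Module.Basis.ofVectorSpace ℂ A
  have h1 : ∀ i, ∃ g' : X.carrier →ₗ[ℂ] Y.carrier, Bim.IsRight g' ∧ e ∘ₗ g' = g ∘ₗ tm X (b i) :=
    fun i => h Y Z e (g ∘ₗ tm X (b i)) he hes (fun a x => by
      rw [LinearMap.comp_apply, ← tens_r, hg]; rfl)
  choose g' hg' heg using h1
  let c : A →ₗ[ℂ] X.carrier →ₗ[ℂ] Y.carrier := b.constr ℂ g'
  have hc : ∀ i, c (b i) = g' i := fun i => b.constr_basis ℂ g' i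
  refine ⟨tlift X c, fun a => ?_, LinearMap.ext ?_⟩
  · refine tens_ext (tlift X c ∘ₗ X.tens.r a) (Y.r a ∘ₗ tlift X c) fun b' x => ?_
    rw [LinearMap.comp_apply, LinearMap.comp_apply, tens_r, tlift_tm, tlift_tm]
    have h2 : c.compl₂ (X.r a) = c.compr₂ (Y.r a) := b.ext fun i => LinearMap.ext fun x => by
      rw [LinearMap.compl₂_apply, LinearMap.compr₂_apply, hc, hg' i]
    exact LinearMap.congr_fun (LinearMap.congr_fun h2 b') x
  · refine tens_ext _ _ fun b' x => ?_
    rw [LinearMap.comp_apply, tlift_tm]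
    have h2 : c.compr₂ e = (tm X).compr₂ g := b.ext fun i => LinearMap.ext fun x => by
      rw [LinearMap.compr₂_apply, hc]
      exact LinearMap.congr_fun (heg i) x
    exact LinearMap.congr_fun (LinearMap.congr_fun h2 b') x

/-- A retraction of the inclusion of the syzygy, as right modules. -/
def syzRet (X : Bim A) : X.tens.carrier →ₗ[ℂ] X.syz.carrier := tlift X (kap X)

theorem syzRet_tm (X : Bim A) (a : A) (x : X.carrier) : syzRet X (tm X a x) = kap X a x :=
  tlift_tm X (kap X) a x

theorem kap_r (X : Bim A) (a b : A) (x : X.carrier) : kap X b (X.r a x) = X.syz.r a (kap X b x) := by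
  apply syzInc_inj X
  rw [(syzInc_isHom X).map_r, syzInc_kap, syzInc_kap, X.l_r, map_sub, tens_r, tens_r]

theorem syzInc_syzRet (X : Bim A) (t : X.tens.carrier) :
    syzInc X (syzRet X t) = t - tm X 1 (act X t) :=
  tens_ext (syzInc X ∘ₗ syzRet X) (LinearMap.id - tm X 1 ∘ₗ act X) (fun b x => by
    rw [LinearMap.comp_apply, syzRet_tm, syzInc_kap, LinearMap.sub_apply, LinearMap.comp_apply, act_tm]
    rfl) t

theorem syzRet_syzInc (X : Bim A) (t : X.syz.carrier) : syzRet X (syzInc X t) = t := by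
  apply syzInc_inj X
  rw [syzInc_syzRet, act_syzInc, map_zero, sub_zero]

theorem RProj.syz {X : Bim A} (h : X.RProj) : X.syz.RProj := by
  intro Y Z e g he hes hg
  obtain ⟨G, hG, heG⟩ := RProj.tens h Y Z e (g ∘ₗ syzRet X) he hes fun a =>
    tens_ext ((g ∘ₗ syzRet X) ∘ₗ X.tens.r a) (Z.r a ∘ₗ g ∘ₗ syzRet X) fun b x => by
      simp only [LinearMap.comp_apply, tens_r, syzRet_tm, kap_r]
      exact hg _ _
  refine ⟨G ∘ₗ syzInc X, fun a t => ?_, LinearMap.ext fun t => ?_⟩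
  · rw [LinearMap.comp_apply, (syzInc_isHom X).map_r, hG]; rfl
  · have h1 := LinearMap.congr_fun heG (syzInc X t)
    rw [LinearMap.comp_apply, LinearMap.comp_apply, syzRet_syzInc] at h1
    exact h1

theorem RProj.syzN {X : Bim A} (h : X.RProj) : ∀ k, (X.syzN k).RProj
  | 0 => h
  | k + 1 => RProj.syz (RProj.syzN h k)

/-- A bimodule which is free of rank one as a right module. -/
theorem rproj_of_free (X : Bim A) (x₀ : X.carrier) (c : X.carrier →ₗ[ℂ] A)
    (h : ∀ x, X.r (c x) x₀ = x) (h' : ∀ a x, c (X.r a x) = c x * a) : X.RProj := by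
  intro Y Z e g he hes hg
  obtain ⟨y, hy⟩ := hes (g x₀)
  refine ⟨Y.r.flip y ∘ₗ c, fun a x => ?_, LinearMap.ext fun x => ?_⟩
  · rw [LinearMap.comp_apply, h', LinearMap.flip_apply, Y.mul_r]; rfl
  · rw [LinearMap.comp_apply, LinearMap.comp_apply, LinearMap.flip_apply, he.map_r, hy, ← hg, h]

theorem rproj_diag (A : Type u) [Ring A] [Algebra ℂ A] : (Bim.diag A).RProj :=
  rproj_of_free (Bim.diag A) (1 : A) (LinearMap.id (M := A)) (fun x => one_mul (M := A) x) fun _ _ => rfl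

theorem rproj_Lw (w : ℤ) : (Lw A w).RProj := by
  refine rproj_of_free (Lw A w) (⟨AddMonoidAlgebra.single w 1, single_mem_lgr w 1⟩ : lgr A w)
    (Finsupp.lapply w ∘ₗ (AddMonoidAlgebra.coeffLinearEquiv ℂ).toLinearMap ∘ₗ (lgr A w).subtype) ?_ ?_
  · rintro ⟨_, a, rfl⟩
    refine Subtype.ext ?_
    change AddMonoidAlgebra.single w (1 : A) * LaurentPolynomial.C
      ((AddMonoidAlgebra.single w a).coeff w) = AddMonoidAlgebra.single w a
    rw [← LaurentPolynomial.single_eq_C, AddMonoidAlgebra.single_mul_single, AddMonoidAlgebra.coeff_single,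
      Finsupp.single_eq_same, one_mul, add_zero]
  · rintro b ⟨_, a, rfl⟩
    change (AddMonoidAlgebra.single w a * LaurentPolynomial.C b).coeff w =
      (AddMonoidAlgebra.single w a).coeff w * b
    rw [← LaurentPolynomial.single_eq_C, AddMonoidAlgebra.single_mul_single, AddMonoidAlgebra.coeff_single,
      AddMonoidAlgebra.coeff_single, add_zero, Finsupp.single_eq_same, Finsupp.single_eq_same]

end Syzygies

noncomputable section Stable

variable {A : Type u} [Ring A] [Algebra ℂ A]

/-- The Hochschild cocycles of degree `i` with values in `X`; for `i ≥ 0` they are the bimodule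
homomorphisms `Ω^i A → X` on the `i`-th syzygy of `A` in the bar resolution. -/
abbrev Zc (X : Bim A) (i : ℤ) : Submodule ℂ (List A → X.carrier) := cocyc (d X) (Coch X) i

theorem Zc.d_eq {X : Bim A} {i : ℤ} {f : List A → X.carrier} (hf : f ∈ Zc X i) : d X f = 0 :=
  LinearMap.mem_ker.mp hf.2

theorem Zc.map {X Y : Bim A} {φ : X.carrier →ₗ[ℂ] Y.carrier} (hφ : Bim.IsHom φ) {i : ℤ}
    {f : List A → X.carrier} (hf : f ∈ Zc X i) : (fun l => φ (f l)) ∈ Zc Y i :=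
  ⟨Coch.map φ hf.1, LinearMap.mem_ker.mpr (by
    rw [d_map hφ, Zc.d_eq hf]; funext l; exact map_zero φ)⟩

/-- The homomorphisms `Ω^i A → X` which factor through a projective bimodule. -/
def Nul (X : Bim A) (i : ℤ) : Submodule ℂ (List A → X.carrier) :=
  Submodule.span ℂ {f | ∃ P : Bim A, P.Projective ∧ ∃ u ∈ Zc P i, ∃ v : P.carrier →ₗ[ℂ] X.carrier,
    Bim.IsHom v ∧ f = fun l => v (u l)}

theorem Nul_le (X : Bim A) (i : ℤ) : Nul X i ≤ Zc X i := by
  refine Submodule.span_le.mpr ?_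
  rintro _ ⟨P, -, u, hu, v, hv, rfl⟩
  exact Zc.map hv hu

theorem Bim.IsHom.comp {X Y Z : Bim A} {ψ : Y.carrier →ₗ[ℂ] Z.carrier} (hψ : Bim.IsHom ψ)
    {φ : X.carrier →ₗ[ℂ] Y.carrier} (hφ : Bim.IsHom φ) : Bim.IsHom (X := X) (Y := Z) (ψ ∘ₗ φ) where
  map_l a x := by rw [LinearMap.comp_apply, hφ.map_l, hψ.map_l]; rfl
  map_r a x := by rw [LinearMap.comp_apply, hφ.map_r, hψ.map_r]; rfl

theorem Nul.map {X Y : Bim A} {φ : X.carrier →ₗ[ℂ] Y.carrier} (hφ : Bim.IsHom φ) {i : ℤ}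
    {f : List A → X.carrier} (hf : f ∈ Nul X i) : post φ f ∈ Nul Y i := by
  have h : Nul X i ≤ (Nul Y i).comap (post φ) := by
    refine Submodule.span_le.mpr ?_
    rintro _ ⟨P, hP, u, hu, v, hv, rfl⟩
    exact Submodule.subset_span ⟨P, hP, u, hu, φ ∘ₗ v, Bim.IsHom.comp hφ hv, rfl⟩
  exact h hf

theorem tm_isRight (X : Bim A) (a : A) : Bim.IsRight (X := X) (Y := X.tens) (tm X a) := fun _ _ => rfl

theorem d_mem_Nul {X : Bim A} (hX : X.RProj) {i n : ℤ} (h : i + 1 = n) {g : List A → X.carrier}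
    (hg : g ∈ Coch X i) : d X g ∈ Nul X n := by
  subst h
  have h1 : (fun l => tm X 1 (g l)) ∈ Coch X.tens i := Coch.map (Y := X.tens) (tm X 1) hg
  refine Submodule.subset_span ⟨X.tens, RProj.tens_projective hX, d X.tens fun l => tm X 1 (g l),
    ⟨d_mem h1, LinearMap.mem_ker.mpr (d_d _)⟩, act X, act_isHom X, ?_⟩
  rw [← d_map (act_isHom X)]
  congr 1
  funext l
  rw [act_tm, X.one_l]

/-- The map `Hom(Ω^i A, X) → Hom(Ω^(i+1) A, Ω X)` (on cocycles) given by the functor `Ω`. -/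
def om (X : Bim A) : (List A → X.carrier) →ₗ[ℂ] (List A → X.syz.carrier) where
  toFun f l := match l with
    | [] => 0
    | a :: t => kap X a (f t)
  map_add' f g := by
    funext l
    rcases l with _ | ⟨a, t⟩
    · exact (add_zero _).symm
    · exact map_add (kap X a) _ _
  map_smul' c f := by
    funext l
    rcases l with _ | ⟨a, t⟩
    · exact (smul_zero c).symm
    · exact map_smul (kap X a) _ _

theorem om_nil (X : Bim A) (f : List A → X.carrier) : om X f [] = 0 := rfl

theorem om_cons (X : Bim A) (f : List A → X.carrier) (a : A) (t : List A) :
    om X f (a :: t) = kap X a (f t) := rfl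

theorem om_mem {X : Bim A} {i n : ℤ} (h : i + 1 = n) {f : List A → X.carrier} (hf : f ∈ Coch X i) :
    om X f ∈ Coch X.syz n := by
  subst h
  refine ⟨?_, ?_⟩
  · rintro (_ | ⟨a, l₁⟩) l₂
    · exact ((kap X).flip (f l₂)).isLinear
    · exact (kap X a ∘ₗ (hf.1 l₁ l₂).mk' _).isLinear
  · rintro (_ | ⟨a, t⟩) hl
    · rfl
    · rw [om_cons, hf.2 t (fun h => hl (by simp [h])), map_zero]

theorem syzInc_om (X : Bim A) (f : List A → X.carrier) :
    post (syzInc X) (om X f) = d X.tens (post (tm X 1) f) - post (tm X 1) (d X f) := by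
  funext l
  rcases l with _ | ⟨a, t⟩
  · change syzInc X 0 = 0 - tm X 1 0
    rw [map_zero, map_zero, sub_zero]
  · change syzInc X (kap X a (f t)) = d X.tens (post (tm X 1) f) (a :: t) - tm X 1 (d X f (a :: t))
    have h1 : inner X.tens (post (tm X 1) f) a t = tm X 1 (inner X f a t) :=
      inner_map (X := X) (Y := X.tens) (tm X 1) (fun _ _ => rfl) f a t
    rw [syzInc_kap, d_cons, d_cons, h1, map_add]
    change tm X a (f t) - _ = X.tens.l a (tm X 1 (f t)) + _ - _
    rw [tens_l, mul_one]
    abel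

theorem d_om (X : Bim A) (f : List A → X.carrier) : d X.syz (om X f) = - om X (d X f) := by
  have h1 : post (syzInc X) (d X.syz (om X f)) = d X.tens (post (syzInc X) (om X f)) :=
    (d_map (syzInc_isHom X) (om X f)).symm
  have h2 := syzInc_om X (d X f)
  rw [syzInc_om, map_sub, d_d, zero_sub] at h1
  rw [d_d, map_zero, sub_zero] at h2
  rw [← h2] at h1
  funext l
  refine syzInc_inj X ?_
  have h3 := congrFun h1 l
  refine h3.trans ?_
  exact (map_neg (syzInc X) (om X (d X f) l)).symm

theorem om_mem_Zc {X : Bim A} {i n : ℤ} (h : i + 1 = n) {f : List A → X.carrier} (hf : f ∈ Zc X i) :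
    om X f ∈ Zc X.syz n :=
  ⟨om_mem h hf.1, LinearMap.mem_ker.mpr (by rw [d_om, Zc.d_eq hf, map_zero, neg_zero])⟩

/-- The iterates of the previous map, on the cochains with values in `X`. -/
def omN (X : Bim A) : ∀ k, (List A → X.carrier) →ₗ[ℂ] (List A → (X.syzN k).carrier)
  | 0 => LinearMap.id
  | k + 1 => om (X.syzN k) ∘ₗ omN X k

theorem omN_mem {X : Bim A} {i : ℤ} {f : List A → X.carrier} (hf : f ∈ Coch X i) :
    ∀ k : ℕ, omN X k f ∈ Coch (X.syzN k) (i + k)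
  | 0 => by
    have e : i + ((0 : ℕ) : ℤ) = i := by simp
    exact e.symm ▸ hf
  | k + 1 => om_mem (by push_cast; ring) (omN_mem hf k)

theorem d_omN (X : Bim A) (f : List A → X.carrier) :
    ∀ k : ℕ, d (X.syzN k) (omN X k f) = (-1 : ℤ) ^ k • omN X k (d X f)
  | 0 => by rw [pow_zero, one_smul]; rfl
  | k + 1 => by
    change d (X.syzN k).syz (om (X.syzN k) (omN X k f)) = (-1 : ℤ) ^ (k + 1) • om (X.syzN k) (omN X k (d X f))
    rw [d_om, d_omN X f k, sg_smul_map, pow_succ, mul_neg, mul_one, neg_smul]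

/-! ### Products of homomorphisms between syzygies -/

variable {M N P : Bim A}

/-- `(A ⊗ M) ⊗_A N → A ⊗ P` -/
def Pairing.tens (γ : Pairing M N P) : Pairing M.tens N P.tens where
  toFun := (LinearMap.lTensorHom A ∘ₗ γ.toFun.flip).flip
  map_l a t y := tens_ext (((LinearMap.lTensorHom A ∘ₗ γ.toFun.flip) y) ∘ₗ M.tens.l a)
    (P.tens.l a ∘ₗ ((LinearMap.lTensorHom A ∘ₗ γ.toFun.flip) y)) (fun _ _ => rfl) t
  balanced a t y := tens_ext (((LinearMap.lTensorHom A ∘ₗ γ.toFun.flip) y) ∘ₗ M.tens.r a)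
    ((LinearMap.lTensorHom A ∘ₗ γ.toFun.flip) (N.l a y)) (fun b x => by
      change tm P b (γ.toFun (M.r a x) y) = tm P b (γ.toFun x (N.l a y))
      rw [γ.balanced]) t
  map_r a t y := tens_ext ((LinearMap.lTensorHom A ∘ₗ γ.toFun.flip) (N.r a y))
    (P.tens.r a ∘ₗ ((LinearMap.lTensorHom A ∘ₗ γ.toFun.flip) y)) (fun b x => by
      change tm P b (γ.toFun x (N.r a y)) = tm P b (P.r a (γ.toFun x y))
      rw [γ.map_r]) t

theorem Pairing.tens_tm (γ : Pairing M N P) (a : A) (x : M.carrier) (y : N.carrier) :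
    γ.tens.toFun (tm M a x) y = tm P a (γ.toFun x y) := rfl

theorem Pairing.act_tens (γ : Pairing M N P) (t : M.tens.carrier) (y : N.carrier) :
    act P (γ.tens.toFun t y) = γ.toFun (act M t) y :=
  tens_ext (act P ∘ₗ γ.tens.toFun.flip y) (γ.toFun.flip y ∘ₗ act M) (fun a x => by
    change act P (γ.tens.toFun (tm M a x) y) = γ.toFun (act M (tm M a x)) y
    rw [γ.tens_tm, act_tm, act_tm, γ.map_l]) t

/-- `(Ω M) ⊗_A N → Ω P` -/
def Pairing.syz (γ : Pairing M N P) : Pairing M.syz N P.syz where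
  toFun := LinearMap.mk₂ ℂ (fun t y => (⟨γ.tens.toFun (syzInc M t) y, by
      rw [LinearMap.mem_ker, γ.act_tens, act_syzInc, map_zero, LinearMap.zero_apply]⟩ :
        LinearMap.ker (act P)))
    (fun s t y => Subtype.ext (by
      change γ.tens.toFun (syzInc M (s + t)) y = _
      rw [map_add, LinearMap.map_add₂]; rfl))
    (fun c t y => Subtype.ext (by
      change γ.tens.toFun (syzInc M (c • t)) y = _
      rw [map_smul, LinearMap.map_smul₂]; rfl))
    (fun t _ _ => Subtype.ext (map_add (γ.tens.toFun (syzInc M t)) _ _))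
    (fun _ t _ => Subtype.ext (map_smul (γ.tens.toFun (syzInc M t)) _ _))
  map_l a t y := Subtype.ext (γ.tens.map_l a (syzInc M t) y)
  balanced a t y := Subtype.ext (γ.tens.balanced a (syzInc M t) y)
  map_r a t y := Subtype.ext (γ.tens.map_r a (syzInc M t) y)

theorem Pairing.syzInc_syz (γ : Pairing M N P) (t : M.syz.carrier) (y : N.carrier) :
    syzInc P (γ.syz.toFun t y) = γ.tens.toFun (syzInc M t) y := rfl

theorem Pairing.syz_kap (γ : Pairing M N P) (a : A) (x : M.carrier) (y : N.carrier) :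
    γ.syz.toFun (kap M a x) y = kap P a (γ.toFun x y) := by
  refine syzInc_inj P ?_
  rw [γ.syzInc_syz, syzInc_kap, syzInc_kap, map_sub, LinearMap.sub_apply, γ.tens_tm, γ.tens_tm, γ.map_l]

/-- `(Ω^k M) ⊗_A N → Ω^k P` -/
def Pairing.syzN (γ : Pairing M N P) : ∀ k, Pairing (M.syzN k) N (P.syzN k)
  | 0 => γ
  | k + 1 => (γ.syzN k).syz

/-- The first argument of a multilinear function, fixed. -/
def tlML (V : Type u) [AddCommGroup V] [Module ℂ V] : ML A V →ₗ[ℂ] A →ₗ[ℂ] ML A V :=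
  LinearMap.mk₂ ℂ (fun f a => ⟨tl f.1 a, ML.tl_mem f.2 a⟩)
    (fun _ _ _ => rfl) (fun _ _ _ => rfl)
    (fun f a b => Subtype.ext ((ML.tl_lin f.2).map_add a b))
    (fun c f a => Subtype.ext ((ML.tl_lin f.2).map_smul c a))

/-- For bilinear `E(f, x)`, the map `(f, a ⊗ x) ↦ E(f(a, -), x)`. -/
def evT {V : Type u} [AddCommGroup V] [Module ℂ V] (X : Bim A)
    (E : ML A M.carrier →ₗ[ℂ] X.carrier →ₗ[ℂ] V) : ML A M.carrier →ₗ[ℂ] X.tens.carrier →ₗ[ℂ] V where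
  toFun f := tlift X (E ∘ₗ tlML M.carrier f)
  map_add' f g := by
    refine LinearMap.ext (tens_ext _ _ fun a x => ?_)
    rw [LinearMap.add_apply, tlift_tm, tlift_tm, tlift_tm, map_add, LinearMap.comp_add]
    rfl
  map_smul' c f := by
    refine LinearMap.ext (tens_ext _ _ fun a x => ?_)
    rw [RingHom.id_apply, LinearMap.smul_apply, tlift_tm, tlift_tm, map_smul, LinearMap.comp_smul]
    rfl

theorem evT_tm {V : Type u} [AddCommGroup V] [Module ℂ V] (X : Bim A)
    (E : ML A M.carrier →ₗ[ℂ] X.carrier →ₗ[ℂ] V) (f : ML A M.carrier) (a : A) (x : X.carrier) :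
    evT X E f (tm X a x) = E (tlML M.carrier f a) x := tlift_tm X _ a x

/-- For a pairing `γ : M ⊗_A N → P`, the map which sends `f` and `a₁ ⊗ ⋯ ⊗ a_j ⊗ y ∈ A^{⊗j} ⊗ N` to
`γ(f(a₁, …, a_j), y)`, restricted to `Ω^j N ⊆ A^{⊗j} ⊗ N`.  For a cocycle `f` of degree `j`, i.e.
`f : Ω^j A → M`, this is the homomorphism `Ω^j N → M ⊗_A N → P`. -/
def ev (γ : Pairing M N P) : ∀ j, ML A M.carrier →ₗ[ℂ] (N.syzN j).carrier →ₗ[ℂ] P.carrier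
  | 0 => γ.toFun ∘ₗ LinearMap.proj [] ∘ₗ (ML A M.carrier).subtype
  | j + 1 => (evT (N.syzN j) (ev γ j)).compl₂ (syzInc (N.syzN j))

theorem ev_zero (γ : Pairing M N P) (f : ML A M.carrier) (y : N.carrier) :
    ev γ 0 f y = γ.toFun (f.1 []) y := rfl

theorem ev_succ (γ : Pairing M N P) (j : ℕ) (f : ML A M.carrier) (z : (N.syzN j).syz.carrier) :
    ev γ (j + 1) f z = evT (N.syzN j) (ev γ j) f (syzInc (N.syzN j) z) := rfl

theorem ev_right (γ : Pairing M N P) (b : A) : ∀ (j : ℕ) (f : ML A M.carrier) (z : (N.syzN j).carrier),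
    ev γ j f ((N.syzN j).r b z) = P.r b (ev γ j f z)
  | 0, f, z => γ.map_r b _ z
  | j + 1, f, z => by
    revert z
    change ∀ z : (N.syzN j).syz.carrier, ev γ (j + 1) f ((N.syzN j).syz.r b z) = P.r b (ev γ (j + 1) f z)
    intro z
    rw [ev_succ, ev_succ, (syzInc_isHom _).map_r]
    refine tens_ext (evT (N.syzN j) (ev γ j) f ∘ₗ (N.syzN j).tens.r b)
      (P.r b ∘ₗ evT (N.syzN j) (ev γ j) f) (fun a x => ?_) (syzInc (N.syzN j) z)
    rw [LinearMap.comp_apply, LinearMap.comp_apply, tens_r, evT_tm, evT_tm, ev_right γ b j]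

/-- `inner`, as a multilinear function. -/
def innML (X : Bim A) (f : ML A X.carrier) (b : A) : ML A X.carrier := ⟨inner X f.1 b, inner_mem f.2 b⟩

theorem ev_inner (γ : Pairing M N P) (b : A) : ∀ (j : ℕ) (f : ML A M.carrier) (z : (N.syzN j).carrier),
    ev γ j (innML M f b) z = - ev γ j f ((N.syzN j).l b z)
  | 0, f, z => by
    revert z
    change ∀ z : N.carrier, γ.toFun (inner M f.1 b []) z = - γ.toFun (f.1 []) (N.l b z)
    intro z
    rw [inner_nil, map_neg, LinearMap.neg_apply, γ.balanced]
  | j + 1, f, z => by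
    revert z
    change ∀ z : (N.syzN j).syz.carrier, ev γ (j + 1) (innML M f b) z = - ev γ (j + 1) f ((N.syzN j).syz.l b z)
    intro z
    rw [ev_succ, ev_succ, (syzInc_isHom _).map_l]
    have h1 := tens_ext (evT (N.syzN j) (ev γ j) (innML M f b))
      (ev γ j (tlML M.carrier f b) ∘ₗ act (N.syzN j) -
        evT (N.syzN j) (ev γ j) f ∘ₗ (N.syzN j).tens.l b) (fun a x => by
      rw [LinearMap.sub_apply, LinearMap.comp_apply, LinearMap.comp_apply, tens_l, evT_tm, evT_tm, act_tm]
      have h2 : tlML M.carrier (innML M f b) a =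
          - tlML M.carrier f (b * a) - innML M (tlML M.carrier f b) a := by
        refine Subtype.ext (funext fun t => ?_)
        exact inner_cons f.1 b a t
      rw [h2, map_sub, map_neg, LinearMap.sub_apply, ev_inner γ a j, LinearMap.neg_apply]
      abel) (syzInc (N.syzN j) z)
    rw [h1, LinearMap.sub_apply, LinearMap.comp_apply, act_syzInc, map_zero, zero_sub]
    rfl

theorem ev_map {M₁ P₁ : Bim A} (γ : Pairing M N P) (γ₁ : Pairing M₁ N P₁) (φ : M.carrier →ₗ[ℂ] M₁.carrier)
    (ψ : P.carrier →ₗ[ℂ] P₁.carrier) (h : ∀ x y, γ₁.toFun (φ x) y = ψ (γ.toFun x y)) :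
    ∀ (j : ℕ) (f : ML A M.carrier) (z : (N.syzN j).carrier),
      ev γ₁ j ⟨fun l => φ (f.1 l), ML.comp f.2 φ⟩ z = ψ (ev γ j f z)
  | 0, f, z => h _ z
  | j + 1, f, z => by
    revert z
    change ∀ z : (N.syzN j).syz.carrier, ev γ₁ (j + 1) _ z = ψ (ev γ (j + 1) f z)
    intro z
    rw [ev_succ, ev_succ]
    refine tens_ext (evT (N.syzN j) (ev γ₁ j) _) (ψ ∘ₗ evT (N.syzN j) (ev γ j) f) (fun a x => ?_)
      (syzInc (N.syzN j) z)
    rw [LinearMap.comp_apply, evT_tm, evT_tm, ← ev_map γ γ₁ φ ψ h j]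
    rfl

theorem ev_isHom (γ : Pairing M N P) (j : ℕ) (f : ML A M.carrier) (hf : d M f.1 = 0) :
    Bim.IsHom (X := N.syzN j) (Y := P) (ev γ j f) where
  map_r b z := ev_right γ b j f z
  map_l b z := by
    have h1 : innML M f b = - ⟨fun l => M.l b (f.1 l), ML.comp f.2 (M.l b)⟩ := by
      refine Subtype.ext (funext fun t => ?_)
      have h2 := congrFun hf (b :: t)
      rw [d_cons] at h2
      exact (neg_eq_of_add_eq_zero_right h2).symm
    have h2 := ev_inner γ b j f z
    rw [h1, map_neg, LinearMap.neg_apply, ev_map γ γ (M.l b) (P.l b) (fun x y => γ.map_l b x y) j f z,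
      neg_inj] at h2
    exact h2.symm

/-- The composition of `f : Ω^j A → M` with `g : Ω^i A → Ω^j N`, formed with a pairing `M ⊗_A N → P`. -/
def pcomp (γ : Pairing M N P) (j : ℕ) : ML A M.carrier →ₗ[ℂ] (List A → (N.syzN j).carrier) →ₗ[ℂ]
    (List A → P.carrier) :=
  LinearMap.mk₂ ℂ (fun f g l => ev γ j f (g l))
    (fun f f' g => by funext l; rw [map_add]; rfl)
    (fun c f g => by funext l; rw [map_smul]; rfl)
    (fun f g g' => by funext l; exact map_add (ev γ j f) _ _)
    (fun c f g => by funext l; exact map_smul (ev γ j f) _ _)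

theorem pcomp_mem (γ : Pairing M N P) (j : ℕ) {i : ℤ} {f : ML A M.carrier} (hf : d M f.1 = 0)
    {g : List A → (N.syzN j).carrier} (hg : g ∈ Zc (N.syzN j) i) : pcomp γ j f g ∈ Zc P i :=
  Zc.map (ev_isHom γ j f hf) hg

theorem pcomp_nul_right (γ : Pairing M N P) (j : ℕ) {i : ℤ} {f : ML A M.carrier} (hf : d M f.1 = 0)
    {g : List A → (N.syzN j).carrier} (hg : g ∈ Nul (N.syzN j) i) : pcomp γ j f g ∈ Nul P i :=
  Nul.map (ev_isHom γ j f hf) hg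

theorem pcomp_nul_left (γ : Pairing M N P) (hP : P.RProj) (j : ℕ) {i i' : ℤ} {f : ML A M.carrier}
    (hf : f.1 ∈ Nul M i') {g : List A → (N.syzN j).carrier} (hg : g ∈ Zc (N.syzN j) i) :
    pcomp γ j f g ∈ Nul P i := by
  have h : Nul M i' ≤ ((Nul P i).comap ((pcomp γ j).flip g)).map (ML A M.carrier).subtype := by
    refine Submodule.span_le.mpr ?_
    rintro _ ⟨Q, hQ, u, hu, v, hv, rfl⟩
    refine ⟨⟨fun l => v (u l), ML.comp hu.1.1 v⟩, ?_, rfl⟩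
    obtain ⟨v', hv', hvv⟩ := hQ M.tens M (act M) v (act_isHom M) (act_surj M) hv
    have hu' : (fun l => v' (u l)) ∈ Zc M.tens i' := Zc.map hv' hu
    refine Submodule.subset_span ⟨P.tens, RProj.tens_projective hP,
      pcomp γ.tens j ⟨fun l => v' (u l), hu'.1.1⟩ g, pcomp_mem γ.tens j (Zc.d_eq hu') hg, act P,
      act_isHom P, ?_⟩
    funext l
    refine Eq.trans ?_ (ev_map γ.tens γ (act M) (act P) (fun x y => (γ.act_tens x y).symm) j
      ⟨fun l => v' (u l), hu'.1.1⟩ (g l))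
    have h3 : (⟨fun l => v (u l), ML.comp hu.1.1 v⟩ : ML A M.carrier) =
        ⟨fun l => act M (v' (u l)), ML.comp hu'.1.1 (act M)⟩ :=
      Subtype.ext (funext fun l => (LinearMap.congr_fun hvv (u l)).symm)
    exact congrArg (fun f => ev γ j f (g l)) h3
  obtain ⟨f', hf', e⟩ := h hf
  have : f' = f := Subtype.ext e
  exact this ▸ hf'

theorem pcomp_om (γ : Pairing M N P) (j : ℕ) (f : ML A M.carrier) (hf : om M f.1 ∈ ML A M.syz.carrier)
    (g : List A → (N.syzN j).carrier) :
    pcomp γ.syz (j + 1) ⟨om M f.1, hf⟩ (om (N.syzN j) g) = om P (pcomp γ j f g) := by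
  have key : ∀ (a : A) (z : (N.syzN j).carrier),
      ev γ.syz j (tlML M.syz.carrier ⟨om M f.1, hf⟩ a) z = kap P a (ev γ j f z) := fun a z =>
    ev_map γ γ.syz (kap M a) (kap P a) (fun x y => γ.syz_kap a x y) j f z
  funext l
  rcases l with _ | ⟨a, t⟩
  · exact map_zero (ev γ.syz (j + 1) ⟨om M f.1, hf⟩)
  · change ev γ.syz (j + 1) ⟨om M f.1, hf⟩ (kap (N.syzN j) a (g t)) = kap P a (ev γ j f (g t))
    rw [ev_succ, syzInc_kap, map_sub, evT_tm, evT_tm, key, key, kap_one, sub_zero]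

end Stable

/-! ### Tate–Hochschild cohomology -/

noncomputable section Tate

variable {A : Type u} [Ring A] [Algebra ℂ A]

/-- The map `Hom(Ω^i A, Ω^k X) → Hom(Ω^(i+1) A, Ω^(k+1) X)` given by the functor `Ω`. -/
def omS (X : Bim A) (k : ℕ) : (List A → (X.syzN k).carrier) →ₗ[ℂ] (List A → (X.syzN (k + 1)).carrier) :=
  om (X.syzN k)

/-- Families of homomorphisms `x_k : Ω^(n+k) A → Ω^k X` such that, in the stable category of bimodules,
`x_(k+1) = Ω x_k` for all large `k`. -/
def TateFam (X : Bim A) (n : ℤ) : Submodule ℂ (∀ k : ℕ, List A → (X.syzN k).carrier) where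
  carrier := {x | (∀ k : ℕ, x k ∈ Zc (X.syzN k) (n + k)) ∧ ∃ K : ℕ, ∀ k ≥ K,
    x (k + 1) - omS X k (x k) ∈ Nul (X.syzN (k + 1)) (n + (k + 1 : ℕ))}
  add_mem' := by
    rintro x y ⟨hx, K, hK⟩ ⟨hy, L, hL⟩
    refine ⟨fun k => add_mem (hx k) (hy k), max K L, fun k hk => ?_⟩
    have h := add_mem (hK k (le_trans (le_max_left _ _) hk)) (hL k (le_trans (le_max_right _ _) hk))
    rw [sub_add_sub_comm, ← map_add] at h
    exact h
  zero_mem' := ⟨fun _ => zero_mem _, 0, fun k _ => by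
    have h : omS X k ((0 : ∀ k : ℕ, List A → (X.syzN k).carrier) k) = 0 := map_zero _
    rw [h, Pi.zero_apply, sub_zero]
    exact zero_mem _⟩
  smul_mem' := by
    rintro c x ⟨hx, K, hK⟩
    refine ⟨fun k => Submodule.smul_mem _ c (hx k), K, fun k hk => ?_⟩
    have h := Submodule.smul_mem _ c (hK k hk)
    rw [smul_sub, ← map_smul] at h
    exact h

/-- The families which are stably zero for all large `k`. -/
def TateNul (X : Bim A) (n : ℤ) : Submodule ℂ (TateFam X n) where
  carrier := {x | ∃ K : ℕ, ∀ k ≥ K, x.1 k ∈ Nul (X.syzN k) (n + k)}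
  add_mem' := by
    rintro x y ⟨K, hK⟩ ⟨L, hL⟩
    exact ⟨max K L, fun k hk => add_mem (hK k (le_trans (le_max_left _ _) hk))
      (hL k (le_trans (le_max_right _ _) hk))⟩
  zero_mem' := ⟨0, fun _ _ => zero_mem _⟩
  smul_mem' := by
    rintro c x ⟨K, hK⟩
    exact ⟨K, fun k hk => Submodule.smul_mem _ c (hK k hk)⟩

/-- Tate–Hochschild cohomology `colim_k \underline{Hom}(Ω^(n+k) A, Ω^k X)` of `A` with coefficients in a
bimodule `X`, where `\underline{Hom}` denotes the bimodule homomorphisms modulo those which factor through a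
projective bimodule.  If `A` is a Frobenius algebra then `Ω` is an auto-equivalence of the stable category
of `A`-bimodules, whose shift is `Ω⁻¹`, and this is the space of morphisms `A → X[n]` in the stable
category. -/
abbrev Tate (X : Bim A) (n : ℤ) : Type u := TateFam X n ⧸ TateNul X n

/-- The class of a family. -/
def Tate.mk {X : Bim A} {n : ℤ} (x : TateFam X n) : Tate X n := (TateNul X n).mkQ x

/-- The bilinear map on quotients induced by a bilinear map. -/
def quotMap₂ {Z Z' Z'' : Type u} [AddCommGroup Z] [Module ℂ Z] [AddCommGroup Z'] [Module ℂ Z']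
    [AddCommGroup Z''] [Module ℂ Z''] (S : Submodule ℂ Z) (S' : Submodule ℂ Z') (S'' : Submodule ℂ Z'')
    (B : Z →ₗ[ℂ] Z' →ₗ[ℂ] Z'') (hl : ∀ x ∈ S, ∀ y, B x y ∈ S'') (hr : ∀ x, ∀ y ∈ S', B x y ∈ S'') :
    (Z ⧸ S) →ₗ[ℂ] (Z' ⧸ S') →ₗ[ℂ] (Z'' ⧸ S'') :=
  S.liftQ (LinearMap.flip (S'.liftQ (B.compr₂ S''.mkQ).flip fun y hy =>
    LinearMap.mem_ker.mpr (LinearMap.ext fun x => (Submodule.Quotient.mk_eq_zero _).mpr (hr x y hy))))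
    fun x hx => LinearMap.mem_ker.mpr (Submodule.linearMap_qext _ (LinearMap.ext fun y =>
      (Submodule.Quotient.mk_eq_zero _).mpr (hl x hx y)))

theorem Coch.eq_zero {X : Bim A} {i : ℤ} (hi : i < 0) {f : List A → X.carrier} (hf : f ∈ Coch X i) :
    f = 0 := funext fun l => hf.2 l (by omega)

variable {M N P : Bim A}

/-- The component `x_k` as a multilinear function. -/
def famML {n : ℤ} (x : TateFam M n) (k : ℕ) : ML A (M.syzN k).carrier := ⟨x.1 k, (x.2.1 k).1.1⟩

/-- The composition `Ω^(i+j) A → Ω^j N → Ω^k P`, where `j = p + k`, of `y_j` and of the homomorphism given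
by `x_k : Ω^j A → Ω^k M`. -/
def famComp (γ : Pairing M N P) {p q : ℤ} (x : TateFam M p) (y : TateFam N q) (k j : ℕ) :
    List A → (P.syzN k).carrier := pcomp (γ.syzN k) j (famML x k) (y.1 j)

theorem famComp_mem (γ : Pairing M N P) {p q n : ℤ} (h : p + q = n) (x : TateFam M p) (y : TateFam N q)
    (k : ℕ) : famComp γ x y k (p + k).toNat ∈ Zc (P.syzN k) (n + k) := by
  by_cases hk : 0 ≤ p + k
  · have h1 : q + ((p + k).toNat : ℤ) = n + k := by omega
    have h2 := y.2.1 (p + k).toNat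
    rw [h1] at h2
    exact pcomp_mem (γ.syzN k) _ (Zc.d_eq (x.2.1 k)) h2
  · have h1 : famML x k = 0 := Subtype.ext (Coch.eq_zero (by omega) (x.2.1 k).1)
    rw [famComp, h1, map_zero, LinearMap.zero_apply]
    exact zero_mem _

theorem famComp_succ (γ : Pairing M N P) (hP : P.RProj) {p q n : ℤ} (h : p + q = n) (x : TateFam M p)
    (y : TateFam N q) (k j : ℕ) (hj : (j : ℤ) = p + k)
    (hx : x.1 (k + 1) - omS M k (x.1 k) ∈ Nul (M.syzN (k + 1)) (p + (k + 1 : ℕ)))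
    (hy : y.1 (j + 1) - omS N j (y.1 j) ∈ Nul (N.syzN (j + 1)) (q + (j + 1 : ℕ))) :
    famComp γ x y (k + 1) (j + 1) - omS P k (famComp γ x y k j) ∈
      Nul (P.syzN (k + 1)) (n + (k + 1 : ℕ)) := by
  have e : q + ((j + 1 : ℕ) : ℤ) = n + (k + 1 : ℕ) := by push_cast; omega
  rw [e] at hy
  have ho : om (M.syzN k) (x.1 k) ∈ ML A (M.syzN k).syz.carrier := (om_mem rfl (x.2.1 k).1).1
  have hy2 : omS N j (y.1 j) ∈ Zc (N.syzN (j + 1)) (n + (k + 1 : ℕ)) :=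
    om_mem_Zc (by push_cast at e ⊢; omega) (y.2.1 j)
  have h1 : omS P k (famComp γ x y k j) =
      pcomp (γ.syzN (k + 1)) (j + 1) ⟨omS M k (x.1 k), ho⟩ (omS N j (y.1 j)) :=
    (pcomp_om (γ.syzN k) j (famML x k) ho (y.1 j)).symm
  have h2 : famComp γ x y (k + 1) (j + 1) - omS P k (famComp γ x y k j) =
      pcomp (γ.syzN (k + 1)) (j + 1) (famML x (k + 1)) (y.1 (j + 1) - omS N j (y.1 j)) +
      pcomp (γ.syzN (k + 1)) (j + 1) (famML x (k + 1) - ⟨omS M k (x.1 k), ho⟩) (omS N j (y.1 j)) := by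
    rw [h1, famComp, map_sub, map_sub, LinearMap.sub_apply]
    abel
  rw [h2]
  exact add_mem (pcomp_nul_right _ _ (Zc.d_eq (x.2.1 (k + 1))) hy)
    (pcomp_nul_left (i' := p + (k + 1 : ℕ)) _ (RProj.syzN hP (k + 1)) _ hx hy2)

theorem toNat_succ {p : ℤ} {k : ℕ} (h : 0 ≤ p + k) : (p + (k + 1 : ℕ)).toNat = (p + k).toNat + 1 := by
  omega

/-- The product of two families. -/
def famMul (γ : Pairing M N P) (hP : P.RProj) {p q n : ℤ} (h : p + q = n) (x : TateFam M p)
    (y : TateFam N q) : TateFam P n :=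
  ⟨fun k => sg (p * q) • famComp γ x y k (p + k).toNat, fun k => zsmul_mem (famComp_mem γ h x y k) _, by
    obtain ⟨K, hK⟩ := x.2.2
    obtain ⟨L, hL⟩ := y.2.2
    refine ⟨K + L + p.natAbs, fun k hk => ?_⟩
    have h0 : 0 ≤ p + k := by omega
    change sg (p * q) • famComp γ x y (k + 1) (p + (k + 1 : ℕ)).toNat -
      omS P k (sg (p * q) • famComp γ x y k (p + k).toNat) ∈ _
    rw [toNat_succ h0, sg_smul_map, ← smul_sub]
    exact zsmul_mem (famComp_succ γ hP h x y k _ (by omega) (hK k (by omega)) (hL _ (by omega))) _⟩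

/-- The product of two families, as a bilinear map. -/
def famMulL (γ : Pairing M N P) (hP : P.RProj) {p q n : ℤ} (h : p + q = n) :
    TateFam M p →ₗ[ℂ] TateFam N q →ₗ[ℂ] TateFam P n :=
  LinearMap.mk₂ ℂ (famMul γ hP h)
    (fun x x' y => Subtype.ext (funext fun k => by
      have h1 : famML (x + x') k = famML x k + famML x' k := rfl
      change sg (p * q) • famComp γ (x + x') y k _ =
        sg (p * q) • famComp γ x y k _ + sg (p * q) • famComp γ x' y k _
      rw [famComp, h1, map_add, LinearMap.add_apply, smul_add]; rfl))
    (fun c x y => Subtype.ext (funext fun k => by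
      have h1 : famML (c • x) k = c • famML x k := rfl
      change sg (p * q) • famComp γ (c • x) y k _ = c • sg (p * q) • famComp γ x y k _
      rw [famComp, h1, map_smul, LinearMap.smul_apply, smul_comm]; rfl))
    (fun x y y' => Subtype.ext (funext fun k => by
      change sg (p * q) • famComp γ x (y + y') k _ =
        sg (p * q) • famComp γ x y k _ + sg (p * q) • famComp γ x y' k _
      rw [← smul_add]
      exact congrArg _ (map_add (pcomp (γ.syzN k) _ (famML x k)) _ _)))
    (fun c x y => Subtype.ext (funext fun k => by
      change sg (p * q) • famComp γ x (c • y) k _ = c • sg (p * q) • famComp γ x y k _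
      rw [smul_comm]
      exact congrArg _ (map_smul (pcomp (γ.syzN k) _ (famML x k)) _ _)))

/-- The product `Tate^p(A, M) ⊗ Tate^q(A, N) → Tate^(p+q)(A, P)` given by a pairing `M ⊗_A N → P` (with `P`
projective as a right module) and by composition in the stable category, with the sign `(-1)^(pq)` as in the
cup product. -/
def Tate.mul (γ : Pairing M N P) (hP : P.RProj) {p q n : ℤ} (h : p + q = n) :
    Tate M p →ₗ[ℂ] Tate N q →ₗ[ℂ] Tate P n :=
  quotMap₂ _ _ _ (famMulL γ hP h)
    (by
      rintro x ⟨K, hK⟩ y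
      refine ⟨K + p.natAbs, fun k hk => zsmul_mem ?_ _⟩
      have h2 := y.2.1 (p + k).toNat
      rw [show q + ((p + k).toNat : ℤ) = n + k by omega] at h2
      exact pcomp_nul_left _ (RProj.syzN hP k) _ (hK k (by omega)) h2)
    (by
      rintro x y ⟨K, hK⟩
      refine ⟨K + p.natAbs, fun k hk => zsmul_mem ?_ _⟩
      have h2 := hK (p + k).toNat (by omega)
      rw [show q + ((p + k).toNat : ℤ) = n + k by omega] at h2
      exact pcomp_nul_right _ _ (Zc.d_eq (x.2.1 k)) h2)

/-- The family `(Ω^k f)_k` given by a cocycle `f`. -/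
def famOf (X : Bim A) (p : ℤ) : Zc X p →ₗ[ℂ] TateFam X p where
  toFun f := ⟨fun k => omN X k f.1, fun k => ⟨omN_mem f.2.1 k, LinearMap.mem_ker.mpr (by
    rw [d_omN, Zc.d_eq f.2, map_zero, smul_zero])⟩, 0, fun k _ => by
      have h : omN X (k + 1) f.1 - omS X k (omN X k f.1) = 0 := sub_self _
      rw [h]
      exact zero_mem _⟩
  map_add' f g := Subtype.ext (funext fun k => map_add (omN X k) f.1 g.1)
  map_smul' c f := Subtype.ext (funext fun k => map_smul (omN X k) c f.1)

/-- The comparison map from Hochschild cohomology to Tate–Hochschild cohomology. -/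
def comparison (X : Bim A) (hX : X.RProj) (p : ℤ) : HH X p →ₗ[ℂ] Tate X p :=
  (cobd (d X) (Coch X) p).mapQ (TateNul X p) (famOf X p) (by
    rintro ⟨f, hf⟩ ⟨g, hg, hgf⟩
    refine ⟨0, fun k _ => ?_⟩
    have h2 := d_mem_Nul (RProj.syzN hX k) (n := p + k) (by ring) (omN_mem hg k)
    rw [d_omN, hgf] at h2
    change omN X k f ∈ Nul (X.syzN k) (p + k)
    have h3 := zsmul_mem h2 ((-1 : ℤ) ^ k)
    rw [smul_smul, ← mul_pow, neg_one_mul, neg_neg, one_pow, one_smul] at h3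
    exact h3)

end Tate

end HochschildTate

open HochschildTate

/-!
Write `B = Λ[ı^{±1}]`. A homogeneous cochain of `B` is determined by its evaluation at `ı = 1`
(`eq_zero_of_eps`), and the cochains `x` of `Λ` extend `ı`-linearly to cochains `x ı^w` of `B` (`emb`). This
extension commutes with differentials, cup products and braces on the nose (`d_emb`, `cup_emb`,
`brace_emb`), so that it defines an embedding `x ↦ x ı^w` in cohomology (`embH`), compatible with products and
brackets. The map `Φ` is `(x, y) ↦ x ı^w + y δ ı^w` (`phiMap`).

The central point is `ghh_ext`: a class `z` in the cohomology of `B` is determined by the two restrictions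
`j^* z` and `j^* [z, ı]` to `Λ`. Indeed, the Hochschild cochains of `B` with values in a bimodule `X` are
quasi-isomorphic to the mapping cone of the commutator with `ı` on the cochains of `Λ` with values in `X`, and
`f ↦ (f|_Λ, f{ı}|_Λ)` is the comparison map. Only its injectivity in cohomology is needed (`exists_d_eq`). It is
proved by dimension shifting along the embedding of `X` in the coinduced bimodule `Hom(B, X)`, for which the
mapping cone is acyclic in positive degrees (`coind_cone_acyclic`): the cochains of `Λ` have a contraction, and
the equation `z(ı^{v+1}) - z(ı^v) ı = ψ(ı^v)` on central elements is solved by summation over `v ∈ ℤ`. The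
induction ends with derivations of `B`, which vanish if they vanish on `Λ` and on `ı` (`deriv_eq_zero`).

The insertion of `ı` in a cochain, which is the bracket with the class of `ı`, is a graded derivation of the
cup product and of the bracket (`ins_scupA`, `ins_gerst`), and it satisfies `[x ı^w, ı] = 0` and
`[y δ ı^w, ı] = -y ı^{w+1}`. The first equation needs that the bracket with the unit vanishes, which follows
from a homotopy inserting two units (`d_dbl`, `HH.bracket_one`). As moreover `j^*` sends `x ı^w + y δ ı^w` to
the image of `x` under the multiplication by `ı^w` on coefficients, `ghh_ext` shows that `Φ` is bijective
(`phiMap_bijective`), and it reduces each formula for brackets with `δ` to a comparison of two restrictions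
(`bracket_embH_euD`, `bracket_euD_euD`). Graded commutativity is Gerstenhaber's homotopy given by the brace
(`d_brace_eq_scupA_sub`); it implies `δ² = 0`, as `2` is invertible.

The isomorphisms `Ψ` and `Θ` are the functoriality of both cohomology theories for the isomorphism of
bimodules `Λ ≅ Λ ı^w` (`HH.map_mul`, `Tate.map_mul`, `comparison_map`).
-/

namespace HochschildTate

/-! ### Insertion of an element, braces and cup products -/

section Insertion

set_option linter.unusedSectionVars false

variable {A : Type u} [Ring A] [Algebra ℂ A]
variable {V W U : Type u} [AddCommGroup V] [Module ℂ V] [AddCommGroup W] [Module ℂ W]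
  [AddCommGroup U] [Module ℂ U]

/-- The brace `f{c}` with an element `c` of `A`, a cochain of degree `0`: the alternating sum of the
functions obtained from `f` by inserting `c` in one of the arguments. -/
def ins (c : A) (f : List A → V) : List A → V := brace (-1) f (coch0 c)

theorem tl_coch0 (c : V) (a : A) : tl (coch0 c : List A → V) a = 0 := rfl

theorem hsum_zero_right {φ : W → List A → V} (hφ : ∀ t, IsLinearMap ℂ fun x => φ x t) (l : List A) :
    hsum φ 0 l = 0 := Finset.sum_eq_zero fun _ _ => (hφ _).map_zero

theorem hsum_coch0 {φ : W → List A → V} (hφ : ∀ t, IsLinearMap ℂ fun x => φ x t) (c : W)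
    (l : List A) : hsum φ (coch0 c) l = φ c l := by
  rcases l with _ | ⟨a, t⟩
  · rw [hsum_nil]; rfl
  · rw [hsum_cons, tl_coch0, hsum_zero_right hφ, add_zero]; rfl

theorem ins_nil (c : A) (f : List A → V) : ins c f [] = f [c] := brace_nil _ _ _

theorem ins_cons (c : A) {f : List A → V} (hf : f ∈ ML A V) (a : A) (t : List A) :
    ins c f (a :: t) = f (c :: a :: t) - ins c (tl f a) t := by
  rw [ins, brace_cons, hsum_coch0 (ML.lin hf), neg_one_smul, ← sub_eq_add_neg]; rfl

theorem tl_ins (c : A) {f : List A → V} (hf : f ∈ ML A V) (a : A) :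
    tl (ins c f) a = tl (tl f c) a - ins c (tl f a) := funext fun t => ins_cons c hf a t

theorem ins_add (c : A) (f g : List A → V) : ins c (f + g) = ins c f + ins c g := brace_add_left _ _ _ _

theorem ins_smul (c : A) (x : ℂ) (f : List A → V) : ins c (x • f) = x • ins c f := brace_smul_left _ _ _ _

theorem ins_neg (c : A) (f : List A → V) : ins c (-f) = -ins c f := brace_neg_left _ _ _

theorem ins_sub (c : A) (f g : List A → V) : ins c (f - g) = ins c f - ins c g := by
  rw [sub_eq_add_neg, ins_add, ins_neg, sub_eq_add_neg]

theorem ins_zsmul (c : A) (n : ℤ) (f : List A → V) : ins c (n • f) = n • ins c f := by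
  rw [← Int.cast_smul_eq_zsmul ℂ, ins_smul, Int.cast_smul_eq_zsmul]

theorem ins_comp (c : A) (φ : V →ₗ[ℂ] W) (f : List A → V) (t : List A) :
    ins c (fun l => φ (f l)) t = φ (ins c f t) := brace_comp _ φ f _ t

theorem coch0_ML (c : V) : (coch0 c : List A → V) ∈ ML A V := by
  rintro (_ | ⟨a, l₁⟩) l₂ <;> exact (0 : A →ₗ[ℂ] V).isLinear

theorem ins_mem_ML (c : A) {f : List A → V} (hf : f ∈ ML A V) : ins c f ∈ ML A V :=
  brace_mem_ML _ hf (coch0_ML c)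

theorem ins_mem (c : A) {X : Bim A} {f : List A → X.carrier} {p n : ℤ} (h : p = n + 1)
    (hf : f ∈ Coch X p) : ins c f ∈ Coch X n :=
  brace_mem hf (coch0_mem (Bim.diag A) c) (by omega) _

/-- Insertion is a graded derivation with respect to cutting a sequence in two. -/
theorem ins_hsum (c : A) {φ : W → List A → V} (hφ : ∀ t, IsLinearMap ℂ fun x => φ x t)
    (hφ' : ∀ x, φ x ∈ ML A V) {g : List A → W} (hg : g ∈ ML A W) (l : List A) :
    ins c (hsum φ g) l = hsum φ (ins c g) l + hsum (fun x => ins c (φ x)) (tau g) l := by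
  have hφi : ∀ t, IsLinearMap ℂ fun x => ins c (φ x) t := fun t =>
    ⟨fun x y => by
      rw [show φ (x + y) = φ x + φ y from funext fun s => (hφ s).map_add x y, ins_add]; rfl,
    fun r x => by
      rw [show φ (r • x) = r • φ x from funext fun s => (hφ s).map_smul r x, ins_smul]; rfl⟩
  have hs : ∀ (g g' : List A → W) (t : List A), hsum φ (g - g') t = hsum φ g t - hsum φ g' t := by
    intro g g' t
    rw [sub_eq_add_neg, hsum_add_right fun t => (hφ t).map_add, hsum_neg_right hφ, sub_eq_add_neg]
  induction l generalizing g with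
  | nil => simp only [ins_nil, hsum_nil, hsum_cons, tau_nil, tl]; abel
  | cons a t ih =>
    have h1 : tl (hsum φ g) a = tl (φ (g [])) a + hsum φ (tl g a) := funext fun s => hsum_cons φ g a s
    have h2 := congrFun (ins_add c (tl (φ (g [])) a) (hsum φ (tl g a))) t
    rw [Pi.add_apply, ih (ML.tl_mem hg a)] at h2
    rw [ins_cons c (hsum_mem hφ hφ' hg), h1, h2, hsum_cons φ g c, hsum_cons φ (ins c g), tl_ins c hg, hs,
      hsum_cons φ (tl g c), hsum_cons _ (tau g), tl_tau, hsum_neg_right hφi, tau_nil, ins_nil,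
      ins_cons c (hφ' (g []))]
    have h3 : tl g c [] = g [c] := rfl
    rw [h3]
    abel

theorem ins_cup (c : A) (β : U →ₗ[ℂ] W →ₗ[ℂ] V) {f : List A → U} (hf : f ∈ ML A U) {g : List A → W}
    (hg : g ∈ ML A W) : ins c (cup β f g) = cup β (ins c f) g + cup β (tau f) (ins c g) := by
  funext l
  refine (ins_hsum c (φ := fun x s => β x (g s)) (fun t => (β.flip (g t)).isLinear)
    (fun x => ML.comp hg (β x)) hf l).trans ?_
  refine congrArg₂ (· + ·) rfl ?_
  refine Finset.sum_congr rfl fun i _ => ?_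
  exact ins_comp c (β (tau f (l.take i))) g (l.drop i)

theorem brace_sub_left (ε : ℤ) (f f' : List A → V) (g : List A → A) :
    brace ε (f - f') g = brace ε f g - brace ε f' g := by
  rw [sub_eq_add_neg, brace_add_left, brace_neg_left, sub_eq_add_neg]

/-- Insertion is a graded derivation of the brace: inserting `c` in `f{g}` either hits the arguments of `g`
or those of `f`. -/
theorem ins_brace (c : A) {ε : ℤ} (hε : ε * ε = 1) {f : List A → V} (hf : f ∈ ML A V) {g : List A → A}
    (hg : g ∈ ML A A) (hgε : tau g = -(ε • g)) :
    ins c (brace ε f g) = brace (-ε) f (ins c g) + ε • brace ε (ins c f) g := by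
  have hfi : ∀ {f : List A → V}, f ∈ ML A V → ∀ t, IsLinearMap ℂ fun x => ins c (tl f x) t :=
    fun {f} hf t => ⟨fun x y => by rw [(ML.tl_lin hf).map_add, ins_add]; rfl,
      fun r x => by rw [(ML.tl_lin hf).map_smul, ins_smul]; rfl⟩
  funext l
  induction l generalizing f with
  | nil =>
    -- By the hypothesis on `g`, either `ε = -1` or `g []` vanishes, so that `f(g, c)` occurs with the right sign.
    have h0 : g [] = -(ε • g []) := by
      have := congrFun hgε []
      rwa [tau_nil] at this
    have h1 : f [g [], c] = -(ε • f [g [], c]) := by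
      have h2 : f [-(ε • g []), c] = -(ε • f [g [], c]) := by
        have h3 := map_zsmul ((ML.lin hf [c]).mk' _) (-ε) (g [])
        simpa only [neg_smul, IsLinearMap.mk'_apply] using h3
      rwa [← h0] at h2
    simp only [Pi.add_apply, Pi.smul_apply, ins_nil, brace_nil, brace_cons, hsum_cons, hsum_nil,
      ins_cons c hf, smul_sub]
    have h3 : tl f c [g []] = f [c, g []] := rfl
    have h4 : tl f (g []) [c] = f [g [], c] := rfl
    have h5 : tl g c [] = g [c] := rfl
    rw [h3, h4, h5]
    nth_rewrite 1 [h1]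
    abel
  | cons a t ih =>
    have hH : hsum (fun x s => f (x :: s)) g ∈ ML A V :=
      hsum_mem (fun t => ML.lin hf t) (fun x => ML.tl_mem hf x) hg
    have h1 : tl (brace ε f g) a = tl (hsum (fun x s => f (x :: s)) g) a + ε • brace ε (tl f a) g :=
      funext fun s => brace_cons ε f g a s
    have h2 := ins_hsum c (φ := fun x s => f (x :: s)) (fun t => ML.lin hf t) (fun x => ML.tl_mem hf x) hg
      (a :: t)
    have h3 : hsum (fun x => ins c (fun s => f (x :: s))) (-(ε • g)) (a :: t) =
        -(ε • hsum (fun x => ins c (tl f x)) g (a :: t)) :=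
      (hsum_neg_right (hfi hf) _ _).trans (congrArg _ (hsum_zsmul_right (hfi hf) ε g _))
    have h4 : hsum (fun x s => ins c f (x :: s)) g (a :: t) =
        hsum (fun x s => tl f c (x :: s)) g (a :: t) - hsum (fun x => ins c (tl f x)) g (a :: t) := by
      simp only [hsum, ins_cons c hf, Finset.sum_sub_distrib]; rfl
    rw [hgε, h3, ins_cons c hH] at h2
    have h5 := ih (ML.tl_mem hf a)
    rw [Pi.add_apply, Pi.smul_apply] at h5
    rw [ins_cons c (brace_mem_ML ε hf hg), h1, ins_add, ins_zsmul, Pi.add_apply, Pi.smul_apply,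
      h5, Pi.add_apply, Pi.smul_apply, brace_cons ε f g, brace_cons (-ε) f, brace_cons ε (ins c f), h4,
      brace_cons ε (tl f c), tl_ins c hf, brace_sub_left, Pi.sub_apply]
    rw [sub_eq_iff_eq_add] at h2
    rw [h2]
    simp only [smul_add, smul_sub, smul_smul, hε, one_smul, neg_smul]
    abel

/-- The function `f`, multiplied by `ε ^ length`. -/
def twist (ε : ℤ) (f : List A → V) : List A → V := fun l => ε ^ l.length • f l

theorem hsum_cup (β : U →ₗ[ℂ] W →ₗ[ℂ] V) (f : List A → U) (g : List A → W) (h : List A → A)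
    (l : List A) : hsum (fun x s => cup β (tl f x) g s) h l =
      cup β (hsum (fun x s => f (x :: s)) h) g l := by
  induction l generalizing h with
  | nil => simp only [hsum_nil, cup_nil]; rfl
  | cons a t ih =>
    have h1 : tl (hsum (fun x s => f (x :: s)) h) a =
        tl (tl f (h [])) a + hsum (fun x s => f (x :: s)) (tl h a) := funext fun s => hsum_cons _ h a s
    rw [hsum_cons, ih, cup_cons, cup_cons, h1, cup_add_left, Pi.add_apply, hsum_nil]
    simp only [tl]
    abel

/-- The brace is a graded derivation of the cup product in its first argument. -/
theorem brace_cup (ε : ℤ) (β : U →ₗ[ℂ] W →ₗ[ℂ] V) (f : List A → U) (g : List A → W) (h : List A → A) :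
    brace ε (cup β f g) h = cup β (brace ε f h) g + cup β (twist ε f) (brace ε g h) := by
  funext l
  induction l generalizing f with
  | nil =>
    simp only [brace_nil, cup_nil, Pi.add_apply, cup_cons, twist, List.length_nil, pow_zero, one_smul]
    rw [add_comm]; rfl
  | cons a t ih =>
    have h1 : tl (cup β f g) a = (fun l => β (f []) (tl g a l)) + cup β (tl f a) g :=
      funext fun s => cup_cons β f g a s
    have h2 : hsum (fun x s => cup β f g (x :: s)) h (a :: t) =
        β (f []) (hsum (fun x s => g (x :: s)) h (a :: t)) +
          cup β (hsum (fun x s => f (x :: s)) h) g (a :: t) := by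
      rw [← hsum_cup]
      simp only [hsum, cup_cons, Finset.sum_add_distrib, map_sum]
    have h3 : tl (brace ε f h) a = tl (hsum (fun x s => f (x :: s)) h) a + ε • brace ε (tl f a) h :=
      funext fun s => brace_cons ε f h a s
    have h4 : tl (twist ε f) a = ε • twist ε (tl f a) := by
      funext s; simp [tl, twist, pow_succ', mul_smul]
    have h5 : twist ε f [] = f [] := by simp [twist]
    have h6 : brace ε f h [] = hsum (fun x s => f (x :: s)) h [] := by rw [brace_nil, hsum_nil]
    rw [brace_cons, h1, brace_add_left, Pi.add_apply, brace_comp, ih, h2, Pi.add_apply, Pi.add_apply,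
      cup_cons β (brace ε f h), cup_cons β (twist ε f), h3, h4, h5, h6, brace_cons ε g, cup_add_left,
      cup_zsmul_left, cup_zsmul_left, cup_cons β (hsum (fun x s => f (x :: s)) h)]
    simp only [Pi.add_apply, Pi.smul_apply, smul_add, map_add, map_zsmul]
    abel

end Insertion

/-! ### Insertion of the unit -/

section InsertOne

variable {A : Type u} [Ring A] [Algebra ℂ A] {X : Bim A}

/-- The insertion of a central element `c` is a homotopy between the left and the right multiplication
by `c` on coefficients. -/
theorem d_ins (c : A) (hc : ∀ a, a * c = c * a) {f : List A → X.carrier} (hf : f ∈ ML A X.carrier) :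
    d X (ins c f) = -ins c (d X f) + ((fun l => X.l c (f l)) - fun l => X.r c (f l)) := by
  have hg : tau (coch0 c : List A → A) = -((-1 : ℤ) • coch0 c) := by
    funext l; rcases l with _ | ⟨a, t⟩
    · simp [tau]
    · simp [tau, coch0]
  have h0 : dA (coch0 c : List A → A) = 0 := coch0_cocyc (Bim.diag A) c hc
  have h1 : brace (-(-1)) f (0 : List A → A) = 0 := by
    funext l; simp [brace, hsum, (hf _ _).map_zero]
  have h2 : cupR X (-(-1)) f (coch0 c) = fun l => X.r c (f l) := by
    funext l
    rw [neg_neg]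
    have h3 : ∀ (f : List A → X.carrier) l, cupR X 1 f (coch0 c) l = X.r c (f l) := by
      intro f l
      induction l generalizing f with
      | nil => rw [cupR_nil, one_smul]; rfl
      | cons a t ih =>
        rw [cupR_cons, ih, one_smul, one_smul]
        change X.r 0 (f []) + _ = _
        rw [map_zero, LinearMap.zero_apply, zero_add]; rfl
    exact h3 f l
  have h3 : hsum (fun x s => X.l x (f s)) (coch0 c) = fun l => X.l c (f l) := by
    funext l
    exact hsum_coch0 (fun t => (X.l.flip (f t)).isLinear) c l
  have h := d_brace (X := X) (ε := -1) (by norm_num) hf hg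
  rw [h0, h1, h2, h3] at h
  refine h.trans ?_
  rw [neg_one_smul, neg_one_smul, add_zero, sub_neg_eq_add, add_sub_assoc]
  rfl

theorem inner_ins_one {f : List A → X.carrier} (hf : f ∈ ML A X.carrier) (a : A) (t : List A) :
    inner X (ins 1 f) a t = -inner X f 1 (a :: t) + ins 1 (inner X f a) t - f (a :: t) := by
  have h := congrFun (d_ins 1 (fun a => by rw [mul_one, one_mul]) hf) (a :: t)
  have h1 : ins 1 (tl (d X f) a) t = X.l a (ins 1 f t) + ins 1 (inner X f a) t := by
    rw [tl_d, ins_add, Pi.add_apply, ins_comp]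
  rw [d_cons, Pi.add_apply, Pi.sub_apply, Pi.neg_apply, ins_cons 1 (d_mem_ML hf), h1, d_cons] at h
  simp only [X.one_l, X.one_r, sub_self, add_zero] at h
  rw [← sub_eq_zero] at h ⊢
  rw [← h]
  abel

/-- The double brace `f{1, 1}`: the signed sum of the functions obtained from `f` by inserting the unit in
two of the arguments. -/
def dbl {V : Type u} [AddCommGroup V] : List A → (List A → V) → V
  | [], f => ins 1 (tl f 1) []
  | a :: t, f => ins 1 (tl f 1) (a :: t) + dbl t (tl f a)

theorem dbl_add {V : Type u} [AddCommGroup V] [Module ℂ V] (l : List A) (f g : List A → V) :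
    dbl l (f + g) = dbl l f + dbl l g := by
  have h : ∀ l, ins 1 (tl (f + g) 1) l = ins 1 (tl f 1) l + ins 1 (tl g 1) l := fun l =>
    congrFun (ins_add 1 (tl f 1) (tl g 1)) l
  induction l generalizing f g with
  | nil => exact h []
  | cons a t ih =>
    have h1 : dbl t (tl (f + g) a) = dbl t (tl f a) + dbl t (tl g a) := ih _ _
      fun l => congrFun (ins_add 1 (tl (tl f a) 1) (tl (tl g a) 1)) l
    rw [dbl, dbl, dbl, h, h1]; abel

theorem dbl_map {V W : Type u} [AddCommGroup V] [Module ℂ V] [AddCommGroup W] [Module ℂ W]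
    (φ : V →ₗ[ℂ] W) (l : List A) (f : List A → V) : dbl l (fun s => φ (f s)) = φ (dbl l f) := by
  induction l generalizing f with
  | nil => exact ins_comp 1 φ (tl f 1) []
  | cons a t ih =>
    rw [dbl, dbl, map_add, ← ih (tl f a), ← ins_comp 1 φ (tl f 1)]; rfl

theorem dbl_smul {V : Type u} [AddCommGroup V] [Module ℂ V] (c : ℂ) (l : List A) (f : List A → V) :
    dbl l (c • f) = c • dbl l f := dbl_map (c • LinearMap.id) l f

theorem dbl_neg {V : Type u} [AddCommGroup V] [Module ℂ V] (l : List A) (f : List A → V) :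
    dbl l (-f) = -dbl l f := dbl_map (-LinearMap.id) l f

theorem dbl_mem_ML {V : Type u} [AddCommGroup V] [Module ℂ V] {f : List A → V} (hf : f ∈ ML A V) :
    (fun l => dbl l f) ∈ ML A V := by
  have hK : ∀ {f : List A → V}, f ∈ ML A V → ins 1 (tl f 1) ∈ ML A V :=
    fun hf => ins_mem_ML 1 (ML.tl_mem hf 1)
  intro l₁ l₂
  induction l₁ generalizing f with
  | nil =>
    have h : IsLinearMap ℂ fun a => dbl l₂ (tl f a) :=
      ⟨fun a b => by rw [(ML.tl_lin hf).map_add, dbl_add], fun c a => by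
        rw [(ML.tl_lin hf).map_smul, dbl_smul]⟩
    exact ((ML.lin (hK hf) l₂).mk' _ + h.mk' _).isLinear
  | cons c l₁ ih => exact ((hK hf (c :: l₁) l₂).mk' _ + (ih (ML.tl_mem hf c)).mk' _).isLinear

theorem dbl_eq_zero {V : Type u} [AddCommGroup V] [Module ℂ V] {f : List A → V} (hf : f ∈ ML A V) {p : ℤ}
    (h : ∀ l, (l.length : ℤ) ≠ p → f l = 0) (l : List A) (hl : (l.length : ℤ) ≠ p - 2) : dbl l f = 0 := by
  have hi : ∀ {f : List A → V}, f ∈ ML A V → ∀ {p : ℤ}, (∀ l, (l.length : ℤ) ≠ p → f l = 0) →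
      ∀ l : List A, (l.length : ℤ) ≠ p - 1 → ins 1 f l = 0 := by
    intro f hf p h l
    induction l generalizing f p with
    | nil => intro hl; rw [ins_nil]; exact h _ (by simp at hl ⊢; omega)
    | cons a t ih =>
      intro hl
      simp only [List.length_cons] at hl
      rw [ins_cons 1 hf, h _ (by simp only [List.length_cons]; omega), ih (ML.tl_mem hf a) (p := p - 1)
        (fun l hl => h (a :: l) (by simp only [List.length_cons]; omega)) (by omega), sub_zero]
  have hK : ∀ {f : List A → V}, f ∈ ML A V → ∀ {p : ℤ}, (∀ l, (l.length : ℤ) ≠ p → f l = 0) →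
      ∀ l : List A, (l.length : ℤ) ≠ p - 2 → ins 1 (tl f 1) l = 0 := fun hf p h l hl =>
    hi (ML.tl_mem hf 1) (p := p - 1) (fun l hl => h (1 :: l) (by simp only [List.length_cons]; omega)) l
      (by omega)
  induction l generalizing f p with
  | nil => exact hK hf h [] hl
  | cons a t ih =>
    rw [dbl, hK hf h _ hl, ih (ML.tl_mem hf a) (p := p - 1)
      (fun l hl => h (a :: l) (by simp only [List.length_cons]; omega))
      (by simp only [List.length_cons] at hl; omega), add_zero]

theorem inner_dbl {f : List A → X.carrier} (hf : f ∈ ML A X.carrier) (a : A) (t : List A) :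
    inner X (fun l => dbl l f) a t = ins 1 (inner X f 1) (a :: t) + dbl t (inner X f a) := by
  induction t generalizing f a with
  | nil =>
    simp only [inner_nil, dbl, ins_nil, ins_cons 1 (inner_mem hf 1), tl, inner_cons, mul_one, one_mul,
      X.one_r]
    abel
  | cons b t ih =>
    have hK := ML.tl_mem hf 1
    have h1 : tl (fun l => dbl l f) a = tl (ins 1 (tl f 1)) a + fun l => dbl l (tl f a) := rfl
    have h2 := inner_ins_one hK a (b :: t)
    rw [inner_cons] at h2
    have h3 : tl (inner X f 1) a = -tl f a - inner X (tl f 1) a := by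
      funext s; simp only [tl, inner_cons, one_mul]; rfl
    have h4 : tl (inner X f a) 1 = -tl f a - inner X (tl f a) 1 := by
      funext s; simp only [tl, inner_cons, mul_one]; rfl
    have h5 : tl (inner X f a) b = -tl f (a * b) + -inner X (tl f a) b := by
      funext s; simp [tl, inner_cons]; abel
    rw [inner_cons, h1, inner_add, ih (ML.tl_mem hf a), dbl, dbl, h4, h5, dbl_add, dbl_neg, dbl_neg,
      ins_cons 1 (inner_mem hf 1), h3, ins_sub, ins_sub, ins_neg, inner_cons f 1 1, mul_one]
    simp only [Pi.sub_apply, Pi.neg_apply]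
    rw [← sub_eq_zero] at h2 ⊢
    rw [← h2]
    have h6 : tl f 1 (a :: b :: t) = f (1 :: a :: b :: t) := rfl
    rw [h6]
    abel

/-- The double insertion of the unit is a homotopy between the insertion of the unit and zero. -/
theorem d_dbl {f : List A → X.carrier} (hf : f ∈ ML A X.carrier) :
    d X (fun l => dbl l f) = (fun l => dbl l (d X f)) - ins 1 f := by
  funext l
  rcases l with _ | ⟨a, t⟩
  · have h : inner X f 1 [1] = 0 := by
      rw [inner_cons, inner_nil, mul_one, X.one_r, sub_neg_eq_add]
      exact neg_add_cancel _
    have h1 : dbl [] (d X f) = d X f [1, 1] := ins_nil 1 _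
    rw [d_nil, Pi.sub_apply, h1, ins_nil, d_cons, X.one_l, h, add_zero, sub_self]
  · have h1 : tl (d X f) 1 = f + inner X f 1 := by
      rw [tl_d]; simp only [X.one_l]
    rw [d_cons, inner_dbl hf, Pi.sub_apply, dbl, h1, tl_d, dbl_add, dbl_map, ins_add, Pi.add_apply]
    abel

end InsertOne

/-! ### Dimension shifting -/

section Coinduced

variable {A : Type u} [Ring A] [Algebra ℂ A] (X : Bim A)

/-- The coinduced bimodule `Hom(A, X)`, with the actions `(b φ)(a) = φ(a b)` and `(φ b)(a) = φ(a) b`. -/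
def Bim.coind : Bim A where
  carrier := A →ₗ[ℂ] X.carrier
  l := LinearMap.mk₂ ℂ (fun b φ => φ ∘ₗ LinearMap.mulRight ℂ b)
    (fun b c φ => LinearMap.ext fun a => by simp [mul_add])
    (fun r b φ => LinearMap.ext fun a => by simp)
    (fun b φ ψ => rfl) (fun r b φ => rfl)
  r := LinearMap.mk₂ ℂ (fun b φ => X.r b ∘ₗ φ)
    (fun b c φ => LinearMap.ext fun a => by simp)
    (fun r b φ => LinearMap.ext fun a => by simp)
    (fun b φ ψ => LinearMap.ext fun a => by simp) (fun r b φ => LinearMap.ext fun a => by simp)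
  one_l φ := LinearMap.ext fun a => by simp
  mul_l b c φ := LinearMap.ext fun a => by simp [mul_assoc]
  one_r φ := LinearMap.ext fun a => X.one_r _
  mul_r b c φ := LinearMap.ext fun a => X.mul_r _ _ _
  l_r b c φ := rfl

/-- The evaluation of an element of the coinduced bimodule. -/
def evC (b : A) : X.coind.carrier →ₗ[ℂ] X.carrier := LinearMap.applyₗ b

variable {X}

theorem coind_ext {φ ψ : X.coind.carrier} (h : ∀ b, evC X b φ = evC X b ψ) : φ = ψ := LinearMap.ext h

theorem evC_l (a b : A) (φ : X.coind.carrier) : evC X b (X.coind.l a φ) = evC X (b * a) φ := rfl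

theorem evC_r (b a : A) (φ : X.coind.carrier) : evC X b (X.coind.r a φ) = X.r a (evC X b φ) := rfl

variable (X)

/-- The embedding of `X` in the coinduced bimodule, `x ↦ (a ↦ a x)`. -/
def coindInc : X.carrier →ₗ[ℂ] X.coind.carrier := X.l.flip

variable {X}

theorem evC_coindInc (b : A) (x : X.carrier) : evC X b (coindInc X x) = X.l b x := rfl

theorem coindInc_isHom : Bim.IsHom (X := X) (Y := X.coind) (coindInc X) where
  map_l a x := coind_ext fun b => (X.mul_l b a x).symm
  map_r a x := coind_ext fun b => X.l_r b a x

theorem coindInc_injective : Function.Injective (coindInc X) := fun x y h => by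
  have h1 := congrArg (evC X 1) h
  rwa [evC_coindInc, evC_coindInc, X.one_l, X.one_l] at h1

variable (X)

/-- The cosyzygy of `X`, i.e. the cokernel of its embedding in the coinduced bimodule, realized as the space
of linear maps `φ : A → X` with `φ(1) = 0`, on which `(b φ)(a) = φ(a b) - a φ(b)`. -/
def Bim.cosyz : Bim A where
  carrier := LinearMap.ker (evC X 1)
  l := LinearMap.mk₂ ℂ (fun b φ => ⟨X.coind.l b φ.1 - coindInc X (evC X b φ.1), by
      rw [LinearMap.mem_ker, map_sub, evC_l, evC_coindInc, X.one_l, one_mul, sub_self]⟩)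
    (fun b c φ => Subtype.ext (by
      have h : evC X (b + c) φ.1 = evC X b φ.1 + evC X c φ.1 :=
        LinearMap.map_add (σ := RingHom.id ℂ) (M := A) (M₃ := X.carrier) φ.1 b c
      simp only [Submodule.coe_add, map_add, LinearMap.add_apply, h]
      abel))
    (fun r b φ => Subtype.ext (by
      have h : evC X (r • b) φ.1 = r • evC X b φ.1 :=
        LinearMap.map_smul (R := ℂ) (M := A) (M₂ := X.carrier) φ.1 r b
      simp only [Submodule.coe_smul, map_smul, LinearMap.smul_apply, h, smul_sub]))
    (fun b φ ψ => Subtype.ext (by simp only [Submodule.coe_add, map_add]; abel))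
    (fun r b φ => Subtype.ext (by simp only [Submodule.coe_smul, map_smul, smul_sub]))
  r := LinearMap.mk₂ ℂ (fun b φ => ⟨X.coind.r b φ.1, by
      rw [LinearMap.mem_ker, evC_r, LinearMap.mem_ker.mp φ.2, map_zero]⟩)
    (fun b c φ => Subtype.ext (by simp))
    (fun r b φ => Subtype.ext (by simp))
    (fun b φ ψ => Subtype.ext (by simp))
    (fun r b φ => Subtype.ext (by simp))
  one_l φ := Subtype.ext (by
    change X.coind.l 1 φ.1 - coindInc X (evC X 1 φ.1) = φ.1
    rw [X.coind.one_l, LinearMap.mem_ker.mp φ.2, map_zero, sub_zero])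
  mul_l b c φ := Subtype.ext (coind_ext fun a => by
    change evC X a (X.coind.l (b * c) φ.1 - coindInc X (evC X (b * c) φ.1)) =
      evC X a (X.coind.l b (X.coind.l c φ.1 - coindInc X (evC X c φ.1)) -
        coindInc X (evC X b (X.coind.l c φ.1 - coindInc X (evC X c φ.1))))
    simp only [map_sub, evC_l, evC_coindInc, mul_assoc, X.mul_l]
    abel)
  one_r φ := Subtype.ext (X.coind.one_r φ.1)
  mul_r b c φ := Subtype.ext (X.coind.mul_r b c φ.1)
  l_r b c φ := Subtype.ext (coind_ext fun a => by
    change evC X a (X.coind.l b (X.coind.r c φ.1) - coindInc X (evC X b (X.coind.r c φ.1))) =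
      evC X a (X.coind.r c (X.coind.l b φ.1 - coindInc X (evC X b φ.1)))
    simp only [map_sub, evC_l, evC_r, evC_coindInc, X.l_r])

/-- The projection of the coinduced bimodule onto the cosyzygy. -/
def cosyzPr : X.coind.carrier →ₗ[ℂ] X.cosyz.carrier :=
  LinearMap.codRestrict (LinearMap.ker (evC X 1)) (LinearMap.id - coindInc X ∘ₗ evC X 1) fun φ => by
    rw [LinearMap.mem_ker, LinearMap.sub_apply, map_sub, LinearMap.comp_apply, evC_coindInc, X.one_l]
    exact sub_self _

/-- The inclusion of the cosyzygy in the coinduced bimodule, a linear section of the projection. -/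
def cosyzInc : X.cosyz.carrier →ₗ[ℂ] X.coind.carrier := (LinearMap.ker (evC X 1)).subtype

variable {X}

theorem cosyzInc_cosyzPr (φ : X.coind.carrier) :
    cosyzInc X (cosyzPr X φ) = φ - coindInc X (evC X 1 φ) := rfl

theorem cosyzInc_injective : Function.Injective (cosyzInc X) := Subtype.val_injective

theorem cosyzPr_cosyzInc (φ : X.cosyz.carrier) : cosyzPr X (cosyzInc X φ) = φ := by
  apply cosyzInc_injective
  have h : evC X 1 (cosyzInc X φ) = 0 := LinearMap.mem_ker.mp φ.2
  rw [cosyzInc_cosyzPr, h, map_zero, sub_zero]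

theorem cosyzPr_coindInc (x : X.carrier) : cosyzPr X (coindInc X x) = 0 := by
  apply cosyzInc_injective
  rw [cosyzInc_cosyzPr, evC_coindInc, X.one_l, sub_self, map_zero]

theorem cosyzPr_isHom : Bim.IsHom (X := X.coind) (Y := X.cosyz) (cosyzPr X) where
  map_l a φ := cosyzInc_injective <| by
    change X.coind.l a φ - coindInc X (evC X 1 (X.coind.l a φ)) =
      X.coind.l a (φ - coindInc X (evC X 1 φ)) - coindInc X (evC X a (φ - coindInc X (evC X 1 φ)))
    rw [map_sub, map_sub, map_sub, ← coindInc_isHom.map_l, evC_coindInc, evC_l, one_mul]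
    abel
  map_r a φ := cosyzInc_injective <| by
    change X.coind.r a φ - coindInc X (evC X 1 (X.coind.r a φ)) =
      X.coind.r a (φ - coindInc X (evC X 1 φ))
    rw [map_sub, evC_r, coindInc_isHom.map_r]

/-- A multilinear function `f`, as a function with values in the coinduced bimodule: the first argument of `f`
becomes the argument of the values. -/
def curryC (f : ML A X.carrier) (t : List A) : X.coind.carrier := (ML.lin f.2 t).mk' _

theorem evC_curryC (f : ML A X.carrier) (t : List A) (a : A) : evC X a (curryC f t) = f.1 (a :: t) := rfl

theorem curryC_mem {p n : ℤ} (h : p = n + 1) (f : ML A X.carrier) (hf : f.1 ∈ Coch X p) :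
    curryC f ∈ Coch X.coind n := by
  refine ⟨fun l₁ l₂ => ⟨fun a b => coind_ext fun c => ?_, fun r a => coind_ext fun c => ?_⟩,
    fun l hl => coind_ext fun c => ?_⟩
  · rw [map_add]; exact (f.2 (c :: l₁) l₂).map_add a b
  · rw [map_smul]; exact (f.2 (c :: l₁) l₂).map_smul r a
  · rw [map_zero]; exact hf.2 _ (by simp only [List.length_cons]; omega)

theorem evC_inner (b : A) (g : List A → X.coind.carrier) (a : A) (t : List A) :
    evC X b (inner X.coind g a t) = inner X (fun l => evC X b (g l)) a t :=
  (inner_map (X := X.coind) (Y := X) (evC X b) (fun a φ => evC_r b a φ) g a t).symm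

/-- For a cocycle of positive degree, the associated function with values in the coinduced bimodule is a
cocycle modulo `X`. -/
theorem d_curryC (f : ML A X.carrier) (hf : d X f.1 = 0) (h0 : f.1 [] = 0) :
    d X.coind (curryC f) = post (coindInc X) f.1 := by
  funext l
  rcases l with _ | ⟨a, t⟩
  · change 0 = coindInc X (f.1 [])
    rw [h0, map_zero]
  · refine coind_ext fun c => ?_
    have h1 := congrFun hf (c :: a :: t)
    rw [d_cons, inner_cons] at h1
    rw [d_cons, map_add, evC_l, evC_inner, evC_curryC]
    change _ = X.l c (f.1 (a :: t))
    change f.1 ((c * a) :: t) + inner X (tl f.1 c) a t = _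
    change X.l c (f.1 (a :: t)) + (_ - inner X (tl f.1 c) a t) = 0 at h1
    rw [← sub_eq_zero, ← neg_eq_zero, ← h1]
    abel

theorem d_post {X Y : Bim A} {φ : X.carrier →ₗ[ℂ] Y.carrier} (hφ : Bim.IsHom φ) (f : List A → X.carrier) :
    d Y (post φ f) = post φ (d X f) := d_map hφ f

end Coinduced

/-! ### Restriction to `Λ` and insertion of `ı` -/

noncomputable section Restriction

set_option linter.unusedSectionVars false

open LaurentPolynomial

variable {Λ : Type u} [Ring Λ] [Algebra ℂ Λ]

/-- The linear map on `Λ[ı^{±1}]` with prescribed restrictions to the homogeneous parts. -/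
def lsumB {V : Type u} [AddCommGroup V] [Module ℂ V] (φ : ℤ → Λ →ₗ[ℂ] V) : Λ[T;T⁻¹] →ₗ[ℂ] V :=
  Finsupp.lsum ℂ φ ∘ₗ (AddMonoidAlgebra.coeffLinearEquiv ℂ).toLinearMap

theorem lsumB_single {V : Type u} [AddCommGroup V] [Module ℂ V] (φ : ℤ → Λ →ₗ[ℂ] V) (v : ℤ) (a : Λ) :
    lsumB φ (AddMonoidAlgebra.single v a) = φ v a := by
  change Finsupp.lsum ℂ φ (Finsupp.single v a) = _
  rw [Finsupp.lsum_single]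

theorem lhomB_ext {V : Type u} [AddCommGroup V] [Module ℂ V] {f g : Λ[T;T⁻¹] →ₗ[ℂ] V}
    (h : ∀ v a, f (AddMonoidAlgebra.single v a) = g (AddMonoidAlgebra.single v a)) : f = g := by
  refine LinearMap.ext fun x => ?_
  induction x using LaurentPolynomial.induction_on' with
  | add p q hp hq => rw [map_add, map_add, hp, hq]
  | C_mul_T n a => rw [← single_eq_C_mul_T]; exact h n a

/-- The restriction of a bimodule over `Λ[ı^{±1}]` to `Λ`. -/
def Bim.res (X : Bim Λ[T;T⁻¹]) : Bim Λ where
  carrier := X.carrier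
  l := X.l ∘ₗ AddMonoidAlgebra.lsingle (R := ℂ) (0 : ℤ)
  r := X.r ∘ₗ AddMonoidAlgebra.lsingle (R := ℂ) (0 : ℤ)
  one_l := X.one_l
  mul_l a b x := by
    have h : (AddMonoidAlgebra.lsingle (R := ℂ) (0 : ℤ) (a * b) : Λ[T;T⁻¹]) = C a * C b := map_mul C a b
    rw [LinearMap.comp_apply, h, X.mul_l]; rfl
  one_r := X.one_r
  mul_r a b x := by
    have h : (AddMonoidAlgebra.lsingle (R := ℂ) (0 : ℤ) (a * b) : Λ[T;T⁻¹]) = C a * C b := map_mul C a b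
    rw [LinearMap.comp_apply, h, X.mul_r]; rfl
  l_r a b x := X.l_r (C a) (C b) x

/-- The restriction of functions on sequences to `Λ`. -/
def resC (X : Bim Λ[T;T⁻¹]) : (List Λ[T;T⁻¹] → X.carrier) →ₗ[ℂ] (List Λ → X.res.carrier) where
  toFun f l := f (l.map C)
  map_add' _ _ := rfl
  map_smul' _ _ := rfl

variable {X Y : Bim Λ[T;T⁻¹]}

theorem inner_resC (f : List Λ[T;T⁻¹] → X.carrier) (a : Λ) (t : List Λ) :
    inner X.res (resC X f) a t = inner X f (C a) (t.map C) := by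
  induction t generalizing f a with
  | nil => rw [inner_nil, List.map_nil, inner_nil]; rfl
  | cons b t ih =>
    rw [inner_cons, List.map_cons, inner_cons, ← ih, ← map_mul]
    rfl

theorem d_resC (f : List Λ[T;T⁻¹] → X.carrier) : d X.res (resC X f) = resC X (d X f) := by
  funext l
  rcases l with _ | ⟨a, t⟩
  · rfl
  · rw [d_cons, inner_resC]; rfl

theorem resC_mem {f : List Λ[T;T⁻¹] → X.carrier} {p : ℤ} (hf : f ∈ Coch X p) :
    resC X f ∈ Coch X.res p := by
  refine ⟨fun l₁ l₂ => ?_, fun l hl => hf.2 _ (by rwa [List.length_map])⟩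
  have h : (fun a => resC X f (l₁ ++ a :: l₂)) = fun a =>
      f (l₁.map C ++ (C a : Λ[T;T⁻¹]) :: l₂.map C) := by
    funext a
    change f ((l₁ ++ a :: l₂).map C) = _
    rw [List.map_append, List.map_cons]
  rw [h]
  exact ((hf.1 (l₁.map C) (l₂.map C)).mk' _ ∘ₗ AddMonoidAlgebra.lsingle (R := ℂ) (0 : ℤ)).isLinear

theorem Bim.IsHom.res {φ : X.carrier →ₗ[ℂ] Y.carrier} (h : Bim.IsHom φ) :
    Bim.IsHom (X := X.res) (Y := Y.res) φ :=
  ⟨fun a x => h.map_l (C a) x, fun a x => h.map_r (C a) x⟩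

/-- The commutator with `ı`, as an endomorphism of the restriction of `X` to `Λ`. -/
def iotaComm (X : Bim Λ[T;T⁻¹]) : X.res.carrier →ₗ[ℂ] X.res.carrier :=
  X.l (T 1) - X.r (T 1)

theorem iotaComm_apply (x : X.carrier) : iotaComm X x = X.l (T 1) x - X.r (T 1) x := rfl

theorem iotaComm_isHom (X : Bim Λ[T;T⁻¹]) : Bim.IsHom (X := X.res) (Y := X.res) (iotaComm X) where
  map_l a (x : X.carrier) := by
    change X.l (T 1) (X.l (C a) x) - X.r (T 1) (X.l (C a) x) = X.l (C a) (X.l (T 1) x - X.r (T 1) x)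
    rw [← X.mul_l, (commute_T 1 (C a)).eq, X.mul_l, ← X.l_r, map_sub]
  map_r a (x : X.carrier) := by
    change X.l (T 1) (X.r (C a) x) - X.r (T 1) (X.r (C a) x) = X.r (C a) (X.l (T 1) x - X.r (T 1) x)
    rw [← X.mul_r, ← (commute_T 1 (C a)).eq, X.mul_r, X.l_r, map_sub]

theorem iotaComm_map {φ : X.carrier →ₗ[ℂ] Y.carrier} (h : Bim.IsHom φ) (x : X.carrier) :
    iotaComm Y (φ x) = φ (iotaComm X x) := by
  rw [iotaComm_apply, iotaComm_apply, map_sub, h.map_l, h.map_r]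

theorem d_ins_T {f : List Λ[T;T⁻¹] → X.carrier} (hf : f ∈ ML Λ[T;T⁻¹] X.carrier) :
    d X.res (resC X (ins (T 1) f)) =
      -resC X (ins (T 1) (d X f)) + post (iotaComm X) (resC X f) := by
  rw [d_resC, d_ins (T 1) (fun a => (commute_T 1 a).symm.eq) hf]
  rfl

/-! ### Acyclicity of coinduced bimodules -/

/-- The evaluation of an element of the coinduced bimodule, as a map of right `Λ`-modules. -/
def evR (X : Bim Λ[T;T⁻¹]) (b : Λ[T;T⁻¹]) : X.coind.res.carrier →ₗ[ℂ] X.res.carrier := evC X b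

theorem evR_l (a : Λ) (b : Λ[T;T⁻¹]) (φ : X.coind.res.carrier) :
    evR X b (X.coind.res.l a φ) = evR X (b * C a) φ := rfl

theorem evR_r (a : Λ) (b : Λ[T;T⁻¹]) (φ : X.coind.res.carrier) :
    evR X b (X.coind.res.r a φ) = X.res.r a (evR X b φ) := rfl

theorem evR_ext {φ ψ : X.coind.res.carrier}
    (h : ∀ v c, evR X (AddMonoidAlgebra.single v c) φ = evR X (AddMonoidAlgebra.single v c) ψ) : φ = ψ :=
  lhomB_ext (V := X.carrier) h

theorem evR_inner (b : Λ[T;T⁻¹]) (g : List Λ → X.coind.res.carrier) (a : Λ) (t : List Λ) :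
    evR X b (inner X.coind.res g a t) = inner X.res (fun l => evR X b (g l)) a t :=
  (inner_map (evR X b) (fun a φ => evR_r a b φ) g a t).symm

/-- The right action of `ı^n`. -/
def rT (X : Bim Λ[T;T⁻¹]) (n : ℤ) : X.res.carrier →ₗ[ℂ] X.res.carrier := X.r (T n)

theorem rT_rT (i j : ℤ) (x : X.res.carrier) : rT X j (rT X i x) = rT X (i + j) x := by
  have h := X.mul_r (T i) (T j) x
  rw [← T_add] at h
  exact h.symm

theorem rT_r (i : ℤ) (c : Λ) (x : X.res.carrier) : rT X i (X.res.r c x) = X.res.r c (rT X i x) := by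
  have h1 := X.mul_r (T i) (C c) x
  have h2 := X.mul_r (C c) (T i) x
  rw [← (commute_T i (C c)).eq] at h2
  exact h2.symm.trans h1

theorem rT_zero (x : X.res.carrier) : rT X 0 x = x := X.one_r x

theorem evR_iotaComm (b : Λ[T;T⁻¹]) (φ : X.coind.res.carrier) :
    evR X b (iotaComm X.coind φ) = evR X (b * T 1) φ - rT X 1 (evR X b φ) := rfl

/-- The contraction `(s g)(t)(c ı^v) = g(c, t)(ı^v)` of the cochains of `Λ` with values in a coinduced
bimodule over `Λ[ı^{±1}]`. -/
def contr (g : ML Λ X.coind.res.carrier) (t : List Λ) : X.coind.res.carrier :=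
  lsumB fun v => evR X (T v) ∘ₗ (ML.lin g.2 t).mk' _

theorem evR_contr (g : ML Λ X.coind.res.carrier) (t : List Λ) (v : ℤ) (c : Λ) :
    evR X (AddMonoidAlgebra.single v c) (contr g t) = evR X (T v) (g.1 (c :: t)) :=
  lsumB_single (V := X.carrier) (fun v => evR X (T v) ∘ₗ (ML.lin g.2 t).mk' _) v c

theorem contr_mem {p n : ℤ} (h : p = n + 1) (g : ML Λ X.coind.res.carrier) (hg : g.1 ∈ Coch X.coind.res p) :
    contr g ∈ Coch X.coind.res n := by
  refine ⟨fun l₁ l₂ => ⟨fun a b => evR_ext fun v c => ?_, fun r a => evR_ext fun v c => ?_⟩,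
    fun l hl => evR_ext fun v c => ?_⟩
  · rw [map_add, evR_contr, evR_contr, evR_contr, ← map_add]
    exact congrArg _ ((g.2 (c :: l₁) l₂).map_add a b)
  · rw [map_smul, evR_contr, evR_contr, ← map_smul]
    exact congrArg _ ((g.2 (c :: l₁) l₂).map_smul r a)
  · rw [map_zero, evR_contr, hg.2 _ (by simp only [List.length_cons]; omega), map_zero]

theorem single_mul_C (v : ℤ) (c a : Λ) :
    (AddMonoidAlgebra.single v c * C a : Λ[T;T⁻¹]) = AddMonoidAlgebra.single v (c * a) := by
  rw [← single_eq_C, AddMonoidAlgebra.single_mul_single, add_zero]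

theorem single_eq_T_mul_C (v : ℤ) (c : Λ) : (AddMonoidAlgebra.single v c : Λ[T;T⁻¹]) = T v * C c := by
  rw [single_eq_C_mul_T, (commute_T v (C c)).eq]

/-- On cocycles of positive degree, the contraction is a section of the differential. -/
theorem d_contr (g : ML Λ X.coind.res.carrier) (hg : d X.coind.res g.1 = 0) (h0 : g.1 [] = 0) :
    d X.coind.res (contr g) = g.1 := by
  funext l
  rcases l with _ | ⟨a, t⟩
  · exact h0.symm
  · refine evR_ext fun v c => ?_
    have h1 := congrArg (evR X (T v)) (congrFun hg (c :: a :: t))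
    have h4 : (fun l => evR X (AddMonoidAlgebra.single v c) (contr g l)) =
        fun l => evR X (T v) (tl g.1 c l) := funext fun l => evR_contr g l v c
    rw [d_cons, inner_cons, map_add, map_sub, map_neg, evR_inner, evR_l, ← single_eq_T_mul_C, Pi.zero_apply,
      map_zero] at h1
    rw [d_cons, map_add, evR_inner, h4, evR_l, single_mul_C, evR_contr, ← sub_eq_zero, ← neg_eq_zero, ← h1]
    abel

/-- Every function on `ℤ` is the difference of a function and its translate. -/
theorem exists_int_primitive {V : Type u} [AddCommGroup V] (u : ℤ → V) :
    ∃ n : ℤ → V, ∀ v, n (v + 1) = n v + u v := by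
  refine ⟨fun v => (∑ i ∈ Finset.range v.toNat, u i) -
    ∑ i ∈ Finset.range (-v).toNat, u (-(i + 1)), fun v => ?_⟩
  rcases lt_or_ge v 0 with hv | hv
  · obtain ⟨k, rfl⟩ : ∃ k : ℕ, v = -(k + 1 : ℤ) := ⟨(-v - 1).toNat, by omega⟩
    have e1 : (-(k + 1 : ℤ) + 1).toNat = 0 := by omega
    have e2 : (-(k + 1 : ℤ)).toNat = 0 := by omega
    have e3 : (-(-(k + 1 : ℤ) + 1)).toNat = k := by omega
    have e4 : (-(-(k + 1 : ℤ))).toNat = k + 1 := by omega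
    simp only [e1, e2, e3, e4, Finset.sum_range_succ]
    abel
  · obtain ⟨k, rfl⟩ : ∃ k : ℕ, v = k := ⟨v.toNat, by omega⟩
    have e1 : ((k : ℤ) + 1).toNat = k + 1 := by omega
    have e2 : ((k : ℤ)).toNat = k := by omega
    have e3 : (-((k : ℤ) + 1)).toNat = 0 := by omega
    have e4 : (-(k : ℤ)).toNat = 0 := by omega
    simp only [e1, e2, e3, e4, Finset.sum_range_succ]
    abel

/-- The commutator with `ı` is surjective on the `Λ`-central elements of a coinduced bimodule. -/
theorem exists_iotaComm_eq (ψ : X.coind.res.carrier)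
    (hψ : ∀ a, X.coind.res.l a ψ = X.coind.res.r a ψ) :
    ∃ z : X.coind.res.carrier, (∀ a, X.coind.res.l a z = X.coind.res.r a z) ∧
      iotaComm X.coind z = ψ := by
  -- The equation for `z` is `z(ı^{v+1}) - z(ı^v) ı = ψ(ı^v)`. With `z(ı^v) = n(v) ı^v` it says that
  -- `n(v+1) - n(v) = ψ(ı^v) ı^{-v-1}`, and `z(c ı^v) = z(ı^v) c` makes `z` central with respect to `Λ`.
  obtain ⟨n, hn⟩ := exists_int_primitive fun v => rT X (-v - 1) (evR X (T v) ψ)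
  obtain ⟨z, hz⟩ : ∃ z : X.coind.res.carrier, ∀ v c,
      evR X (AddMonoidAlgebra.single v c) z = X.res.r c (rT X v (n v)) :=
    ⟨lsumB fun v => X.res.r.flip (rT X v (n v)), fun v c => lsumB_single (V := X.carrier) _ v c⟩
  refine ⟨z, fun a => evR_ext fun v c => ?_, evR_ext fun v c => ?_⟩
  · rw [evR_l, evR_r, single_mul_C, hz, hz, X.res.mul_r]
  · have h2 : (AddMonoidAlgebra.single v c * T 1 : Λ[T;T⁻¹]) = AddMonoidAlgebra.single (v + 1) c := by
      rw [single_eq_C_mul_T, single_eq_C_mul_T, mul_assoc, ← T_add]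
    rw [evR_iotaComm, h2, hz, hz, hn, map_add, map_add, rT_r, rT_rT, rT_rT, single_eq_T_mul_C, ← evR_l, hψ,
      evR_r, show -v - 1 + (v + 1) = 0 by ring, rT_zero]
    abel

/-- The mapping cone of the commutator with `ı` on the cochains of `Λ` with values in a coinduced bimodule is
acyclic in positive degrees. -/
theorem coind_cone_acyclic {p : ℤ} (hp : 1 ≤ p) {g : List Λ → X.coind.res.carrier}
    (hg : g ∈ Zc X.coind.res p) {h : List Λ → X.coind.res.carrier} (hh : h ∈ Coch X.coind.res (p - 1))
    (hd : d X.coind.res h = post (iotaComm X.coind) g) :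
    ∃ g₀ ∈ Coch X.coind.res (p - 1), ∃ h₀ ∈ Coch X.coind.res (p - 2),
      d X.coind.res g₀ = g ∧ h = post (iotaComm X.coind) g₀ - d X.coind.res h₀ := by
  -- `s` solves the first equation, and then `h - [ı, s]` is a cocycle of degree `p - 1`.
  have hs := contr_mem (n := p - 1) (by ring) ⟨g, hg.1.1⟩ hg.1
  have hds : d X.coind.res (contr ⟨g, hg.1.1⟩) = g :=
    d_contr ⟨g, hg.1.1⟩ (Zc.d_eq hg) (hg.1.2 [] (by simp; omega))
  generalize contr ⟨g, hg.1.1⟩ = s at hs hds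
  have hh' : h - post (iotaComm X.coind) s ∈ Coch X.coind.res (p - 1) :=
    Submodule.sub_mem _ hh (Coch.map (iotaComm X.coind) hs)
  have hdh' : d X.coind.res (h - post (iotaComm X.coind) s) = 0 := by
    rw [map_sub, d_post (iotaComm_isHom X.coind), hds, hd, sub_self]
  rcases hp.eq_or_lt with rfl | hp
  -- For `p = 1` this cocycle is a central element, which is `[ı, z]` for a central `z`; add `z` to `s`.
  · have hc : ∀ a, X.coind.res.l a (h [] - iotaComm X.coind (s [])) =
        X.coind.res.r a (h [] - iotaComm X.coind (s [])) := fun a => by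
      have h1 := congrFun hdh' [a]
      rw [d_cons, inner_nil, Pi.zero_apply, ← sub_eq_add_neg, sub_eq_zero] at h1
      exact h1
    obtain ⟨z, hz, hz'⟩ := exists_iotaComm_eq _ hc
    refine ⟨s + coch0 z, add_mem hs (coch0_mem X.coind.res z), 0, zero_mem _, ?_, ?_⟩
    · rw [map_add, hds, coch0_cocyc X.coind.res z hz, add_zero]
    · rw [map_zero, sub_zero]
      funext l
      rcases l with _ | ⟨a, t⟩
      · change h [] = iotaComm X.coind (s [] + z)
        rw [map_add, hz']
        exact (add_sub_cancel _ _).symm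
      · have h1 : h (a :: t) = 0 := hh.2 _ (by simp only [List.length_cons]; omega)
        have h2 : s (a :: t) = 0 := hs.2 _ (by simp only [List.length_cons]; omega)
        change h (a :: t) = iotaComm X.coind (s (a :: t) + 0)
        rw [h1, h2, add_zero, map_zero]
  -- For `p > 1` it is contracted a second time.
  · refine ⟨s, hs, -contr ⟨_, hh'.1⟩, neg_mem (contr_mem (by ring) ⟨_, hh'.1⟩ hh'), hds, ?_⟩
    rw [map_neg, d_contr ⟨_, hh'.1⟩ hdh' (hh'.2 [] (by simp; omega)), sub_neg_eq_add]
    exact (add_sub_cancel _ _).symm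

/-! ### Cocycles of `Λ[ı^{±1}]` are determined by their restrictions -/

/-- A derivation of `Λ[ı^{±1}]` which vanishes on `Λ` and on `ı` is zero. -/
theorem deriv_eq_zero (D : Λ[T;T⁻¹] →ₗ[ℂ] X.carrier)
    (hD : ∀ a b, D (a * b) = X.l a (D b) + X.r b (D a)) (hC : ∀ a, D (C a) = 0) (hT : D (T 1) = 0) :
    D = 0 := by
  have h1 : ∀ n : ℤ, D (T (n + 1)) = X.r (T 1) (D (T n)) := fun n => by
    rw [T_add, hD, hT, map_zero, zero_add]
  have h2 : ∀ x : X.carrier, X.r (T 1) x = 0 → x = 0 := fun x hx => by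
    have h := X.mul_r (T 1) (T (-1)) x
    rwa [← T_add, hx, map_zero, show (1 : ℤ) + -1 = 0 by norm_num, T_zero, X.one_r] at h
  have h3 : ∀ n : ℤ, D (T n) = 0 := fun n => by
    induction n using Int.induction_on with
    | zero => rw [T_zero, ← map_one C]; exact hC 1
    | succ i ih => rw [h1, ih, map_zero]
    | pred i ih => exact h2 _ (by rw [← h1, sub_add_cancel, ih])
  exact lhomB_ext fun v a => by
    rw [single_eq_C_mul_T, hD, h3, hC, map_zero, map_zero, add_zero]; rfl

/-- If the restriction to `Λ` of a cocycle `f` of `Λ[ı^{±1}]` and the restriction of `f{ı}` form a coboundary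
in the mapping cone of the commutator with `ı`, then `f` is a coboundary. -/
theorem exists_d_eq (n : ℕ) : ∀ (X : Bim.{u} Λ[T;T⁻¹]) {p : ℤ}, p = n → ∀ f ∈ Zc X p,
    ∀ x ∈ Coch X.res (p - 1), ∀ y ∈ Coch X.res (p - 2), resC X f = d X.res x →
      resC X (ins (T 1) f) = post (iotaComm X) x - d X.res y → ∃ k ∈ Coch X (p - 1), d X k = f := by
  induction n with
  | zero =>
    rintro X p rfl f hf x hx y hy h1 -
    -- In degree `0`, the only value of `f` is that of its restriction, which is zero.
    refine ⟨0, zero_mem _, ?_⟩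
    rw [map_zero]
    funext l
    rcases l with _ | ⟨a, t⟩
    · exact (congrFun h1 []).symm
    · exact (hf.1.2 _ (by simp only [List.length_cons]; omega)).symm
  | succ n ih =>
    rintro X p rfl f hf x hx y hy h1 h2
    rcases n with _ | n
    -- In degree `1`, subtract from `f` the inner derivation of the element `x`; the difference vanishes on `Λ`
    -- and on `ı`.
    · have hk := coch0_mem X (x [])
      refine ⟨coch0 (x []), by simpa using hk, ?_⟩
      have hdk := d_mem hk
      have hdk' : ∀ a, d X (coch0 (x [])) [a] = X.l a (x []) - X.r a (x []) := fun a => by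
        rw [d_cons, inner_nil, ← sub_eq_add_neg]; rfl
      have hy0 : y = 0 := Coch.eq_zero (by simp) hy
      rw [hy0, map_zero, sub_zero] at h2
      have hDm : f - d X (coch0 (x [])) ∈ ML Λ[T;T⁻¹] X.carrier := Submodule.sub_mem _ hf.1.1 hdk.1
      have hD := deriv_eq_zero (X := X) ((hDm [] []).mk' _) (fun a b => by
          have h := congrFun (show d X (f - d X (coch0 (x []))) = 0 by
            rw [map_sub, d_d, Zc.d_eq hf, sub_zero]) [a, b]
          rw [d_cons, inner_cons, inner_nil] at h
          change _ + (_ - -_) = (0 : X.carrier) at h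
          rw [← sub_eq_zero, ← neg_eq_zero, ← h]
          change -((f - d X (coch0 (x []))) [a * b] - (X.l a ((f - d X (coch0 (x []))) [b]) +
            X.r b ((f - d X (coch0 (x []))) [a]))) = _ + (-((f - d X (coch0 (x []))) [a * b]) - -
              X.r b ((f - d X (coch0 (x []))) [a]))
          abel)
        (fun a => by
          have h := congrFun h1 [a]
          rw [d_cons, inner_nil, ← sub_eq_add_neg] at h
          change f [C a] - d X (coch0 (x [])) [C a] = 0
          rw [hdk', sub_eq_zero]
          exact h)
        (by
          have h := congrFun h2 []
          change f [T 1] - d X (coch0 (x [])) [T 1] = 0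
          rw [hdk', sub_eq_zero]
          exact (ins_nil (T 1) f).symm.trans h)
      funext l
      rcases l with _ | ⟨a, _ | ⟨b, t⟩⟩
      · exact (hf.1.2 [] (by simp)).symm
      · have h := LinearMap.congr_fun hD a
        exact (sub_eq_zero.mp h).symm
      · rw [hdk.2 _ (by simp only [List.length_cons]; omega), hf.1.2 _ (by simp only [List.length_cons]; omega)]
    -- In higher degrees, `f` is the coboundary of `F = curryC f` in the coinduced bimodule, and the image of `F`
    -- in the cosyzygy is a cocycle of smaller degree. Acyclicity of the cone of the coinduced bimodule provides
    -- the data needed to apply the induction hypothesis to it.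
    · have hp : ((n + 1 + 1 : ℕ) : ℤ) - 1 = (n + 1 : ℕ) := by push_cast; ring
      have hp2 : ((n + 1 + 1 : ℕ) : ℤ) - 2 = (n + 1 : ℕ) - 1 := by push_cast; ring
      rw [hp] at hx
      rw [hp2] at hy
      have hF := curryC_mem (n := (n + 1 : ℕ)) (by push_cast; ring) ⟨f, hf.1.1⟩ hf.1
      have hdF := d_curryC ⟨f, hf.1.1⟩ (Zc.d_eq hf) (hf.1.2 [] (by simp; omega))
      generalize curryC ⟨f, hf.1.1⟩ = F at hF hdF
      have hdF : d X.coind F = post (coindInc X) f := hdF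
      have hinc := coindInc_isHom (X := X)
      have hiF : ins (T 1) (post (coindInc X) f) = post (coindInc X) (ins (T 1) f) :=
        funext fun l => ins_comp (T 1) (coindInc X) f l
      let incR : X.res.carrier →ₗ[ℂ] X.coind.res.carrier := coindInc X
      have hincR : Bim.IsHom (X := X.res) (Y := X.coind.res) incR := hinc.res
      have hres : ∀ k : List Λ[T;T⁻¹] → X.carrier, resC X.coind (post (coindInc X) k) =
        post incR (resC X k) := fun _ => rfl
      have hcomm : ∀ k : List Λ → X.res.carrier, post (iotaComm X.coind) (post incR k) =
          post incR (post (iotaComm X) k) := fun k => funext fun l => iotaComm_map hinc (k l)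
      have hdi := d_ins_T hF.1
      rw [hdF, hiF, hres, h2, map_sub] at hdi
      obtain ⟨g₀, hg₀, h₀, hh₀, hdg, hdh⟩ := coind_cone_acyclic (X := X) (p := (n + 1 : ℕ)) (by push_cast; omega)
        (g := resC X.coind F - post incR x)
        ⟨Submodule.sub_mem _ (resC_mem hF) (Coch.map incR hx), LinearMap.mem_ker.mpr (by
          rw [map_sub, d_resC, hdF, hres, h1, d_post hincR, sub_self])⟩
        (h := resC X.coind (ins (T 1) F) - post incR y)
        (Submodule.sub_mem _ (resC_mem (ins_mem (T 1) (by ring) hF)) (Coch.map incR hy)) (by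
          rw [map_sub, hdi, d_post hincR, map_sub, hcomm]
          abel)
      let prR : X.coind.res.carrier →ₗ[ℂ] X.cosyz.res.carrier := cosyzPr X
      have hpr := cosyzPr_isHom (X := X)
      have hprR : Bim.IsHom (X := X.coind.res) (Y := X.cosyz.res) prR := hpr.res
      have hpi : ∀ k : List Λ → X.res.carrier, post prR (post incR k) = 0 :=
        fun k => funext fun l => cosyzPr_coindInc (X := X) (k l)
      obtain ⟨k, hk, hdk⟩ := ih X.cosyz (p := (n + 1 : ℕ)) rfl (post (cosyzPr X) F)
        ⟨Coch.map _ hF, LinearMap.mem_ker.mpr (by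
          rw [d_post hpr, hdF]; exact funext fun l => cosyzPr_coindInc (f l))⟩
        (post prR g₀) (Coch.map prR hg₀) (post prR h₀) (Coch.map prR hh₀)
        (by
          rw [d_post hprR, hdg, map_sub, hpi, sub_zero]; rfl)
        (by
          have e1 : resC X.cosyz (ins (T 1) (post (cosyzPr X) F)) =
              post prR (resC X.coind (ins (T 1) F)) :=
            funext fun l => ins_comp (T 1) (cosyzPr X) F (l.map C)
          have e2 : post (iotaComm X.cosyz) (post prR g₀) = post prR (post (iotaComm X.coind) g₀) :=
            funext fun l => iotaComm_map hpr (g₀ l)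
          rw [e1, e2, d_post hprR, ← map_sub, ← hdh, map_sub, hpi, sub_zero])
      -- Subtract from `F` the coboundary of a lift of `k`. The difference `G` takes values in `X`, and `d G = f`.
      have hk' : post (cosyzInc X) k ∈ Coch X.coind ((n + 1 : ℕ) - 1) := Coch.map (cosyzInc X) hk
      have hG : F - d X.coind (post (cosyzInc X) k) ∈ Coch X.coind (n + 1 : ℕ) :=
        Submodule.sub_mem _ hF (by simpa using d_mem hk')
      have hG0 : post (cosyzPr X) (F - d X.coind (post (cosyzInc X) k)) = 0 := by
        have e : post (cosyzPr X) (post (cosyzInc X) k) = k := funext fun l => cosyzPr_cosyzInc (k l)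
        rw [map_sub, ← d_post hpr, e, hdk, sub_self]
      have hdG : d X.coind (F - d X.coind (post (cosyzInc X) k)) = post (coindInc X) f := by
        rw [map_sub, d_d, sub_zero, hdF]
      generalize F - d X.coind (post (cosyzInc X) k) = G at hG hG0 hdG
      have hGk : post (coindInc X) (post (evC X 1) G) = G := funext fun l => by
        have e := congrArg (cosyzInc X) (congrFun hG0 l)
        change cosyzInc X (cosyzPr X (G l)) = cosyzInc X 0 at e
        rw [cosyzInc_cosyzPr, map_zero, sub_eq_zero] at e
        exact e.symm
      refine ⟨post (evC X 1) G, hp ▸ Coch.map (Y := X) (evC X 1) hG, ?_⟩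
      rw [← hGk, d_post hinc] at hdG
      exact funext fun l => coindInc_injective (congrFun hdG l)

end Restriction

noncomputable section Homogeneous

set_option linter.unusedSectionVars false

open LaurentPolynomial

variable (Λ : Type u) [Ring Λ] [Algebra ℂ Λ]

/-! ### Homogeneous cochains of `Λ[ı^{±1}]` -/

/-- The evaluation `Λ[ı^{±1}] → Λ` at `ı = 1`. -/
def eps : Λ[T;T⁻¹] →ₗ[ℂ] Λ := lsumB fun _ => LinearMap.id

variable {Λ}

theorem eps_single (v : ℤ) (a : Λ) : eps Λ (AddMonoidAlgebra.single v a) = a := lsumB_single _ v a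

theorem eps_C (a : Λ) : eps Λ (C a) = a := eps_single 0 a

theorem eps_T (v : ℤ) : eps Λ (T v) = 1 := eps_single v 1

theorem eps_one : eps Λ 1 = 1 := eps_single 0 1

theorem eps_mul (a b : Λ[T;T⁻¹]) : eps Λ (a * b) = eps Λ a * eps Λ b := by
  induction a using LaurentPolynomial.induction_on' with
  | add p q hp hq => simp only [add_mul, map_add, hp, hq]
  | C_mul_T n x =>
    induction b using LaurentPolynomial.induction_on' with
    | add p q hp hq => simp only [mul_add, map_add, hp, hq]
    | C_mul_T m y =>
      simp only [← single_eq_C_mul_T, AddMonoidAlgebra.single_mul_single, eps_single]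

theorem single_eps {w : ℤ} {x : Λ[T;T⁻¹]} (hx : x ∈ lgr Λ w) : AddMonoidAlgebra.single w (eps Λ x) = x := by
  obtain ⟨a, rfl⟩ := hx
  rw [AddMonoidAlgebra.lsingle_apply, eps_single]

variable (Λ)

/-- The bimodule `Λ` over `Λ[ı^{±1}]`, on which `ı` acts as the identity. -/
def Bim.aug : Bim Λ[T;T⁻¹] where
  carrier := Λ
  l := LinearMap.mul ℂ Λ ∘ₗ eps Λ
  r := (LinearMap.mul ℂ Λ).flip ∘ₗ eps Λ
  one_l x := by simp [eps_one]
  mul_l a b x := by simp [eps_mul, mul_assoc]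
  one_r x := by simp [eps_one]
  mul_r a b x := by simp [eps_mul, mul_assoc]
  l_r a b x := by simp [mul_assoc]

/-- The evaluation at `ı = 1`, as a map to the bimodule `Λ` over `Λ[ı^{±1}]`. -/
def epsB : (Bim.diag Λ[T;T⁻¹]).carrier →ₗ[ℂ] (Bim.aug Λ).carrier := eps Λ

variable {Λ}

theorem epsB_isHom : Bim.IsHom (epsB Λ) where
  map_l a (x : Λ[T;T⁻¹]) := eps_mul a x
  map_r a (x : Λ[T;T⁻¹]) := eps_mul x a

theorem iotaComm_aug (x : (Bim.aug Λ).res.carrier) : iotaComm (Bim.aug Λ) x = 0 := by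
  revert x
  change ∀ x : Λ, eps Λ (T 1) * x - x * eps Λ (T 1) = 0
  exact fun x => by rw [eps_T, one_mul, mul_one, sub_self]

/-- Homogeneous multilinear functions are determined by their values at `ı = 1`. -/
theorem eq_zero_of_eps {w : ℤ} {f : List Λ[T;T⁻¹] → Λ[T;T⁻¹]} (hf : f ∈ ML Λ[T;T⁻¹] Λ[T;T⁻¹])
    (hw : f ∈ Homog (lgr Λ) w) (h : ∀ l, eps Λ (f l) = 0) : f = 0 := by
  funext l
  induction l generalizing f w with
  | nil =>
    have h1 := single_eps (Homog.nil hw)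
    rw [h, AddMonoidAlgebra.single_zero] at h1
    exact h1.symm
  | cons b t ih =>
    have h1 : (ML.lin hf t).mk' _ = 0 := lhomB_ext fun v a =>
      ih (ML.tl_mem hf _) (Homog.tl hw (single_mem_lgr v a)) fun l => h (_ :: l)
    exact LinearMap.congr_fun h1 b

/-- The values of `homog w F`, by recursion on the sequence of arguments: the first argument is decomposed in
its homogeneous parts, and a part of weight `v` is absorbed in `F` and raises the weight by `v`. -/
def homogAux : List Λ[T;T⁻¹] → ℤ → (List Λ[T;T⁻¹] → Λ) →ₗ[ℂ] Λ[T;T⁻¹]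
  | [], w => AddMonoidAlgebra.lsingle w ∘ₗ LinearMap.proj []
  | b :: t, w => ∑ v ∈ b.coeff.support, homogAux t (v + w) ∘ₗ
      LinearMap.funLeft ℂ Λ (List.cons (AddMonoidAlgebra.single v (b.coeff v)))

variable (Λ) in
/-- The homogeneous function of weight `w` whose evaluation at `ı = 1` is a given multilinear function. -/
def homog (w : ℤ) : (List Λ[T;T⁻¹] → Λ) →ₗ[ℂ] (List Λ[T;T⁻¹] → Λ[T;T⁻¹]) :=
  LinearMap.pi fun l => homogAux l w

theorem homog_nil (w : ℤ) (F : List Λ[T;T⁻¹] → Λ) : homog Λ w F [] = AddMonoidAlgebra.single w (F []) := rfl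

theorem homog_cons (w : ℤ) (F : List Λ[T;T⁻¹] → Λ) (b : Λ[T;T⁻¹]) (t : List Λ[T;T⁻¹]) :
    homog Λ w F (b :: t) = ∑ v ∈ b.coeff.support,
      homog Λ (v + w) (tl F (AddMonoidAlgebra.single v (b.coeff v))) t := by
  change homogAux (b :: t) w F = _
  rw [homogAux, LinearMap.sum_apply]
  rfl

theorem homog_cons_lin (w : ℤ) {F : List Λ[T;T⁻¹] → Λ} (hF : F ∈ ML Λ[T;T⁻¹] Λ) (t : List Λ[T;T⁻¹]) :
    IsLinearMap ℂ fun b => homog Λ w F (b :: t) := by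
  let φ : ℤ → Λ →ₗ[ℂ] Λ[T;T⁻¹] := fun v =>
    { toFun := fun a => homog Λ (v + w) (tl F (AddMonoidAlgebra.single v a)) t
      map_add' := fun a b => by
        rw [AddMonoidAlgebra.single_add, (ML.tl_lin hF).map_add, map_add]; rfl
      map_smul' := fun c a => by
        rw [← AddMonoidAlgebra.smul_single, (ML.tl_lin hF).map_smul, map_smul]; rfl }
  have h : (fun b => homog Λ w F (b :: t)) = lsumB φ := funext fun b => homog_cons w F b t
  rw [h]
  exact (lsumB φ).isLinear

theorem homog_single_cons (w : ℤ) {F : List Λ[T;T⁻¹] → Λ} (hF : F ∈ ML Λ[T;T⁻¹] Λ) (v : ℤ) (a : Λ)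
    (t : List Λ[T;T⁻¹]) : homog Λ w F (AddMonoidAlgebra.single v a :: t) =
      homog Λ (v + w) (tl F (AddMonoidAlgebra.single v a)) t := by
  by_cases ha : a = 0
  · rw [ha, AddMonoidAlgebra.single_zero, (ML.tl_lin hF).map_zero, map_zero]
    exact (homog_cons_lin w hF t).map_zero
  · rw [homog_cons, AddMonoidAlgebra.coeff_single, Finsupp.support_single _ ha,
      Finset.sum_singleton, Finsupp.single_eq_same]

theorem eps_homog (w : ℤ) {F : List Λ[T;T⁻¹] → Λ} (hF : F ∈ ML Λ[T;T⁻¹] Λ) (l : List Λ[T;T⁻¹]) :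
    eps Λ (homog Λ w F l) = F l := by
  induction l generalizing F w with
  | nil => rw [homog_nil, eps_single]
  | cons b t ih =>
    have h : eps Λ ∘ₗ (homog_cons_lin w hF t).mk' _ = (ML.lin hF t).mk' _ := lhomB_ext fun v a => by
      rw [LinearMap.comp_apply, IsLinearMap.mk'_apply, homog_single_cons w hF, ih _ (ML.tl_mem hF _)]; rfl
    exact LinearMap.congr_fun h b

theorem homog_mem_ML (w : ℤ) {F : List Λ[T;T⁻¹] → Λ} (hF : F ∈ ML Λ[T;T⁻¹] Λ) :
    homog Λ w F ∈ ML Λ[T;T⁻¹] Λ[T;T⁻¹] := by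
  intro l₁ l₂
  induction l₁ generalizing F w with
  | nil => exact homog_cons_lin w hF l₂
  | cons c l₁ ih =>
    simp only [List.cons_append, homog_cons]
    have h := (∑ v ∈ c.coeff.support, (ih (v + w)
      (ML.tl_mem hF (AddMonoidAlgebra.single v (c.coeff v)))).mk' _).isLinear
    simpa only [LinearMap.sum_apply, LinearMap.coe_sum, IsLinearMap.mk'_apply, Finset.sum_fn] using h

theorem homog_mem_Homog (w : ℤ) {F : List Λ[T;T⁻¹] → Λ} (hF : F ∈ ML Λ[T;T⁻¹] Λ) :
    homog Λ w F ∈ Homog (lgr Λ) w := by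
  intro l
  induction l generalizing F w with
  | nil =>
    intro _
    have e : (([] : List (Λ[T;T⁻¹] × ℤ)).map Prod.snd).sum + w = w := by simp
    exact e.symm ▸ single_mem_lgr w (F [])
  | cons x l ih =>
    obtain ⟨b, v⟩ := x
    intro hl
    have e : (((b, v) :: l).map Prod.snd).sum + w = (l.map Prod.snd).sum + (v + w) := by
      simp only [List.map_cons, List.sum_cons]; ring
    have hb : b ∈ lgr Λ v := hl (b, v) List.mem_cons_self
    have h2 : homog Λ (v + w) (tl F (AddMonoidAlgebra.single v (eps Λ b))) (l.map Prod.fst) ∈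
        lgr Λ ((l.map Prod.snd).sum + (v + w)) :=
      ih (v + w) (ML.tl_mem hF _) fun x hx => hl x (List.mem_cons_of_mem _ hx)
    have h3 := homog_single_cons w hF v (eps Λ b) (l.map Prod.fst)
    rw [single_eps hb] at h3 h2
    rw [← h3] at h2
    rw [e, List.map_cons]
    exact h2

theorem homog_eq_zero (w : ℤ) {F : List Λ[T;T⁻¹] → Λ} {p : ℤ} (h : ∀ l, (l.length : ℤ) ≠ p → F l = 0)
    (l : List Λ[T;T⁻¹]) (hl : (l.length : ℤ) ≠ p) : homog Λ w F l = 0 := by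
  induction l generalizing F w p with
  | nil => rw [homog_nil, h _ hl, AddMonoidAlgebra.single_zero]
  | cons b t ih =>
    rw [homog_cons]
    refine Finset.sum_eq_zero fun v _ => ih (p := p - 1) _ (fun l hl => h _ ?_) ?_
    · simp only [List.length_cons]; omega
    · simp only [List.length_cons] at hl; omega

theorem homog_mem (w : ℤ) {p : ℤ} {F : List Λ[T;T⁻¹] → Λ} (hF : F ∈ Coch (Bim.aug Λ) p) :
    homog Λ w F ∈ GCoch (lgr Λ) w p :=
  ⟨⟨homog_mem_ML w hF.1, homog_eq_zero w hF.2⟩, homog_mem_Homog w hF.1⟩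

/-- The composition of a function on sequences of elements of `Λ` with the evaluation at `ı = 1`. -/
def pull {V : Type u} (x : List Λ → V) : List Λ[T;T⁻¹] → V := fun l => x (l.map (eps Λ))

theorem pull_mem_ML {V : Type u} [AddCommGroup V] [Module ℂ V] {x : List Λ → V} (hx : x ∈ ML Λ V) :
    pull x ∈ ML Λ[T;T⁻¹] V := fun l₁ l₂ => by
  simp only [pull, List.map_append, List.map_cons]
  exact ((hx (l₁.map (eps Λ)) (l₂.map (eps Λ))).mk' _ ∘ₗ eps Λ).isLinear

theorem inner_pull (x : List Λ → Λ) (a : Λ[T;T⁻¹]) (t : List Λ[T;T⁻¹]) :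
    inner (Bim.aug Λ) (pull x) a t = innA x (eps Λ a) (t.map (eps Λ)) := by
  induction t generalizing x a with
  | nil => rw [inner_nil]; exact (innA_nil x (eps Λ a)).symm
  | cons b t ih =>
    have h2 : pull (V := (Bim.aug Λ).carrier) x ((a * b) :: t) =
        x ((eps Λ a * eps Λ b) :: t.map (eps Λ)) := by
      rw [← eps_mul]; rfl
    exact (inner_cons _ _ _ _).trans ((congrArg₂ (fun u v : Λ => -u - v) h2 (ih (tl x (eps Λ a)) b)).trans
      (inner_cons (X := Bim.diag Λ) x (eps Λ a) (eps Λ b) (t.map (eps Λ))).symm)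

theorem d_pull (x : List Λ → Λ) : d (Bim.aug Λ) (pull x) = pull (dA x) := by
  funext l
  rcases l with _ | ⟨a, t⟩
  · rfl
  · rw [d_cons, inner_pull]; rfl

variable (Λ) in
/-- The extension of a cochain of `Λ` to an `ı`-linear cochain of `Λ[ı^{±1}]`, multiplied by `ı^w`. -/
def emb (w : ℤ) : (List Λ → (Bim.diag Λ).carrier) →ₗ[ℂ]
    (List Λ[T;T⁻¹] → (Bim.diag Λ[T;T⁻¹]).carrier) :=
  homog Λ w ∘ₗ LinearMap.funLeft ℂ Λ (List.map (eps Λ))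

theorem eps_emb (w : ℤ) {x : List Λ → Λ} (hx : x ∈ ML Λ Λ) (l : List Λ[T;T⁻¹]) :
    eps Λ (emb Λ w x l) = x (l.map (eps Λ)) := eps_homog w (pull_mem_ML hx) l

theorem emb_mem_ML (w : ℤ) {x : List Λ → Λ} (hx : x ∈ ML Λ Λ) : emb Λ w x ∈ ML Λ[T;T⁻¹] Λ[T;T⁻¹] :=
  homog_mem_ML w (pull_mem_ML hx)

theorem emb_mem_Homog (w : ℤ) {x : List Λ → Λ} (hx : x ∈ ML Λ Λ) : emb Λ w x ∈ Homog (lgr Λ) w :=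
  homog_mem_Homog w (pull_mem_ML hx)

theorem emb_mem (w : ℤ) {p : ℤ} {x : List Λ → Λ} (hx : x ∈ Coch (Bim.diag Λ) p) :
    emb Λ w x ∈ GCoch (lgr Λ) w p :=
  homog_mem w ⟨pull_mem_ML hx.1, fun l hl => hx.2 _ (by rwa [List.length_map])⟩

theorem eq_emb {w : ℤ} {f : List Λ[T;T⁻¹] → Λ[T;T⁻¹]} (hf : f ∈ ML Λ[T;T⁻¹] Λ[T;T⁻¹])
    (hw : f ∈ Homog (lgr Λ) w) {x : List Λ → Λ} (hx : x ∈ ML Λ Λ)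
    (h : ∀ l, eps Λ (f l) = x (l.map (eps Λ))) : f = emb Λ w x :=
  sub_eq_zero.mp (eq_zero_of_eps (Submodule.sub_mem _ hf (emb_mem_ML w hx))
    ((Homog (lgr Λ) w).sub_mem hw (emb_mem_Homog w hx)) fun l =>
      (map_sub (eps Λ) (f l) (emb Λ w x l)).trans (by rw [h, eps_emb w hx, sub_self]))

theorem d_emb (w : ℤ) {x : List Λ → Λ} (hx : x ∈ ML Λ Λ) : dA (emb Λ w x) = emb Λ w (dA x) := by
  refine eq_emb (d_mem_ML (X := Bim.diag _) (emb_mem_ML w hx)) (d_homog (emb_mem_Homog w hx))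
    (d_mem_ML (X := Bim.diag Λ) hx) fun l => ?_
  have h1 := congrFun (d_map epsB_isHom (emb Λ w x)) l
  have h2 : (fun l => epsB Λ (emb Λ w x l)) = pull x := funext fun l => eps_emb w hx l
  exact h1.symm.trans (congrFun ((congrArg (d (Bim.aug Λ)) h2).trans (d_pull x)) l)

theorem cup_emb {w w' v : ℤ} (k : w + w' = v) {x y : List Λ → Λ} (hx : x ∈ ML Λ Λ) (hy : y ∈ ML Λ Λ) :
    cup (LinearMap.mul ℂ Λ[T;T⁻¹]) (emb Λ w x) (emb Λ w' y) = emb Λ v (cup (LinearMap.mul ℂ Λ) x y) := by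
  refine eq_emb (cup_mem_ML _ (emb_mem_ML w hx) (emb_mem_ML w' hy))
    (k ▸ cup_homog (emb_mem_Homog w hx) (emb_mem_Homog w' hy)) (cup_mem_ML _ hx hy) fun l => ?_
  simp only [cup, map_sum, List.length_map]
  refine Finset.sum_congr rfl fun i _ => ?_
  refine (eps_mul (emb Λ w x (l.take i)) (emb Λ w' y (l.drop i))).trans ?_
  rw [eps_emb w hx, eps_emb w' hy, List.map_take, List.map_drop]
  rfl

theorem brace_emb {w w' v : ℤ} (k : w + w' = v) (ε : ℤ) {x y : List Λ → Λ} (hx : x ∈ ML Λ Λ)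
    (hy : y ∈ ML Λ Λ) : brace ε (emb Λ w x) (emb Λ w' y) = emb Λ v (brace ε x y) := by
  refine eq_emb (brace_mem_ML ε (emb_mem_ML w hx) (emb_mem_ML w' hy))
    (k ▸ brace_homog ε (emb_mem_Homog w hx) (emb_mem_Homog w' hy)) (brace_mem_ML ε hx hy) fun l => ?_
  have h1 := brace_comp ε (eps Λ) (emb Λ w x) (emb Λ w' y) l
  have h2 : (fun l => eps Λ (emb Λ w x l)) = pull x := funext fun l => eps_emb w hx l
  rw [h2] at h1
  refine h1.symm.trans ?_
  simp only [brace, hsum, pull, List.map_append, List.length_map, List.map_take, List.length_drop]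
  refine Finset.sum_congr rfl fun i _ => congrArg _ (Finset.sum_congr rfl fun j _ => ?_)
  have e := eps_emb w' hy ((l.drop i).take j)
  rw [List.map_take, List.map_drop] at e
  rw [← e, ← List.map_drop, ← List.map_drop]
  rfl

theorem emb_coch0 (w : ℤ) (a : Λ) : emb Λ w (coch0 a) = coch0 (AddMonoidAlgebra.single w a) := by
  refine (eq_emb (coch0_ML _) (Homog.of (f := coch0 _) (single_mem_lgr w a)
    fun _ _ _ _ _ => Submodule.zero_mem _) (coch0_ML a) fun l => ?_).symm
  rcases l with _ | ⟨b, t⟩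
  · exact eps_single w a
  · exact map_zero (eps Λ)

theorem jCoch_emb (w p : ℤ) {x : List Λ → Λ} (hx : x ∈ Coch (Bim.diag Λ) p) :
    jCoch Λ w (emb Λ w x) = post (iotaMul Λ w) x := by
  funext l
  refine Subtype.ext ?_
  have h1 := jCoch_val Λ w p (emb_mem w hx) l
  refine h1.trans ?_
  have h2 : emb Λ w x (l.map C) ∈ lgr Λ w := h1 ▸ (jCoch Λ w (emb Λ w x) l : lgr Λ w).2
  rw [← single_eps h2, eps_emb w hx.1, List.map_map]
  have h3 : (eps Λ ∘ fun a => (C a : Λ[T;T⁻¹])) = id := funext eps_C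
  have h4 : l.map (eps Λ ∘ (C : Λ → Λ[T;T⁻¹])) = l := by
    refine (congrArg (fun f => l.map f) h3).trans (List.map_id l)
  rw [h4]
  rfl

/-! ### Cohomology classes of `Λ[ı^{±1}]` are determined by two restrictions -/

/-- The evaluation at `ı = 1`, on the part of weight `w`. -/
def epsW (w : ℤ) : (Lw Λ w).carrier →ₗ[ℂ] (Bim.aug Λ).res.carrier := eps Λ ∘ₗ (lgr Λ w).subtype

theorem epsW_isHom (w : ℤ) : Bim.IsHom (X := Lw Λ w) (Y := (Bim.aug Λ).res) (epsW w) where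
  map_l a (x : lgr Λ w) := eps_mul (C a) x.1
  map_r a (x : lgr Λ w) := eps_mul x.1 (C a)

theorem epsW_jCoch (w p : ℤ) {f : List Λ[T;T⁻¹] → Λ[T;T⁻¹]} (hf : f ∈ GCoch (lgr Λ) w p) :
    post (epsW w) (jCoch Λ w f) = resC (Bim.aug Λ) (post (epsB Λ) f) :=
  funext fun l => congrArg (eps Λ) (jCoch_val Λ w p hf l)

/-- A homogeneous cocycle `f` is a coboundary of a homogeneous cochain if the restrictions of `f` and of `f{ı}` to
`Λ` are coboundaries. Homogeneous cochains are cochains with values in the bimodule `Λ` on which `ı` acts as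
the identity, and there the commutator with `ı` vanishes, so that the mapping cone splits. -/
theorem exists_homogeneous_d_eq {w p : ℤ} {f : List Λ[T;T⁻¹] → (Bim.diag Λ[T;T⁻¹]).carrier}
    (hf : f ∈ cocyc (d (Bim.diag Λ[T;T⁻¹])) (GCoch (lgr Λ) w) p)
    {x : List Λ → (Lw Λ w).carrier} (hx : x ∈ Coch (Lw Λ w) (p - 1)) (hfx : jCoch Λ w f = d (Lw Λ w) x)
    (hif : ins (T 1) f ∈ GCoch (lgr Λ) (w + 1) (p - 1))
    {y : List Λ → (Lw Λ (w + 1)).carrier} (hy : y ∈ Coch (Lw Λ (w + 1)) (p - 2))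
    (hfy : jCoch Λ (w + 1) (ins (T 1) f) = d (Lw Λ (w + 1)) y) :
    ∃ k ∈ GCoch (lgr Λ) w (p - 1), d (Bim.diag Λ[T;T⁻¹]) k = f := by
  rcases lt_or_ge p 0 with hp | hp
  · exact ⟨0, zero_mem _, by rw [map_zero, Coch.eq_zero hp hf.1.1]⟩
  obtain ⟨n, hn⟩ := Int.eq_ofNat_of_zero_le hp
  obtain ⟨k, hk, hdk⟩ := exists_d_eq n (Bim.aug Λ) hn (post (epsB Λ) f)
    ⟨Coch.map _ hf.1.1, LinearMap.mem_ker.mpr (by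
      rw [d_post epsB_isHom, LinearMap.mem_ker.mp hf.2, map_zero])⟩
    (post (epsW w) x) (Coch.map (epsW w) hx) (-post (epsW (w + 1)) y)
    (neg_mem (Coch.map (epsW (w + 1)) hy))
    (by rw [d_post (epsW_isHom w), ← hfx, epsW_jCoch w p hf.1])
    (by
      have h1 : post (iotaComm (Bim.aug Λ)) (post (epsW w) x) = 0 := funext fun l => iotaComm_aug _
      have h2 : ins (T 1) (post (epsB Λ) f) = post (epsB Λ) (ins (T 1) f) :=
        funext fun l => ins_comp (T 1) (epsB Λ) f l
      rw [h1, h2, map_neg, d_post (epsW_isHom (w + 1)), ← hfy, epsW_jCoch (w + 1) (p - 1) hif, sub_neg_eq_add,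
        zero_add])
  have hK := homog_mem w hk
  have h0 : d (Bim.diag Λ[T;T⁻¹]) (homog Λ w k) - f = 0 := by
    refine eq_zero_of_eps (w := w) (Submodule.sub_mem _ (d_mem_ML (X := Bim.diag _) hK.1.1) hf.1.1.1)
      ((Homog (lgr Λ) w).sub_mem (d_homog hK.2) hf.1.2) fun l => ?_
    have h1 := congrFun (d_map epsB_isHom (homog Λ w k)) l
    have h2 : (fun l => epsB Λ (homog Λ w k l)) = k := funext fun l => eps_homog w hk.1 l
    rw [h2, hdk] at h1
    exact (map_sub (epsB Λ) (dA (homog Λ w k) l) (f l)).trans (sub_eq_zero.mpr h1.symm)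
  exact ⟨homog Λ w k, hK, sub_eq_zero.mp h0⟩

theorem brace_coch0_left {A V : Type u} [Ring A] [Algebra ℂ A] [AddCommGroup V] (ε : ℤ) (c : V)
    (g : List A → A) : brace ε (coch0 c) g = 0 := by
  have h : ∀ (l : List A) a t, (coch0 c : List A → V) (l ++ a :: t) = 0 := fun l a t => by
    cases l <;> rfl
  funext l
  simp [brace, hsum, h]

/-- The bracket with a cochain of degree `0` is the insertion of its value. -/
theorem gerst_coch0 {A : Type u} [Ring A] [Algebra ℂ A] (p : ℤ) (f : List A → A) (c : A) :
    gerst p 0 f (coch0 c) = ins c f := by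
  rw [gerst, brace_coch0_left, smul_zero, sub_zero, zero_sub, sg_neg, sg_one]
  rfl

/-- The bracket with the class of `ı`. -/
def iotaBr (w p : ℤ) : GHH (lgr Λ) w p →ₗ[ℂ] GHH (lgr Λ) (w + 1) (p - 1) :=
  (GHH.bracket (lgr Λ) rfl (show p + 0 = p - 1 + 1 by omega)).flip (iotaClass Λ)

theorem coho_mk_eq_zero {V : Type u} [AddCommGroup V] [Module ℂ V] {D : V →ₗ[ℂ] V} {C : ℤ → Submodule ℂ V}
    {p : ℤ} {f : V} {hf : f ∈ cocyc D C p} : Coho.mk D C f hf = 0 ↔ ∃ k ∈ C (p - 1), D k = f :=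
  Submodule.Quotient.mk_eq_zero _

/-- A class `z` in the cohomology of `Λ[ı^{±1}]` vanishes if `j^* z` and `j^* [z, ı]` vanish. -/
theorem ghh_eq_zero {w p : ℤ} (z : GHH (lgr Λ) w p) (h1 : jStar Λ w p z = 0)
    (h2 : jStar Λ (w + 1) (p - 1) (iotaBr w p z) = 0) : z = 0 := by
  obtain ⟨⟨f, hf⟩, rfl⟩ := Submodule.mkQ_surjective _ z
  obtain ⟨x, hx, hfx⟩ := coho_mk_eq_zero.mp h1
  obtain ⟨y, hy, hfy⟩ := coho_mk_eq_zero.mp h2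
  have e : gerst p 0 f (coch0 (T 1)) = ins (T 1) f := gerst_coch0 p f (T 1)
  have hif : gerst p 0 f (coch0 (T 1)) ∈ GCoch (lgr Λ) (w + 1) (p - 1) :=
    gerst_gmem (by omega) rfl hf.1 ⟨coch0_mem (Bim.diag _) _, Homog.of (f := coch0 _) (T_mem_lgr 1)
      fun _ _ _ _ _ => Submodule.zero_mem _⟩
  rw [e] at hif
  replace hfy : d (Lw Λ (w + 1)) y = jCoch Λ (w + 1) (gerst p 0 f (coch0 (T 1))) := hfy
  rw [e] at hfy
  exact coho_mk_eq_zero.mpr (exists_homogeneous_d_eq hf hx hfx.symm hif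
    (by rwa [sub_sub] at hy) hfy.symm)

/-- A class `z` in the cohomology of `Λ[ı^{±1}]` is determined by `j^* z` and `j^* [z, ı]`. -/
theorem ghh_ext {w p : ℤ} {z z' : GHH (lgr Λ) w p} (h1 : jStar Λ w p z = jStar Λ w p z')
    (h2 : jStar Λ (w + 1) (p - 1) (iotaBr w p z) = jStar Λ (w + 1) (p - 1) (iotaBr w p z')) : z = z' :=
  sub_eq_zero.mp (ghh_eq_zero _ (by rw [map_sub, h1, sub_self]) (by rw [map_sub, map_sub, h2, sub_self]))

end Homogeneous

/-! ### The graded commutative algebra structure -/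

section Classes

variable {V : Type u} [AddCommGroup V] [Module ℂ V] {D : V →ₗ[ℂ] V} {C : ℤ → Submodule ℂ V} {p : ℤ}

theorem coho_mk_eq {f g : V} {hf : f ∈ cocyc D C p} {hg : g ∈ cocyc D C p} :
    Coho.mk D C f hf = Coho.mk D C g hg ↔ ∃ k ∈ C (p - 1), D k = f - g :=
  Submodule.Quotient.eq _

theorem coho_mk_congr {f g : V} (h : f = g) {hf : f ∈ cocyc D C p} {hg : g ∈ cocyc D C p} :
    Coho.mk D C f hf = Coho.mk D C g hg := by
  subst h; rfl

theorem coho_mk_surj (x : Coho D C p) : ∃ f, ∃ hf : f ∈ cocyc D C p, Coho.mk D C f hf = x := by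
  obtain ⟨⟨f, hf⟩, rfl⟩ := Submodule.mkQ_surjective _ x
  exact ⟨f, hf, rfl⟩

end Classes

section Cochains

set_option linter.unusedSectionVars false

variable {A : Type u} [Ring A] [Algebra ℂ A]

theorem cup_const_mul (c : A) (f g : List A → A) (l : List A) :
    cup (LinearMap.mul ℂ A) (fun s => c * f s) g l = c * cup (LinearMap.mul ℂ A) f g l := by
  simp [cup, mul_assoc, Finset.mul_sum]

theorem cup_assoc (f g h : List A → A) :
    cup (LinearMap.mul ℂ A) (cup (LinearMap.mul ℂ A) f g) h =
      cup (LinearMap.mul ℂ A) f (cup (LinearMap.mul ℂ A) g h) := by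
  funext l
  induction l generalizing f with
  | nil => simp only [cup_nil, LinearMap.mul_apply', mul_assoc]
  | cons a t ih =>
    have h1 : tl (cup (LinearMap.mul ℂ A) f g) a =
        (fun s => f [] * tl g a s) + cup (LinearMap.mul ℂ A) (tl f a) g :=
      funext fun s => cup_cons _ f g a s
    rw [cup_cons, h1, cup_add_left, Pi.add_apply, cup_const_mul, ih, cup_cons _ f, cup_cons _ g, cup_nil]
    simp only [LinearMap.mul_apply', mul_add, mul_assoc, add_assoc]

/-- The signed cup product of cochains with values in `A`. -/
def scupA (p q : ℤ) (f g : List A → A) : List A → A := sg (p * q) • cup (LinearMap.mul ℂ A) f g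

theorem cup_zsmul_right (n : ℤ) (f g : List A → A) :
    cup (LinearMap.mul ℂ A) f (n • g) = n • cup (LinearMap.mul ℂ A) f g := by
  rw [← Int.cast_smul_eq_zsmul ℂ, cup_smul_right, Int.cast_smul_eq_zsmul]

theorem scupA_assoc {p q r m m' : ℤ} (h : p + q = m) (h' : q + r = m') (f g e : List A → A) :
    scupA m r (scupA p q f g) e = scupA p m' f (scupA q r g e) := by
  subst h h'
  simp only [scupA, cup_zsmul_left, cup_zsmul_right, cup_assoc, smul_smul, ← sg_add]
  rw [sg_congr]
  exact ⟨0, by ring⟩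

theorem scupA_one {p : ℤ} (f : List A → A) : scupA p 0 f (coch0 1) = f := by
  have h : ∀ (f : List A → A) l, cup (LinearMap.mul ℂ A) f (coch0 1) l = f l := fun f l => by
    induction l generalizing f with
    | nil => rw [cup_nil]; exact mul_one _
    | cons a t ih =>
      rw [cup_cons, ih]
      exact (congrArg (· + _) (mul_zero (f []))).trans (zero_add _)
  rw [scupA, mul_zero, sg_zero, one_smul]
  exact funext (h f)

/-- The brace is a homotopy for the graded commutativity of the cup product. -/
theorem d_brace_eq_scupA_sub {p q : ℤ} {f g : List A → A} (hf : f ∈ Coch (Bim.diag A) p)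
    (hg : g ∈ Coch (Bim.diag A) q) (hdf : dA f = 0) (hdg : dA g = 0) :
    dA (-sg q • brace (sg (q - 1)) f g) = scupA p q f g - sg (p * q) • scupA q p g f := by
  have h1 : (dA (brace (sg (q - 1)) f g) : List A → A) = -(sg (q - 1) • cup (LinearMap.mul ℂ A) g f) -
      sg (q * (p + 1)) • cup (LinearMap.mul ℂ A) f g := by
    refine (d_brace_A hf hg).trans ?_
    rw [hdf, hdg, brace_zero_left, brace_zero_right _ hf.1, smul_zero, zero_add, zero_sub]
  have h2 : dA (-sg q • brace (sg (q - 1)) f g) = (-sg q • dA (brace (sg (q - 1)) f g) : List A → A) :=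
    map_zsmul (d (Bim.diag A)) _ _
  rw [h2, h1, scupA, scupA, smul_sub, smul_neg, smul_smul, smul_smul, smul_smul, ← sg_add,
    neg_mul, neg_mul, ← sg_add, ← sg_add, sg_congr (m := q + q * (p + 1)) (n := p * q) ⟨q, by ring⟩,
    sg_congr (m := q + (q - 1)) (n := p * q + q * p + 1) ⟨q - p * q - 1, by ring⟩, sg_add _ 1, sg_one]
  simp only [mul_neg, mul_one, neg_smul, neg_neg]
  abel

theorem gerst_antisymm (p q : ℤ) (f g : List A → A) :
    gerst p q f g = -(sg ((p - 1) * (q - 1)) • gerst q p g f) := by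
  rw [gerst, gerst, smul_sub, smul_smul, mul_comm (q - 1), sg_mul_self, one_smul]
  abel

variable {p q p' q' : ℤ} (c : A)

theorem ins_scupA (hp : p' = p - 1) (hq : q' = q - 1) {f g : List A → A} (hf : f ∈ Coch (Bim.diag A) p)
    (hg : g ∈ Coch (Bim.diag A) q) :
    ins c (scupA p q f g) = sg q • scupA p' q (ins c f) g + scupA p q' f (ins c g) := by
  subst hp hq
  have h1 : tau f = sg p • f := tau_eq (X := Bim.diag A) hf
  have h2 := ins_cup c (LinearMap.mul ℂ A) (f := f) hf.1 (g := g) hg.1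
  rw [scupA, scupA, scupA, ins_zsmul, h2, h1, cup_zsmul_left, smul_add,
    smul_smul, smul_smul, ← sg_add, ← sg_add, sg_congr (m := p * q + p) (n := p * (q - 1)) ⟨p, by ring⟩,
    sg_congr (m := p * q) (n := q + (p - 1) * q) ⟨0, by ring⟩]

theorem ins_gerst (hp : p' = p - 1) (hq : q' = q - 1) {f g : List A → A} (hf : f ∈ Coch (Bim.diag A) p)
    (hg : g ∈ Coch (Bim.diag A) q) :
    ins c (gerst p q f g) = gerst p q' f (ins c g) + sg (q - 1) • gerst p' q (ins c f) g := by
  subst hp hq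
  have hs : ∀ n : ℤ, -sg (n - 1) = sg (n - 1 - 1) := fun n => by
    rw [sub_eq_add_neg (n - 1), sg_add, sg_neg, sg_one]; ring
  have h1 : ∀ {p q : ℤ} {f g : List A → A}, f ∈ Coch (Bim.diag A) p → g ∈ Coch (Bim.diag A) q →
      ins c (brace (sg (q - 1)) f g) = brace (sg (q - 1 - 1)) f (ins c g) +
        sg (q - 1) • brace (sg (q - 1)) (ins c f) g := fun {p q f g} hf hg => by
    rw [← hs]
    exact ins_brace c (sg_mul_self _) hf.1 hg.1 (tau_coch hg)
  rw [gerst, ins_sub, ins_zsmul, h1 hf hg, h1 hg hf, gerst, gerst, smul_add, smul_sub, smul_smul,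
    smul_smul, ← sg_add, ← sg_add,
    sg_congr (m := (p - 1) * (q - 1) + (p - 1)) (n := (p - 1) * (q - 1 - 1)) ⟨p - 1, by ring⟩,
    sg_congr (m := q - 1 + (p - 1 - 1) * (q - 1)) (n := (p - 1) * (q - 1)) ⟨0, by ring⟩]
  abel

end Cochains

section HH

variable {A : Type u} [Ring A] [Algebra ℂ A] {p q r m m' n : ℤ}

theorem HH.mul_comm (h : p + q = n) (h' : q + p = n) (x : HH (Bim.diag A) p) (y : HH (Bim.diag A) q) :
    HH.mul (Pairing.diag A) h x y = sg (p * q) • HH.mul (Pairing.diag A) h' y x := by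
  obtain ⟨f, hf, rfl⟩ := coho_mk_surj x
  obtain ⟨g, hg, rfl⟩ := coho_mk_surj y
  exact coho_mk_eq.mpr ⟨-sg q • brace (sg (q - 1)) f g,
    zsmul_mem (brace_mem (X := Bim.diag A) hf.1 hg.1 (by omega) _) _,
    d_brace_eq_scupA_sub hf.1 hg.1 (cocyc_dA hf) (cocyc_dA hg)⟩

theorem HH.bracket_antisymm (h : p + q = n + 1) (h' : q + p = n + 1) (x : HH (Bim.diag A) p)
    (y : HH (Bim.diag A) q) :
    HH.bracket A h x y = -(sg ((p - 1) * (q - 1)) • HH.bracket A h' y x) := by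
  obtain ⟨f, hf, rfl⟩ := coho_mk_surj x
  obtain ⟨g, hg, rfl⟩ := coho_mk_surj y
  exact coho_mk_congr (gerst_antisymm p q f g)

theorem HH.mul_one (hq : q = 0) (h : p + q = p) (x : HH (Bim.diag A) p) :
    HH.mul (Pairing.diag A) h x (oneHH A hq) = x := by
  subst hq
  obtain ⟨f, hf, rfl⟩ := coho_mk_surj x
  exact coho_mk_congr (scupA_one f)

/-- The bracket with the unit vanishes, as the insertion of the unit is homotopic to zero. -/
theorem HH.bracket_one (h : p + 0 = n + 1) (x : HH (Bim.diag A) p) :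
    HH.bracket A h x (oneHH A rfl) = 0 := by
  obtain ⟨f, hf, rfl⟩ := coho_mk_surj x
  refine coho_mk_eq_zero.mpr ⟨-fun l => dbl l f, neg_mem ⟨dbl_mem_ML hf.1.1, fun l hl =>
    dbl_eq_zero hf.1.1 hf.1.2 l (by omega)⟩, ?_⟩
  rw [map_neg, d_dbl hf.1.1, LinearMap.mem_ker.mp hf.2]
  have h1 : gerst p 0 f (coch0 1) = ins 1 f := gerst_coch0 p f 1
  refine Eq.trans ?_ h1.symm
  have h2 : (fun l => dbl l (0 : List A → A)) = 0 := funext fun l => by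
    have := dbl_smul (A := A) (V := A) 0 l 0
    rwa [zero_smul, zero_smul] at this
  have h3 : ∀ y z : List A → A, z = 0 → -(z - y) = y := fun y z hz => by rw [hz, zero_sub, neg_neg]
  exact h3 _ _ h2

end HH

section GHH

variable {A : Type u} [Ring A] [Algebra ℂ A] {𝒜 : ℤ → Submodule ℂ A} [SetLike.GradedMonoid 𝒜]
variable {p q r m m' n w w' w'' v v' u : ℤ}

theorem GHH.mul_comm (k : w + w' = v) (k' : w' + w = v) (h : p + q = n) (h' : q + p = n)
    (x : GHH 𝒜 w p) (y : GHH 𝒜 w' q) : GHH.mul 𝒜 k h x y = sg (p * q) • GHH.mul 𝒜 k' h' y x := by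
  obtain ⟨f, hf, rfl⟩ := coho_mk_surj x
  obtain ⟨g, hg, rfl⟩ := coho_mk_surj y
  exact coho_mk_eq.mpr ⟨-sg q • brace (sg (q - 1)) f g,
    zsmul_mem (Submodule.mem_inf.mpr ⟨brace_mem (X := Bim.diag A) hf.1.1 hg.1.1 (by omega) _,
      Homog.congr k (brace_homog _ hf.1.2 hg.1.2)⟩) _,
    d_brace_eq_scupA_sub hf.1.1 hg.1.1 (cocyc_dA hf) (cocyc_dA hg)⟩

theorem GHH.mul_assoc (k : w + w' = v) (k' : v + w'' = u) (l : w' + w'' = v') (l' : w + v' = u)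
    (h : p + q = m) (h' : m + r = n) (g : q + r = m') (g' : p + m' = n)
    (x : GHH 𝒜 w p) (y : GHH 𝒜 w' q) (z : GHH 𝒜 w'' r) :
    GHH.mul 𝒜 k' h' (GHH.mul 𝒜 k h x y) z = GHH.mul 𝒜 l' g' x (GHH.mul 𝒜 l g y z) := by
  obtain ⟨a, ha, rfl⟩ := coho_mk_surj x
  obtain ⟨b, hb, rfl⟩ := coho_mk_surj y
  obtain ⟨c, hc, rfl⟩ := coho_mk_surj z
  exact coho_mk_congr (scupA_assoc h g a b c)

theorem GHH.bracket_antisymm (k : w + w' = v) (k' : w' + w = v) (h : p + q = n + 1) (h' : q + p = n + 1)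
    (x : GHH 𝒜 w p) (y : GHH 𝒜 w' q) :
    GHH.bracket 𝒜 k h x y = -(sg ((p - 1) * (q - 1)) • GHH.bracket 𝒜 k' h' y x) := by
  obtain ⟨f, hf, rfl⟩ := coho_mk_surj x
  obtain ⟨g, hg, rfl⟩ := coho_mk_surj y
  exact coho_mk_congr (gerst_antisymm p q f g)

end GHH

noncomputable section Laurent

set_option linter.unusedSectionVars false

open LaurentPolynomial

variable {Λ : Type u} [Ring Λ] [Algebra ℂ Λ] {p q m n n' w w' v : ℤ}

theorem iotaBr_mul (k : w + w' = v) (h : p + q = n) (x : GHH (lgr Λ) w p) (y : GHH (lgr Λ) w' q) :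
    iotaBr v n (GHH.mul (lgr Λ) k h x y) =
      sg q • GHH.mul (lgr Λ) (show w + 1 + w' = v + 1 by omega) (show p - 1 + q = n - 1 by omega)
        (iotaBr w p x) y +
      GHH.mul (lgr Λ) (show w + (w' + 1) = v + 1 by omega) (show p + (q - 1) = n - 1 by omega)
        x (iotaBr w' q y) := by
  obtain ⟨f, hf, rfl⟩ := coho_mk_surj x
  obtain ⟨g, hg, rfl⟩ := coho_mk_surj y
  refine coho_mk_congr ((gerst_coch0 _ _ _).trans ((ins_scupA (T 1) rfl rfl hf.1.1 hg.1.1).trans ?_))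
  exact congrArg₂ (fun a b => sg q • scupA (p - 1) q a g + scupA p (q - 1) f b)
    (gerst_coch0 p f (T 1)).symm (gerst_coch0 q g (T 1)).symm

theorem iotaBr_bracket (k : w + w' = v) (h : p + q = n + 1) (x : GHH (lgr Λ) w p) (y : GHH (lgr Λ) w' q) :
    iotaBr v n (GHH.bracket (lgr Λ) k h x y) =
      GHH.bracket (lgr Λ) (show w + (w' + 1) = v + 1 by omega) (show p + (q - 1) = n - 1 + 1 by omega)
        x (iotaBr w' q y) +
      sg (q - 1) • GHH.bracket (lgr Λ) (show w + 1 + w' = v + 1 by omega)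
        (show p - 1 + q = n - 1 + 1 by omega) (iotaBr w p x) y := by
  obtain ⟨f, hf, rfl⟩ := coho_mk_surj x
  obtain ⟨g, hg, rfl⟩ := coho_mk_surj y
  refine coho_mk_congr ((gerst_coch0 _ _ _).trans ((ins_gerst (T 1) rfl rfl hf.1.1 hg.1.1).trans ?_))
  exact congrArg₂ (fun a b => gerst p (q - 1) f b + sg (q - 1) • gerst (p - 1) q a g)
    (gerst_coch0 p f (T 1)).symm (gerst_coch0 q g (T 1)).symm

variable (Λ) in
/-- The map `x ↦ x ı^w` from the Hochschild cohomology of `Λ` to that of `Λ[ı^{±1}]`. -/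
def embH (w p : ℤ) : HH (Bim.diag Λ) p →ₗ[ℂ] GHH (lgr Λ) w p :=
  Coho.map _ _ _ _ (emb Λ w) (fun _ _ hf => emb_mem w hf) (fun _ _ hf => (d_emb w hf.1).symm) p

theorem embH_mul (k : w + w' = v) (h : p + q = n) (x : HH (Bim.diag Λ) p) (y : HH (Bim.diag Λ) q) :
    GHH.mul (lgr Λ) k h (embH Λ w p x) (embH Λ w' q y) = embH Λ v n (HH.mul (Pairing.diag Λ) h x y) := by
  obtain ⟨f, hf, rfl⟩ := coho_mk_surj x
  obtain ⟨g, hg, rfl⟩ := coho_mk_surj y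
  refine coho_mk_congr ?_
  exact (congrArg (fun z => sg (p * q) • z) (cup_emb k hf.1.1 hg.1.1)).trans (map_zsmul (emb Λ v) _ _).symm

theorem embH_bracket (k : w + w' = v) (h : p + q = n + 1) (x : HH (Bim.diag Λ) p)
    (y : HH (Bim.diag Λ) q) :
    GHH.bracket (lgr Λ) k h (embH Λ w p x) (embH Λ w' q y) = embH Λ v n (HH.bracket Λ h x y) := by
  obtain ⟨f, hf, rfl⟩ := coho_mk_surj x
  obtain ⟨g, hg, rfl⟩ := coho_mk_surj y
  refine coho_mk_congr ?_
  have h1 := brace_emb k (sg (q - 1)) hf.1.1 hg.1.1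
  have h2 := brace_emb ((add_comm _ _).trans k) (sg (p - 1)) hg.1.1 hf.1.1
  refine (congrArg₂ (fun a b : List Λ[T;T⁻¹] → Λ[T;T⁻¹] => a - sg ((p - 1) * (q - 1)) • b) h1 h2).trans ?_
  exact ((map_sub (emb Λ v) _ _).trans (congrArg _ (map_zsmul (emb Λ v) _ _))).symm

theorem embH_one_zero : embH Λ 0 0 (oneHH Λ rfl) = oneClass Λ := coho_mk_congr (emb_coch0 0 1)

theorem embH_one_one : embH Λ 1 0 (oneHH Λ rfl) = iotaClass Λ := coho_mk_congr (emb_coch0 1 1)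

theorem jStar_embH (x : HH (Bim.diag Λ) p) :
    jStar Λ w p (embH Λ w p x) = HH.map (iotaMul_isHom Λ w) p x := by
  obtain ⟨f, hf, rfl⟩ := coho_mk_surj x
  exact coho_mk_congr (jCoch_emb w p hf.1)

/-- The bracket `[x ı^w, ı]` is `[x, 1] ı^{w+1}`, and brackets with the unit vanish. -/
theorem iotaBr_embH (x : HH (Bim.diag Λ) p) : iotaBr w p (embH Λ w p x) = 0 := by
  change GHH.bracket (lgr Λ) rfl (show p + 0 = p - 1 + 1 by omega) (embH Λ w p x) (iotaClass Λ) = 0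
  rw [← embH_one_one, embH_bracket, HH.bracket_one, map_zero]

end Laurent

noncomputable section Laurent

set_option linter.unusedSectionVars false

open LaurentPolynomial

/-! ### Products and brackets with the Euler class -/

theorem sg_pow (a : ℤ) (k : ℕ) : sg a ^ k = sg (a * k) := by
  induction k with
  | zero => rw [pow_zero, Nat.cast_zero, mul_zero, sg_zero]
  | succ k ih => rw [pow_succ, ih, ← sg_add, Nat.cast_succ, mul_add, mul_one]

section

variable {A : Type u} [Ring A] [Algebra ℂ A]

theorem twist_eq (a : ℤ) {f : List A → A} {p : ℤ} (hf : f ∈ Coch (Bim.diag A) p) :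
    twist (sg a) f = sg (a * p) • f := by
  funext l
  by_cases h : (l.length : ℤ) = p
  · subst h; rw [twist, sg_pow]; rfl
  · have h1 : f l = 0 := hf.2 l h
    rw [twist, Pi.smul_apply, h1, smul_zero, smul_zero]

theorem brace_zsmul_left (ε n : ℤ) (f g : List A → A) : brace ε (n • f) g = n • brace ε f g := by
  rw [← Int.cast_smul_eq_zsmul ℂ, brace_smul_left, Int.cast_smul_eq_zsmul]

theorem brace_coch1 (ε : ℤ) (E : A →ₗ[ℂ] A) (g : List A → A) : brace ε (coch1 E) g = fun l => E (g l) := by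
  have h : ∀ l (g : List A → A), hsum (fun x s => coch1 E (x :: s)) g l = E (g l) := fun l => by
    induction l with
    | nil => exact fun g => hsum_nil _ g
    | cons a t ih => exact fun g => (hsum_cons _ g a t).trans ((zero_add _).trans (ih (tl g a)))
  funext l
  rcases l with _ | ⟨a, t⟩
  · exact brace_nil _ _ _
  · have h1 : tl (coch1 E) a = coch0 (E a) := funext fun l => by cases l <;> rfl
    rw [brace_cons, h, h1, brace_coch0_left, Pi.zero_apply, smul_zero, add_zero]

end

variable {Λ : Type u} [Ring Λ] [Algebra ℂ Λ] {p q m n n' w w' v : ℤ}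

theorem eulerMap_of_mem {x : Λ[T;T⁻¹]} (hx : x ∈ lgr Λ w) : eulerMap Λ x = -(w • x) := by
  obtain ⟨a, rfl⟩ := hx
  rw [AddMonoidAlgebra.lsingle_apply, eulerMap_single, neg_smul, Int.cast_smul_eq_zsmul]

theorem coch1_eulerMap_map_C (l : List Λ) : coch1 (eulerMap Λ) (l.map C) = 0 := by
  rcases l with _ | ⟨a, _ | ⟨b, t⟩⟩
  · rfl
  · exact (eulerMap_of_mem (C_mem_lgr a)).trans (by rw [zero_smul, neg_zero])
  · rfl

theorem cup_map_C_eq_zero (f : List Λ[T;T⁻¹] → Λ[T;T⁻¹]) {g : List Λ[T;T⁻¹] → Λ[T;T⁻¹]}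
    (hg : ∀ l : List Λ, g (l.map C) = 0) (l : List Λ) :
    cup (LinearMap.mul ℂ Λ[T;T⁻¹]) f g (l.map C) = 0 :=
  Finset.sum_eq_zero fun i _ => by rw [← List.map_drop, hg, map_zero]

theorem brace_map_C_eq_zero (ε : ℤ) {f : List Λ[T;T⁻¹] → Λ[T;T⁻¹]} (hf : f ∈ ML Λ[T;T⁻¹] Λ[T;T⁻¹])
    {g : List Λ[T;T⁻¹] → Λ[T;T⁻¹]} (hg : ∀ l : List Λ, g (l.map C) = 0) (l : List Λ) :
    brace ε f g (l.map C) = 0 := by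
  refine Finset.sum_eq_zero fun i _ => ?_
  rw [hsum, Finset.sum_eq_zero fun j _ => ?_, smul_zero]
  have h1 : ((l.map (C : Λ → Λ[T;T⁻¹])).drop i).take j = ((l.drop i).take j).map C := by
    rw [List.map_take, List.map_drop]
  rw [h1, hg]
  exact (hf _ _).map_zero

theorem jCoch_congr {f g : List Λ[T;T⁻¹] → Λ[T;T⁻¹]} (h : ∀ l : List Λ, f (l.map C) = g (l.map C)) :
    jCoch Λ w f = jCoch Λ w g := funext fun l => congrArg (prW Λ w) (h l)

theorem jCoch_eq_zero {f : List Λ[T;T⁻¹] → Λ[T;T⁻¹]} (h : ∀ l : List Λ, f (l.map C) = 0) :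
    jCoch Λ w f = 0 := funext fun l => (congrArg (prW Λ w) (h l)).trans (map_zero _)

theorem scupA_euler_map_C (f : List Λ[T;T⁻¹] → Λ[T;T⁻¹]) (l : List Λ) :
    scupA p q f (coch1 (eulerMap Λ)) (l.map C) = 0 := by
  rw [scupA, Pi.smul_apply, cup_map_C_eq_zero f coch1_eulerMap_map_C, smul_zero]

theorem jStar_mul_euler (k : w + 0 = v) (h : p + 1 = q) (y : GHH (lgr Λ) w p) :
    jStar Λ v q (GHH.mul (lgr Λ) k h y (eulerClass Λ)) = 0 := by
  obtain ⟨f, hf, rfl⟩ := coho_mk_surj y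
  refine (coho_mk_eq_zero (D := d (Lw Λ v)) (C := Coch (Lw Λ v))).mpr ⟨0, zero_mem _, ?_⟩
  rw [map_zero]
  exact (jCoch_eq_zero (scupA_euler_map_C f)).symm

/-- The restriction to `Λ` of the bracket of a function `F` of weight `w` and of a function which is a multiple
of the Euler derivation comes from the value `-w ı^w` of this derivation on `ı^w`. -/
theorem gerst_scupA_euler_map_C (hm : m + 1 = q) {F Y : List Λ[T;T⁻¹] → Λ[T;T⁻¹]}
    (hF : F ∈ ML Λ[T;T⁻¹] Λ[T;T⁻¹]) (hw : ∀ l : List Λ, F (l.map C) ∈ lgr Λ w)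
    (hY : Y ∈ Coch (Bim.diag Λ[T;T⁻¹]) m) (l : List Λ) :
    gerst p q F (scupA m 1 Y (coch1 (eulerMap Λ))) (l.map C) =
      (sg m * w) • cup (LinearMap.mul ℂ Λ[T;T⁻¹]) Y F (l.map C) := by
  have h1 : cup (LinearMap.mul ℂ Λ[T;T⁻¹]) (twist (sg (p - 1)) Y) (fun l => eulerMap Λ (F l)) (l.map C) =
        -((sg ((p - 1) * m) * w) • cup (LinearMap.mul ℂ Λ[T;T⁻¹]) Y F (l.map C)) := by
    rw [twist_eq (p - 1) hY, cup, cup, Finset.smul_sum, ← Finset.sum_neg_distrib]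
    refine Finset.sum_congr rfl fun i _ => ?_
    rw [← List.map_drop, eulerMap_of_mem (hw _), LinearMap.mul_apply', LinearMap.mul_apply', Pi.smul_apply,
      mul_neg, mul_smul_comm, smul_mul_assoc, smul_smul, mul_comm w]
  rw [gerst, Pi.sub_apply, brace_map_C_eq_zero _ hF (scupA_euler_map_C _), zero_sub, scupA,
    brace_zsmul_left, brace_cup, brace_coch1, smul_smul, Pi.smul_apply, Pi.add_apply,
    cup_map_C_eq_zero _ coch1_eulerMap_map_C, zero_add, h1, smul_neg, neg_neg, smul_smul, ← mul_assoc,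
    ← sg_add, ← sg_add, sg_congr (m := (p - 1) * (q - 1) + m * 1 + (p - 1) * m) (n := m)
      ⟨(p - 1) * m, by subst hm; ring⟩]

theorem gerst_emb_scupA_euler (k : w + w' = v) (hm : m + 1 = q) {f g : List Λ → Λ}
    (hf : f ∈ Coch (Bim.diag Λ) p) (hg : g ∈ Coch (Bim.diag Λ) m) (l : List Λ) :
    gerst p q (emb Λ w f) (scupA m 1 (emb Λ w' g) (coch1 (eulerMap Λ))) (l.map C) =
      ((sg m * w) • emb Λ v (cup (LinearMap.mul ℂ Λ) g f) : List Λ[T;T⁻¹] → Λ[T;T⁻¹]) (l.map C) := by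
  refine (gerst_scupA_euler_map_C hm (emb_mem_ML w hf.1)
    (fun l => (jCoch_val Λ w p (emb_mem w hf) l) ▸ (jCoch Λ w (emb Λ w f) l : lgr Λ w).2)
    (emb_mem w' hg).1 l).trans ?_
  exact congrArg (fun F : List Λ[T;T⁻¹] → Λ[T;T⁻¹] => (sg m * w) • F (l.map C))
    (cup_emb ((add_comm _ _).trans k) hg.1 hf.1)

variable (Λ) in
/-- The map `y ↦ y δ ı^w`. -/
def euD (w p : ℤ) : HH (Bim.diag Λ) (p - 1) →ₗ[ℂ] GHH (lgr Λ) w p :=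
  (GHH.mul (lgr Λ) (add_zero w) (sub_add_cancel p 1)).flip (eulerClass Λ) ∘ₗ embH Λ w (p - 1)

theorem euD_apply (y : HH (Bim.diag Λ) (p - 1)) : euD Λ w p y =
    GHH.mul (lgr Λ) (add_zero w) (sub_add_cancel p 1) (embH Λ w (p - 1) y) (eulerClass Λ) := rfl

theorem jStar_euD (y : HH (Bim.diag Λ) (p - 1)) : jStar Λ w p (euD Λ w p y) = 0 := jStar_mul_euler _ _ _

theorem iotaBr_euler : iotaBr 0 1 (eulerClass Λ) = -embH Λ (0 + 1) (1 - 1) (oneHH Λ (sub_self 1)) := by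
  have h : ins (T 1) (coch1 (eulerMap Λ)) ∈ Coch (Bim.diag Λ[T;T⁻¹]) 0 :=
    ins_mem (X := Bim.diag _) (T 1) (by norm_num) (coch1_mem (eulerMap Λ))
  have h1 : ins (T 1) (coch1 (eulerMap Λ)) = -(coch0 (T 1) : List Λ[T;T⁻¹] → Λ[T;T⁻¹]) := by
    funext l
    rcases l with _ | ⟨a, t⟩
    · refine (ins_nil _ _).trans ((eulerMap_of_mem (T_mem_lgr 1)).trans ?_)
      rw [one_smul]; rfl
    · exact (h.2 (a :: t) (by simp only [List.length_cons]; omega)).trans neg_zero.symm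
  have h2 : (coch0 (T 1) : List Λ[T;T⁻¹] → Λ[T;T⁻¹]) = emb Λ (0 + 1) (coch0 (1 : Λ)) := by
    rw [zero_add]; exact (emb_coch0 1 (1 : Λ)).symm
  exact coho_mk_congr (D := d (Bim.diag Λ[T;T⁻¹])) (C := GCoch (lgr Λ) (0 + 1))
    ((gerst_coch0 1 _ _).trans (h1.trans (congrArg Neg.neg h2)))

theorem iotaBr_euD (y : HH (Bim.diag Λ) (p - 1)) :
    iotaBr w p (euD Λ w p y) = -embH Λ (w + 1) (p - 1) y := by
  rw [euD_apply, iotaBr_mul, iotaBr_embH, map_zero, LinearMap.zero_apply, smul_zero, zero_add, iotaBr_euler,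
    map_neg, embH_mul (h := show p - 1 + (1 - 1) = p - 1 by omega), HH.mul_one]

theorem bracket_embH_euD (k : w + w' = v) (h : p + q = n + 1) (x : HH (Bim.diag Λ) p)
    (y : HH (Bim.diag Λ) (q - 1)) :
    GHH.bracket (lgr Λ) k h (embH Λ w p x) (euD Λ w' q y) =
      embH Λ v n ((sg (q - 1) * w) • HH.mul (Pairing.diag Λ) (show p + (q - 1) = n by omega) x y) +
        euD Λ v n (HH.bracket Λ (show p + (q - 1) = n - 1 + 1 by omega) x y) := by
  -- The restriction of the left-hand side to `Λ` comes from the values of `δ` on `ı^w`. The brackets with `ı` are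
  -- computed by the derivation property and by `[δ, ı] = -ı`.
  refine ghh_ext ?_ ?_
  · rw [map_add, jStar_embH, jStar_euD, add_zero, HH.mul_comm _ (show q - 1 + p = n by omega), smul_smul]
    obtain ⟨f, hf, rfl⟩ := coho_mk_surj x
    obtain ⟨g, hg, rfl⟩ := coho_mk_surj y
    refine coho_mk_congr ((jCoch_congr (gerst_emb_scupA_euler k (sub_add_cancel q 1) hf.1 hg.1)).trans ?_)
    have hm : cup (LinearMap.mul ℂ Λ) g f ∈ Coch (Bim.diag Λ) n :=
      cup_mem (M := Bim.diag Λ) (N := Bim.diag Λ) (X := Bim.diag Λ) hg.1 hf.1 (by omega) (LinearMap.mul ℂ Λ)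
    refine (map_zsmul (jCoch Λ v) _ _).trans ((congrArg _ (jCoch_emb v n hm)).trans
      ((map_zsmul (post (iotaMul Λ v)) _ _).symm.trans (congrArg (post (iotaMul Λ v)) ?_)))
    have e : sg (q - 1) * w * sg (p * (q - 1)) * sg ((q - 1) * p) = sg (q - 1) * w := by
      rw [mul_assoc, mul_comm p, sg_mul_self, _root_.mul_one]
    refine Eq.trans ?_ (smul_smul _ _ _).symm
    rw [e]
    rfl
  · rw [iotaBr_bracket, iotaBr_embH, map_zero, LinearMap.zero_apply, smul_zero, add_zero, iotaBr_euD, map_neg,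
      embH_bracket (h := show p + (q - 1) = n - 1 + 1 by omega), map_add, iotaBr_embH, iotaBr_euD, zero_add]

end Laurent

noncomputable section Laurent

set_option linter.unusedSectionVars false

open LaurentPolynomial

variable {Λ : Type u} [Ring Λ] [Algebra ℂ Λ] {p q m n n' w w' v : ℤ}

/-! ### The isomorphism `HH(Λ)[ı^{±1}, δ] ≅ HH(Λ[ı^{±1}])` -/

theorem bracket_euD_embH (k : w + w' = v) (h : p + q = n + 1) (y : HH (Bim.diag Λ) (p - 1))
    (x : HH (Bim.diag Λ) q) :
    GHH.bracket (lgr Λ) k h (euD Λ w p y) (embH Λ w' q x) =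
      embH Λ v n (-(w' • HH.mul (Pairing.diag Λ) (show p - 1 + q = n by omega) y x)) +
        euD Λ v n (sg (q - 1) • HH.bracket Λ (show p - 1 + q = n - 1 + 1 by omega) y x) := by
  rw [GHH.bracket_antisymm k ((add_comm _ _).trans k) h ((add_comm _ _).trans h), bracket_embH_euD,
    HH.mul_comm _ (show p - 1 + q = n by omega), HH.bracket_antisymm _ (show p - 1 + q = n - 1 + 1 by omega)]
  have e1 : sg ((p - 1) * (q - 1)) * (sg (p - 1) * w' * sg (q * (p - 1))) = w' := by
    rw [mul_right_comm, ← mul_assoc, ← sg_add, ← sg_add,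
      sg_congr (n := 0) ⟨(p - 1) * q, by ring⟩, sg_zero, one_mul]
  have e2 : sg ((p - 1) * (q - 1)) * sg ((q - 1) * (p - 1 - 1)) = sg (q - 1) := by
    rw [← sg_add, sg_congr]
    exact ⟨(q - 1) * (p - 2), by ring⟩
  simp only [smul_add, neg_add, smul_neg, neg_neg, map_neg, map_zsmul, smul_smul, e1, e2]

theorem gerst_map_C_eq_zero {f g : List Λ[T;T⁻¹] → Λ[T;T⁻¹]} (hf : f ∈ ML Λ[T;T⁻¹] Λ[T;T⁻¹])
    (hg : g ∈ ML Λ[T;T⁻¹] Λ[T;T⁻¹]) (hf' : ∀ l : List Λ, f (l.map C) = 0)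
    (hg' : ∀ l : List Λ, g (l.map C) = 0) (l : List Λ) : gerst p q f g (l.map C) = 0 := by
  rw [gerst, Pi.sub_apply, Pi.smul_apply, brace_map_C_eq_zero _ hf hg', brace_map_C_eq_zero _ hg hf', smul_zero,
    sub_zero]

theorem bracket_euD_euD (k : w + w' = v) (h : p + q = n + 1) (y : HH (Bim.diag Λ) (p - 1))
    (y' : HH (Bim.diag Λ) (q - 1)) :
    GHH.bracket (lgr Λ) k h (euD Λ w p y) (euD Λ w' q y') =
      euD Λ v n ((w - w') • HH.mul (Pairing.diag Λ) (show p - 1 + (q - 1) = n - 1 by omega) y y') := by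
  -- Both sides vanish on `Λ`, as `δ` does, and the brackets with `ı` involve at most one factor `δ`.
  refine ghh_ext ?_ ?_
  · rw [jStar_euD]
    obtain ⟨f, hf, rfl⟩ := coho_mk_surj y
    obtain ⟨g, hg, rfl⟩ := coho_mk_surj y'
    refine (coho_mk_eq_zero (D := d (Lw Λ v)) (C := Coch (Lw Λ v))).mpr ⟨0, zero_mem _, ?_⟩
    refine (map_zero (d (Lw Λ v))).trans (jCoch_eq_zero fun l => ?_).symm
    have hM : ∀ {r : ℤ} {f : List Λ → (Bim.diag Λ).carrier} (w : ℤ), f ∈ Zc (Bim.diag Λ) r →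
        scupA r 1 (emb Λ w f) (coch1 (eulerMap Λ)) ∈ ML Λ[T;T⁻¹] Λ[T;T⁻¹] := fun w hf =>
      zsmul_mem (cup_mem_ML _ (emb_mem_ML w hf.1.1) (coch1_mem (eulerMap Λ)).1) _
    exact gerst_map_C_eq_zero (hM w hf) (hM w' hg) (scupA_euler_map_C _) (scupA_euler_map_C _) l
  · have e : -sg (q - 1) = sg (q - 1 - 1) := by rw [sub_eq_add_neg (q - 1), sg_add, sg_neg, sg_one]; ring
    rw [iotaBr_bracket, iotaBr_euD, iotaBr_euD, iotaBr_euD, map_neg, map_neg, LinearMap.neg_apply,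
      bracket_euD_embH, bracket_embH_euD, ← e]
    simp only [map_neg, map_zsmul, smul_add, smul_neg, neg_smul, smul_smul, map_add, map_sub, sub_smul, add_smul, one_smul,
      ← mul_assoc, sg_mul_self, one_mul]
    abel

/-- The square of `δ` vanishes, as `δ` has odd degree and `2` is invertible. -/
theorem euler_mul_euler (h : 1 + 1 = n) :
    GHH.mul (lgr Λ) (add_zero 0) h (eulerClass Λ) (eulerClass Λ) = 0 := by
  have h := GHH.mul_comm (𝒜 := lgr Λ) (add_zero 0) (add_zero 0) h h (eulerClass Λ) (eulerClass Λ)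
  rw [mul_one, sg_one, neg_one_smul] at h
  have h2 := eq_neg_iff_add_eq_zero.mp h
  rw [← two_smul ℂ] at h2
  exact (smul_eq_zero.mp h2).resolve_left two_ne_zero

theorem embH_mul_euD (k : w + w' = v) (h : p + q = n) (x : HH (Bim.diag Λ) p)
    (y : HH (Bim.diag Λ) (q - 1)) :
    GHH.mul (lgr Λ) k h (embH Λ w p x) (euD Λ w' q y) =
      euD Λ v n (HH.mul (Pairing.diag Λ) (show p + (q - 1) = n - 1 by omega) x y) := by
  rw [euD_apply, euD_apply, ← embH_mul k, GHH.mul_assoc]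

theorem euD_mul_embH (k : w + w' = v) (h : p + q = n) (y : HH (Bim.diag Λ) (p - 1))
    (x : HH (Bim.diag Λ) q) :
    GHH.mul (lgr Λ) k h (euD Λ w p y) (embH Λ w' q x) =
      euD Λ v n (sg q • HH.mul (Pairing.diag Λ) (show p - 1 + q = n - 1 by omega) y x) := by
  rw [euD_apply, GHH.mul_assoc _ _ (zero_add w') k _ _ (add_comm 1 q) (show p - 1 + (q + 1) = n by omega),
    GHH.mul_comm _ (add_zero w') _ rfl, one_mul, map_zsmul, ← GHH.mul_assoc k (add_zero v) (add_zero w') k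
      (show p - 1 + q = n - 1 by omega) (sub_add_cancel n 1) rfl, embH_mul, map_zsmul, euD_apply]

theorem euD_mul_euD (k : w + w' = v) (h : p + q = n) (y : HH (Bim.diag Λ) (p - 1))
    (y' : HH (Bim.diag Λ) (q - 1)) : GHH.mul (lgr Λ) k h (euD Λ w p y) (euD Λ w' q y') = 0 := by
  rw [euD_apply (w := w'), ← GHH.mul_assoc k (add_zero v) (add_zero w') k
    (show p + (q - 1) = n - 1 by omega) (sub_add_cancel n 1), euD_mul_embH, euD_apply,
    GHH.mul_assoc _ _ (add_zero 0) (add_zero v) _ _ rfl (show n - 1 - 1 + (1 + 1) = n by omega), euler_mul_euler, map_zero]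

variable (Λ)

/-- The map `(x, y) ↦ (x + y δ) ı^w`. -/
def phiMap (w p : ℤ) : UE Λ p →ₗ[ℂ] GHH (lgr Λ) w p := (embH Λ w p).coprod (euD Λ w p)

variable {Λ}

theorem phiMap_apply (a : UE Λ p) : phiMap Λ w p a = embH Λ w p a.1 + euD Λ w p a.2 :=
  LinearMap.coprod_apply _ _ a

theorem phiMap_mul (k : w + w' = v) (h : p + q = n) (a : UE Λ p) (b : UE Λ q) :
    phiMap Λ v n (UE.mul h a b) = GHH.mul (lgr Λ) k h (phiMap Λ w p a) (phiMap Λ w' q b) := by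
  rw [phiMap_apply, phiMap_apply, phiMap_apply, map_add, map_add, LinearMap.add_apply, LinearMap.add_apply,
    embH_mul, embH_mul_euD, euD_mul_embH, euD_mul_euD, UE.mul, map_add]
  abel

theorem phiMap_bracket (k : w + w' = v) (h : p + q = n + 1) (a : UE Λ p) (b : UE Λ q) :
    phiMap Λ v n (UE.bracket w w' h a b) = GHH.bracket (lgr Λ) k h (phiMap Λ w p a) (phiMap Λ w' q b) := by
  rw [phiMap_apply, phiMap_apply, phiMap_apply, map_add, map_add, LinearMap.add_apply, LinearMap.add_apply,
    embH_bracket, bracket_embH_euD, bracket_euD_embH, bracket_euD_euD, UE.bracket, map_add, map_add, map_add,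
    map_sub, map_neg]
  abel

variable (Λ) in
/-- The multiplication by `ı^{-w}`, the inverse of `iotaMul`. -/
def iotaInv (w : ℤ) : (Lw Λ w).carrier →ₗ[ℂ] (Bim.diag Λ).carrier := eps Λ ∘ₗ (lgr Λ w).subtype

theorem iotaInv_isHom (w : ℤ) : Bim.IsHom (X := Lw Λ w) (Y := Bim.diag Λ) (iotaInv Λ w) where
  map_l a (x : lgr Λ w) := (eps_mul (C a) x.1).trans (congrArg (· * eps Λ x.1) (eps_C a))
  map_r a (x : lgr Λ w) := (eps_mul x.1 (C a)).trans (congrArg (eps Λ x.1 * ·) (eps_C a))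

theorem iotaInv_iotaMul (w : ℤ) : iotaInv Λ w ∘ₗ iotaMul Λ w = LinearMap.id :=
  LinearMap.ext fun (x : Λ) => eps_single w x

theorem iotaMul_iotaInv (w : ℤ) : iotaMul Λ w ∘ₗ iotaInv Λ w = LinearMap.id :=
  LinearMap.ext fun x => Subtype.ext (single_eps (Subtype.property (p := (· ∈ lgr Λ w)) x))

theorem HH.map_mul {A : Type u} [Ring A] [Algebra ℂ A] {M N P M' N' P' : Bim A} (γ : Pairing M N P)
    (γ' : Pairing M' N' P') {φ : M.carrier →ₗ[ℂ] M'.carrier} (hφ : Bim.IsHom φ)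
    {ψ : N.carrier →ₗ[ℂ] N'.carrier} (hψ : Bim.IsHom ψ) {χ : P.carrier →ₗ[ℂ] P'.carrier} (hχ : Bim.IsHom χ)
    (H : ∀ x y, γ'.toFun (φ x) (ψ y) = χ (γ.toFun x y)) (h : p + q = n) (x : HH M p) (y : HH N q) :
    HH.map hχ n (HH.mul γ h x y) = HH.mul γ' h (HH.map hφ p x) (HH.map hψ q y) := by
  obtain ⟨f, hf, rfl⟩ := coho_mk_surj x
  obtain ⟨g, hg, rfl⟩ := coho_mk_surj y
  refine coho_mk_congr (funext fun l => ?_)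
  change χ (sg (p * q) • cup γ.toFun f g l) = sg (p * q) • cup γ'.toFun (post φ f) (post ψ g) l
  rw [map_zsmul, cup, map_sum]
  exact congrArg _ (Finset.sum_congr rfl fun i _ => (H _ _).symm)

theorem HH.map_map {A : Type u} [Ring A] [Algebra ℂ A] {X Y : Bim A} {φ : X.carrier →ₗ[ℂ] Y.carrier}
    (hφ : Bim.IsHom φ) {ψ : Y.carrier →ₗ[ℂ] X.carrier} (hψ : Bim.IsHom ψ) (h : ψ ∘ₗ φ = LinearMap.id) :
    HH.map hψ p ∘ₗ HH.map hφ p = LinearMap.id := LinearMap.ext fun x => by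
  obtain ⟨f, hf, rfl⟩ := coho_mk_surj x
  exact coho_mk_congr (funext fun l => LinearMap.congr_fun h (f l))

variable (Λ) in
/-- The isomorphism of Hochschild cohomology groups given by the multiplication by `ı^w` on coefficients. -/
def psiEquiv (p w : ℤ) : HH (Bim.diag Λ) p ≃ₗ[ℂ] HH (Lw Λ w) p :=
  LinearEquiv.ofLinearMap (HH.map (iotaMul_isHom Λ w) p) (HH.map (iotaInv_isHom w) p)
    (HH.map_map _ _ (iotaMul_iotaInv w)) (HH.map_map _ _ (iotaInv_iotaMul w))

theorem psiEquiv_apply (x : HH (Bim.diag Λ) p) : psiEquiv Λ p w x = HH.map (iotaMul_isHom Λ w) p x := rfl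

theorem Lw_mul_iotaMul (k : w + w' = v) (x y : (Bim.diag Λ).carrier) :
    (Lw.mul Λ k).toFun (iotaMul Λ w x) (iotaMul Λ w' y) = iotaMul Λ v ((Pairing.diag Λ).toFun x y) := by
  revert x y
  intro (x : Λ) (y : Λ)
  refine Subtype.ext ?_
  change AddMonoidAlgebra.single w x * AddMonoidAlgebra.single w' y = AddMonoidAlgebra.single v (x * y)
  rw [AddMonoidAlgebra.single_mul_single, k]

theorem psiEquiv_mul (k : w + w' = v) (h : p + q = n) (x : HH (Bim.diag Λ) p) (y : HH (Bim.diag Λ) q) :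
    psiEquiv Λ n v (HH.mul (Pairing.diag Λ) h x y) =
      HH.mul (Lw.mul Λ k) h (psiEquiv Λ p w x) (psiEquiv Λ q w' y) :=
  HH.map_mul _ _ (iotaMul_isHom Λ w) (iotaMul_isHom Λ w') (iotaMul_isHom Λ v) (Lw_mul_iotaMul k) h x y

theorem psiEquiv_one : psiEquiv Λ 0 0 (oneHH Λ rfl) = oneRel Λ :=
  coho_mk_congr (funext fun l => by
    rcases l with _ | ⟨a, t⟩
    · rfl
    · exact map_zero (iotaMul Λ 0))

theorem jStar_phiMap (a : UE Λ p) : jStar Λ w p (phiMap Λ w p a) = psiEquiv Λ p w a.1 := by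
  rw [phiMap_apply, map_add, jStar_embH, jStar_euD, add_zero, psiEquiv_apply]

theorem iotaBr_phiMap (a : UE Λ p) : iotaBr w p (phiMap Λ w p a) = -embH Λ (w + 1) (p - 1) a.2 := by
  rw [phiMap_apply, map_add, iotaBr_embH, iotaBr_euD, zero_add]

/-- The two restrictions of `(x + y δ) ı^w` are, up to sign and up to powers of `ı`, the classes `x` and `y`,
and a class is determined by its two restrictions. -/
theorem phiMap_bijective (w p : ℤ) : Function.Bijective (phiMap Λ w p) := by
  constructor
  · refine (injective_iff_map_eq_zero _).mpr fun a ha => ?_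
    have h1 := jStar_phiMap (w := w) a
    have h2 := congrArg (jStar Λ (w + 1) (p - 1)) (iotaBr_phiMap (w := w) a)
    rw [ha, map_zero] at h1
    rw [ha, map_zero, map_zero, map_neg, jStar_embH, ← psiEquiv_apply] at h2
    exact Prod.ext ((psiEquiv Λ p w).map_eq_zero_iff.mp h1.symm)
      ((psiEquiv Λ (p - 1) (w + 1)).map_eq_zero_iff.mp (neg_eq_zero.mp h2.symm))
  · intro z
    refine ⟨((psiEquiv Λ p w).symm (jStar Λ w p z),
      -(psiEquiv Λ (p - 1) (w + 1)).symm (jStar Λ (w + 1) (p - 1) (iotaBr w p z))), ghh_ext ?_ ?_⟩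
    · rw [jStar_phiMap, LinearEquiv.apply_symm_apply]
    · rw [iotaBr_phiMap, map_neg, jStar_embH, ← psiEquiv_apply, map_neg, LinearEquiv.apply_symm_apply, neg_neg]

variable (Λ) in
/-- The isomorphism from the elements of bidegree `(p, -2w)` of `HH(Λ)[ı^{±1}, δ]` to the part of weight `w` of
the cohomology of `Λ[ı^{±1}]`. -/
def phiEquiv (p w : ℤ) : UE Λ p ≃ₗ[ℂ] GHH (lgr Λ) w p :=
  LinearEquiv.ofBijective (phiMap Λ w p) (phiMap_bijective w p)

theorem jStar_eq_zero_iff (z : GHH (lgr Λ) w p) : jStar Λ w p z = 0 ↔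
    ∃ y : GHH (lgr Λ) w (p - 1), z = GHH.mul (lgr Λ) (add_zero w) (sub_add_cancel p 1) y (eulerClass Λ) := by
  constructor
  · intro h
    obtain ⟨a, rfl⟩ := (phiMap_bijective w p).2 z
    rw [jStar_phiMap, LinearEquiv.map_eq_zero_iff] at h
    exact ⟨embH Λ w (p - 1) a.2, by rw [phiMap_apply, h, map_zero, zero_add, euD_apply]⟩
  · rintro ⟨y, rfl⟩
    exact jStar_mul_euler _ _ _

theorem phiMap_one : phiMap Λ 0 0 (oneHH Λ rfl, 0) = oneClass Λ := by
  rw [phiMap_apply, map_zero, add_zero, embH_one_zero]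

theorem phiMap_iota : phiMap Λ 1 0 (oneHH Λ rfl, 0) = iotaClass Λ := by
  rw [phiMap_apply, map_zero, add_zero, embH_one_one]

theorem phiMap_euler : phiMap Λ 0 1 (0, oneHH Λ (sub_self 1)) = eulerClass Λ := by
  rw [phiMap_apply, map_zero, zero_add]
  refine ghh_ext ?_ ?_
  · rw [jStar_euD]
    exact ((coho_mk_eq_zero (D := d (Lw Λ 0)) (C := Coch (Lw Λ 0))).mpr ⟨0, zero_mem _,
      (map_zero (d (Lw Λ 0))).trans (jCoch_eq_zero coch1_eulerMap_map_C).symm⟩).symm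
  · rw [iotaBr_euD, iotaBr_euler]

theorem HH.bracket_one_left (h : 0 + p = n + 1) (x : HH (Bim.diag Λ) p) :
    HH.bracket Λ h (oneHH Λ rfl) x = 0 := by
  rw [HH.bracket_antisymm h (by omega), HH.bracket_one, smul_zero, neg_zero]

theorem bracket_iota_embH (h : 0 + p = n + 1) (x : HH (Bim.diag Λ) p) :
    GHH.bracket (lgr Λ) (add_zero 1) h (iotaClass Λ) (embH Λ 0 p x) = 0 := by
  rw [← embH_one_one, embH_bracket, HH.bracket_one_left, map_zero]

theorem bracket_iota_iota (k : 1 + 1 = w) (h : 0 + 0 = n + 1) :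
    GHH.bracket (lgr Λ) k h (iotaClass Λ) (iotaClass Λ) = 0 := by
  rw [← embH_one_one, embH_bracket, HH.bracket_one, map_zero]

theorem bracket_euler_embH (x : HH (Bim.diag Λ) p) :
    GHH.bracket (lgr Λ) (add_zero 0) (add_comm 1 p) (eulerClass Λ) (embH Λ 0 p x) = 0 := by
  have h : ∀ {i : ℤ} (hi : i = 0) (h : i + p = p - 1 + 1), HH.bracket Λ h (oneHH Λ hi) x = 0 := by
    rintro _ rfl h; exact HH.bracket_one_left h x
  rw [← phiMap_euler, phiMap_apply, map_zero, zero_add, bracket_euD_embH, h, smul_zero, map_zero, zero_smul,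
    neg_zero, map_zero, add_zero]

theorem bracket_euler_iota (h : (1 : ℤ) + 0 = 0 + 1) :
    GHH.bracket (lgr Λ) (zero_add 1) h (eulerClass Λ) (iotaClass Λ) = -iotaClass Λ := by
  have h := iotaBr_euler (Λ := Λ)
  have h1 : embH Λ (0 + 1) (1 - 1) (oneHH Λ (sub_self 1)) = iotaClass Λ := embH_one_one
  rw [h1] at h
  exact h

end Laurent

noncomputable section TateFunctoriality

/-! ### Functoriality of Tate–Hochschild cohomology in the coefficients -/

variable {A : Type u} [Ring A] [Algebra ℂ A] {X Y Z : Bim A}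

/-- The map `A ⊗ X → A ⊗ Y` induced by `φ : X → Y`. -/
def tensMap (φ : X.carrier →ₗ[ℂ] Y.carrier) : X.tens.carrier →ₗ[ℂ] Y.tens.carrier := LinearMap.lTensor A φ

theorem tensMap_tm (φ : X.carrier →ₗ[ℂ] Y.carrier) (a : A) (x : X.carrier) :
    tensMap φ (tm X a x) = tm Y a (φ x) := rfl

theorem tensMap_isHom {φ : X.carrier →ₗ[ℂ] Y.carrier} (hφ : Bim.IsHom φ) : Bim.IsHom (tensMap φ) where
  map_l a := tens_ext (tensMap φ ∘ₗ X.tens.l a) (Y.tens.l a ∘ₗ tensMap φ) fun _ _ => rfl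
  map_r a := tens_ext (tensMap φ ∘ₗ X.tens.r a) (Y.tens.r a ∘ₗ tensMap φ) fun b x =>
    congrArg (tm Y b) (hφ.map_r a x)

theorem act_tensMap {φ : X.carrier →ₗ[ℂ] Y.carrier} (hφ : Bim.IsHom φ) (t : X.tens.carrier) :
    act Y (tensMap φ t) = φ (act X t) :=
  tens_ext (act Y ∘ₗ tensMap φ) (φ ∘ₗ act X) (fun a x => by
    rw [LinearMap.comp_apply, LinearMap.comp_apply, tensMap_tm, act_tm, act_tm, hφ.map_l]) t

/-- The map `Ω X → Ω Y` induced by a homomorphism `φ : X → Y`. -/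
def syzMap {φ : X.carrier →ₗ[ℂ] Y.carrier} (hφ : Bim.IsHom φ) : X.syz.carrier →ₗ[ℂ] Y.syz.carrier :=
  (tensMap φ).restrict (p := LinearMap.ker (act X)) (q := LinearMap.ker (act Y)) fun t ht => by
    rw [LinearMap.mem_ker, act_tensMap hφ, LinearMap.mem_ker.mp ht, map_zero]

theorem syzInc_syzMap {φ : X.carrier →ₗ[ℂ] Y.carrier} (hφ : Bim.IsHom φ) (t : X.syz.carrier) :
    syzInc Y (syzMap hφ t) = tensMap φ (syzInc X t) := rfl

theorem syzMap_isHom {φ : X.carrier →ₗ[ℂ] Y.carrier} (hφ : Bim.IsHom φ) : Bim.IsHom (syzMap hφ) where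
  map_l a t := syzInc_inj Y ((tensMap_isHom hφ).map_l a (syzInc X t))
  map_r a t := syzInc_inj Y ((tensMap_isHom hφ).map_r a (syzInc X t))

theorem syzMap_kap {φ : X.carrier →ₗ[ℂ] Y.carrier} (hφ : Bim.IsHom φ) (a : A) (x : X.carrier) :
    syzMap hφ (kap X a x) = kap Y a (φ x) := by
  refine syzInc_inj Y ?_
  rw [syzInc_syzMap, syzInc_kap, syzInc_kap, map_sub, tensMap_tm, tensMap_tm, hφ.map_l]

/-- The homomorphism `Ω^k X → Ω^k Y` induced by a homomorphism `φ : X → Y`. -/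
def syzNMap {φ : X.carrier →ₗ[ℂ] Y.carrier} (hφ : Bim.IsHom φ) :
    ∀ k, {ψ : (X.syzN k).carrier →ₗ[ℂ] (Y.syzN k).carrier // Bim.IsHom ψ}
  | 0 => ⟨φ, hφ⟩
  | k + 1 => ⟨syzMap (syzNMap hφ k).2, syzMap_isHom (syzNMap hφ k).2⟩

theorem syzNMap_syzNMap {φ : X.carrier →ₗ[ℂ] Y.carrier} (hφ : Bim.IsHom φ)
    {ψ : Y.carrier →ₗ[ℂ] X.carrier} (hψ : Bim.IsHom ψ) (h : ψ ∘ₗ φ = LinearMap.id) :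
    ∀ (k : ℕ) (x : (X.syzN k).carrier), (syzNMap hψ k).1 ((syzNMap hφ k).1 x) = x
  | 0, x => LinearMap.congr_fun h x
  | k + 1, x => by
    revert x
    change ∀ x : (X.syzN k).syz.carrier, syzMap (syzNMap hψ k).2 (syzMap (syzNMap hφ k).2 x) = x
    intro x
    refine syzInc_inj _ ?_
    rw [syzInc_syzMap, syzInc_syzMap]
    refine tens_ext (tensMap (syzNMap hψ k).1 ∘ₗ tensMap (syzNMap hφ k).1) LinearMap.id (fun a y => ?_) _
    rw [LinearMap.comp_apply, tensMap_tm, tensMap_tm, syzNMap_syzNMap hφ hψ h k]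
    rfl

theorem om_post {φ : X.carrier →ₗ[ℂ] Y.carrier} (hφ : Bim.IsHom φ) (f : List A → X.carrier) :
    om Y (post φ f) = post (syzMap hφ) (om X f) := by
  funext l
  rcases l with _ | ⟨a, t⟩
  · exact (map_zero (syzMap hφ)).symm
  · exact (syzMap_kap hφ a (f t)).symm

theorem omS_post {φ : X.carrier →ₗ[ℂ] Y.carrier} (hφ : Bim.IsHom φ) (k : ℕ)
    (f : List A → (X.syzN k).carrier) :
    omS Y k (post (syzNMap hφ k).1 f) = post (syzNMap hφ (k + 1)).1 (omS X k f) :=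
  om_post (syzNMap hφ k).2 f

theorem omN_post {φ : X.carrier →ₗ[ℂ] Y.carrier} (hφ : Bim.IsHom φ) (f : List A → X.carrier) :
    ∀ k, omN Y k (post φ f) = post (syzNMap hφ k).1 (omN X k f)
  | 0 => rfl
  | k + 1 => (congrArg (omS Y k) (omN_post hφ f k)).trans (omS_post hφ k (omN X k f))

/-- The map on families of homomorphisms induced by a homomorphism of bimodules. -/
def TateFam.map {φ : X.carrier →ₗ[ℂ] Y.carrier} (hφ : Bim.IsHom φ) (n : ℤ) :
    TateFam X n →ₗ[ℂ] TateFam Y n where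
  toFun x := ⟨fun k => post (syzNMap hφ k).1 (x.1 k), fun k => Zc.map (syzNMap hφ k).2 (x.2.1 k), by
    obtain ⟨K, hK⟩ := x.2.2
    refine ⟨K, fun k hk => ?_⟩
    have h := Nul.map (syzNMap hφ (k + 1)).2 (hK k hk)
    rw [map_sub, ← omS_post] at h
    exact h⟩
  map_add' x y := Subtype.ext (funext fun k => map_add (post (syzNMap hφ k).1) (x.1 k) (y.1 k))
  map_smul' c x := Subtype.ext (funext fun k => map_smul (post (syzNMap hφ k).1) c (x.1 k))

/-- The functoriality of Tate–Hochschild cohomology in the coefficients. -/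
def Tate.map {φ : X.carrier →ₗ[ℂ] Y.carrier} (hφ : Bim.IsHom φ) (n : ℤ) : Tate X n →ₗ[ℂ] Tate Y n :=
  (TateNul X n).mapQ (TateNul Y n) (TateFam.map hφ n) fun x hx => by
    obtain ⟨K, hK⟩ := hx
    exact ⟨K, fun k hk => Nul.map (syzNMap hφ k).2 (hK k hk)⟩

theorem Tate.map_map {φ : X.carrier →ₗ[ℂ] Y.carrier} (hφ : Bim.IsHom φ)
    {ψ : Y.carrier →ₗ[ℂ] X.carrier} (hψ : Bim.IsHom ψ) (h : ψ ∘ₗ φ = LinearMap.id) (n : ℤ) :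
    Tate.map hψ n ∘ₗ Tate.map hφ n = LinearMap.id := LinearMap.ext fun x => by
  obtain ⟨x, rfl⟩ := Submodule.mkQ_surjective _ x
  exact congrArg (TateNul X n).mkQ (Subtype.ext (funext fun k => funext fun l =>
    syzNMap_syzNMap hφ hψ h k (x.1 k l)))

/-- The comparison map is natural in the coefficients. -/
theorem comparison_map {φ : X.carrier →ₗ[ℂ] Y.carrier} (hφ : Bim.IsHom φ) (hX : X.RProj) (hY : Y.RProj)
    (p : ℤ) (x : HH X p) : comparison Y hY p (HH.map hφ p x) = Tate.map hφ p (comparison X hX p x) := by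
  obtain ⟨f, hf, rfl⟩ := coho_mk_surj x
  exact congrArg (TateNul Y p).mkQ (Subtype.ext (funext fun k => omN_post hφ f k))

variable {M N P M' N' P' : Bim A} {γ : Pairing M N P} {γ' : Pairing M' N' P'}
  {φ : M.carrier →ₗ[ℂ] M'.carrier} {ψ : N.carrier →ₗ[ℂ] N'.carrier} {χ : P.carrier →ₗ[ℂ] P'.carrier}

theorem Pairing.syzN_syzNMap (hφ : Bim.IsHom φ) (hχ : Bim.IsHom χ)
    (H : ∀ x y, γ'.toFun (φ x) (ψ y) = χ (γ.toFun x y)) :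
    ∀ (k : ℕ) (x : (M.syzN k).carrier) (y : N.carrier),
      (γ'.syzN k).toFun ((syzNMap hφ k).1 x) (ψ y) = (syzNMap hχ k).1 ((γ.syzN k).toFun x y)
  | 0, x, y => H x y
  | k + 1, x, y => by
    revert x
    change ∀ x : (M.syzN k).syz.carrier, (γ'.syzN k).syz.toFun (syzMap (syzNMap hφ k).2 x) (ψ y) =
      syzMap (syzNMap hχ k).2 ((γ.syzN k).syz.toFun x y)
    intro x
    refine syzInc_inj _ ?_
    rw [Pairing.syzInc_syz, syzInc_syzMap, syzInc_syzMap, Pairing.syzInc_syz]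
    refine tens_ext ((γ'.syzN k).tens.toFun.flip (ψ y) ∘ₗ tensMap (syzNMap hφ k).1)
      (tensMap (syzNMap hχ k).1 ∘ₗ (γ.syzN k).tens.toFun.flip y) (fun a z => ?_) _
    rw [LinearMap.comp_apply, LinearMap.comp_apply, tensMap_tm, LinearMap.flip_apply, LinearMap.flip_apply,
      Pairing.tens_tm, Pairing.tens_tm, tensMap_tm, Pairing.syzN_syzNMap hφ hχ H k]

theorem ev_syzNMap (hψ : Bim.IsHom ψ) (H : ∀ x y, γ'.toFun (φ x) (ψ y) = χ (γ.toFun x y)) :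
    ∀ (j : ℕ) (f : ML A M.carrier) (z : (N.syzN j).carrier),
      ev γ' j ⟨fun l => φ (f.1 l), ML.comp f.2 φ⟩ ((syzNMap hψ j).1 z) = χ (ev γ j f z)
  | 0, f, z => H _ z
  | j + 1, f, z => by
    revert z
    change ∀ z : (N.syzN j).syz.carrier, ev γ' (j + 1) _ (syzMap (syzNMap hψ j).2 z) = χ (ev γ (j + 1) f z)
    intro z
    rw [ev_succ, ev_succ, syzInc_syzMap]
    refine tens_ext (evT (N'.syzN j) (ev γ' j) _ ∘ₗ tensMap (syzNMap hψ j).1)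
      (χ ∘ₗ evT (N.syzN j) (ev γ j) f) (fun a x => ?_) (syzInc (N.syzN j) z)
    rw [LinearMap.comp_apply, LinearMap.comp_apply, tensMap_tm, evT_tm, evT_tm, ← ev_syzNMap hψ H j]
    rfl

/-- The products in Tate–Hochschild cohomology are natural with respect to morphisms of pairings. -/
theorem Tate.map_mul (hφ : Bim.IsHom φ) (hψ : Bim.IsHom ψ) (hχ : Bim.IsHom χ) (hP : P.RProj) (hP' : P'.RProj)
    (H : ∀ x y, γ'.toFun (φ x) (ψ y) = χ (γ.toFun x y)) {p q n : ℤ} (h : p + q = n) (x : Tate M p)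
    (y : Tate N q) :
    Tate.map hχ n (Tate.mul γ hP h x y) = Tate.mul γ' hP' h (Tate.map hφ p x) (Tate.map hψ q y) := by
  obtain ⟨x, rfl⟩ := Submodule.mkQ_surjective _ x
  obtain ⟨y, rfl⟩ := Submodule.mkQ_surjective _ y
  refine congrArg (TateNul P' n).mkQ (Subtype.ext (funext fun k => ?_))
  refine (map_zsmul (post (syzNMap hχ k).1) (sg (p * q)) (famComp γ x y k (p + k).toNat)).trans ?_
  refine congrArg (sg (p * q) • ·) (funext fun l => ?_)
  exact (ev_syzNMap hψ (Pairing.syzN_syzNMap hφ hχ H k) _ (famML x k) (y.1 _ l)).symm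

/-- The isomorphism of Tate–Hochschild cohomology groups given by the multiplication by `ı^w` on
coefficients. -/
def thetaEquiv (Λ : Type u) [Ring Λ] [Algebra ℂ Λ] (n w : ℤ) : Tate (Bim.diag Λ) n ≃ₗ[ℂ] Tate (Lw Λ w) n :=
  LinearEquiv.ofLinearMap (Tate.map (iotaMul_isHom Λ w) n) (Tate.map (iotaInv_isHom w) n)
    (Tate.map_map _ _ (iotaMul_iotaInv w) n) (Tate.map_map _ _ (iotaInv_iotaMul w) n)

end TateFunctoriality

end HochschildTate

theorem mainTheorem7 (Λ : Type u) [Ring Λ] [Algebra ℂ Λ] :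
    ∃ (Φ : ∀ p w : ℤ, UE Λ p ≃ₗ[ℂ] GHH (lgr Λ) w p)
      (Ψ : ∀ p w : ℤ, HH (Bim.diag Λ) p ≃ₗ[ℂ]
        HH (Lw Λ w) p)
      (Θ : ∀ n w : ℤ, Tate (Bim.diag Λ) n ≃ₗ[ℂ]
        Tate (Lw Λ w) n),
      -- the algebra `HH(Λ[ı^{±1}], Λ[ı^{±1}])` is graded commutative
      (∀ (p q n w w' v : ℤ) (h : p + q = n) (k : w + w' = v) (a : GHH (lgr Λ) w p)
          (b : GHH (lgr Λ) w' q),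
        GHH.mul (lgr Λ) k h a b =
          sg (p * q) • GHH.mul (lgr Λ)
            ((add_comm w' w).trans k) ((add_comm q p).trans h) b a) ∧
      -- `Φ` is an isomorphism of algebras, and it preserves `ı` and `δ`
      (∀ (p q n w w' v : ℤ) (h : p + q = n) (k : w + w' = v) (a : UE Λ p)
          (b : UE Λ q),
        Φ n v (UE.mul h a b) =
          GHH.mul (lgr Λ) k h (Φ p w a) (Φ q w' b)) ∧
      Φ 0 0 (oneHH Λ rfl, 0) = oneClass Λ ∧
      Φ 0 1 (oneHH Λ rfl, 0) = iotaClass Λ ∧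
      Φ 1 0 (0, oneHH Λ (sub_self 1)) = eulerClass Λ ∧
      -- the bracket
      (∀ (p q n w w' v : ℤ) (h : p + q = n + 1) (k : w + w' = v) (a : UE Λ p)
          (b : UE Λ q),
        Φ n v (UE.bracket w w' h a b) =
          GHH.bracket (lgr Λ) k h (Φ p w a) (Φ q w' b)) ∧
      (∀ (p : ℤ) (x : HH (Bim.diag Λ) p),
        GHH.bracket (lgr Λ) (add_zero 1)
          (show 0 + p = p - 1 + 1 by omega) (iotaClass Λ) (Φ p 0 (x, 0)) = 0) ∧
      GHH.bracket (lgr Λ) (show (1 : ℤ) + 1 = 2 by omega)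
        (show (0 : ℤ) + 0 = -1 + 1 by omega) (iotaClass Λ) (iotaClass Λ) = 0 ∧
      (∀ (p : ℤ) (x : HH (Bim.diag Λ) p),
        GHH.bracket (lgr Λ) (add_zero 0) (add_comm 1 p)
          (eulerClass Λ) (Φ p 0 (x, 0)) = 0) ∧
      GHH.bracket (lgr Λ) (zero_add 1) (show (1 : ℤ) + 0 = 0 + 1 by omega)
        (eulerClass Λ) (iotaClass Λ) = -iotaClass Λ ∧
      -- `Ψ` is the isomorphism of algebras given by the multiplication by powers of `ı`
      (∀ (p w : ℤ) (x : HH (Bim.diag Λ) p),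
        Ψ p w x = HH.map (iotaMul_isHom Λ w) p x) ∧
      (∀ (p q n w w' v : ℤ) (h : p + q = n) (k : w + w' = v)
          (x : HH (Bim.diag Λ) p)
          (y : HH (Bim.diag Λ) q),
        Ψ n v (HH.mul (Pairing.diag Λ) h x y) =
          HH.mul (Lw.mul Λ k) h (Ψ p w x) (Ψ q w' y)) ∧
      Ψ 0 0 (oneHH Λ rfl) = oneRel Λ ∧
      -- the restriction `j^*` is the projection, and its kernel is the ideal generated by `δ`
      (∀ (p w : ℤ) (a : UE Λ p), jStar Λ w p (Φ p w a) = Ψ p w a.1) ∧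
      (∀ (p w : ℤ) (z : GHH (lgr Λ) w p),
        jStar Λ w p z = 0 ↔
          ∃ y : GHH (lgr Λ) w (p - 1),
            z = GHH.mul (lgr Λ) (add_zero w) (sub_add_cancel p 1) y
              (eulerClass Λ)) ∧
      -- `Θ` is an isomorphism of algebras, compatible with the comparison maps
      (∀ (p q n w w' v : ℤ) (h : p + q = n) (k : w + w' = v)
          (x : Tate (Bim.diag Λ) p)
          (y : Tate (Bim.diag Λ) q),
        Θ n v (Tate.mul (Pairing.diag Λ) (rproj_diag Λ) h x y) =
          Tate.mul (Lw.mul Λ k) (rproj_Lw v) h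
            (Θ p w x) (Θ q w' y)) ∧
      (∀ (p w : ℤ) (x : HH (Bim.diag Λ) p),
        comparison (Lw Λ w) (rproj_Lw w) p (Ψ p w x) =
          Θ p w (comparison (Bim.diag Λ) (rproj_diag Λ) p x)) := by
  refine ⟨phiEquiv Λ, psiEquiv Λ, thetaEquiv Λ, fun p q n w w' v h k a b => GHH.mul_comm _ _ _ _ a b,
    fun p q n w w' v h k a b => phiMap_mul k h a b, phiMap_one, phiMap_iota, phiMap_euler,
    fun p q n w w' v h k a b => phiMap_bracket k h a b, fun p x => ?_, bracket_iota_iota _ _, fun p x => ?_,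
    bracket_euler_iota _, fun p w x => rfl, fun p q n w w' v h k x y => psiEquiv_mul k h x y, psiEquiv_one,
    fun p w a => jStar_phiMap a, fun p w z => jStar_eq_zero_iff z,
    fun p q n w w' v h k x y => Tate.map_mul (iotaMul_isHom Λ w) (iotaMul_isHom Λ w') (iotaMul_isHom Λ v) _ _
      (Lw_mul_iotaMul k) h x y,
    fun p w x => comparison_map (iotaMul_isHom Λ w) _ _ p x⟩
  · have e : phiEquiv Λ p 0 (x, 0) = embH Λ 0 p x := (phiMap_apply _).trans (by rw [map_zero, add_zero])
    rw [e]
    exact bracket_iota_embH _ x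
  · have e : phiEquiv Λ p 0 (x, 0) = embH Λ 0 p x := (phiMap_apply _).trans (by rw [map_zero, add_zero])
    rw [e]
    exact bracket_euler_embH x
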